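/- Theorem 2.3. Let $(N^2,\sigma)$ be a complete Riemannian surface and equip $N\times\mathbb R$ with the product metric $\sigma+dr^2$. For each $n\ge 1$ let $\Omega_n\subset N$ be a connected open set, $u_n:\Omega_n\to\mathbb R$ a smooth function and $\Sigma_n=\{(x,u_n(x)):x\in\Omega_n\}$ its graph. Suppose that one of the following holds: (a) every $\Sigma_n$ is minimal, i.e. $\operatorname{div}\frac{Du_n}{\sqrt{1+|Du_n|^2}}=0$ on $\Omega_n$; (b) every $\Sigma_n$ has constant mean curvature, i.e. for each $n$ the function $\operatorname{div}\frac{Du_n}{\sqrt{1+|Du_n|^2}}$ is a constant $c_n$ on $\Omega_n$; (c) every $\Sigma_n$ is a translating graph, i.e. $\operatorname{div}\frac{Du_n}{\sqrt{1+|Du_n|^2}}=\frac{1}{\sqrt{1+|Du_n|^2}}$ on $\Omega_n$. Let $\Sigma$ be a connected (immersed) $C^2$ surface without boundary in $N\times\mathbb R$, given by a $C^2$ immersion $G:S\to N\times\mathbb R$ of a connected surface $S$. Suppose that the $\Sigma_n$ (or parts of them) converge to $\Sigma$ locally in $C^2$: there are maps $F_n:S\to N\times\mathbb R$ such that for each compact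 set $K\subset S$ and all sufficiently large $n$ the map $F_n$ is of class $C^2$ near $K$ and $F_n(K)\subset\Sigma_n$, and such that in local charts $F_n\to G$, together with all derivatives of order at most $2$, uniformly on compact sets. Then $\Sigma$ admits a continuous unit normal field $\vec v$ whose angle function $\Theta=\langle\vec v,\partial_r\rangle$ satisfies either $\Theta>0$ everywhere on $\Sigma$ or $\Theta\equiv 0$ on $\Sigma$. Consequently, for an arbitrary continuous unit normal field along $\Sigma$, the angle function is everywhere positive, everywhere negative, or identically zero. -/

import Mathlib

open Set Filter Topology Bundle Matrix
open scoped Manifold ContDiff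

noncomputable section

/-- Local `C^2` convergence (uniform convergence on compact sets, with all derivatives of order at
most two, in charts of the source and of the target) of a sequence of maps `F n`, each of which
only has to be of class `C^2` near a given compact set once `n` is large, to a map `G`. -/
def TendstoLocC2 {E E' H H' M M' : Type*}
    [NormedAddCommGroup E] [NormedSpace ℝ E] [TopologicalSpace H] (I : ModelWithCorners ℝ E H)
    [NormedAddCommGroup E'] [NormedSpace ℝ E'] [TopologicalSpace H'] (I' : ModelWithCorners ℝ E' H')
    [TopologicalSpace M] [ChartedSpace H M] [TopologicalSpace M'] [ChartedSpace H' M']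
    (F : ℕ → M → M') (G : M → M') : Prop :=
  ∀ φ ∈ atlas H M, ∀ ψ ∈ atlas H' M', ∀ K : Set M, IsCompact K → K ⊆ φ.source →
    MapsTo G K ψ.source →
      (∀ᶠ n in atTop, MapsTo (F n) K ψ.source ∧ ∀ s ∈ K, ContMDiffAt I I' 2 (F n) s) ∧
      ∀ k : ℕ, k ≤ 2 → TendstoUniformlyOn
        (fun n => iteratedFDeriv ℝ k (ψ.extend I' ∘ F n ∘ (φ.extend I).symm))
        (iteratedFDeriv ℝ k (ψ.extend I' ∘ G ∘ (φ.extend I).symm)) atTop (φ.extend I '' K)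

section Graphs

variable {N : Type*} [TopologicalSpace N] [ChartedSpace (EuclideanSpace ℝ (Fin 2)) N]

/-- The graph of `u` over `Ω`, as a subset of `N × ℝ`. -/
def graphOver (Ω : Set N) (u : N → ℝ) : Set (N × ℝ) :=
  {p | p.1 ∈ Ω ∧ p.2 = u p.1}

/-- `u` is a smooth function on the connected domain `Ω`, so that its graph over `Ω` is a smooth
connected graph in `N × ℝ`. -/
structure IsSmoothGraph (Ω : Set N) (u : N → ℝ) : Prop where
  isOpen : IsOpen Ω
  isConnected : IsConnected Ω
  smooth : ContMDiffOn (𝓡 2) 𝓘(ℝ, ℝ) ∞ u Ω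

/-- The `i`-th coordinate vector field of the chart `φ`, at the point with coordinates `y`. -/
def coordVec (φ : OpenPartialHomeomorph N (EuclideanSpace ℝ (Fin 2)))
    (y : EuclideanSpace ℝ (Fin 2)) (i : Fin 2) : TangentSpace (𝓡 2) (φ.symm y) :=
  mfderiv (𝓡 2) (𝓡 2) φ.symm y (EuclideanSpace.single i (1 : ℝ))

/-- The `i`-th partial derivative of a function of two real variables. -/
def partialD (i : Fin 2) (f : EuclideanSpace ℝ (Fin 2) → ℝ) (y : EuclideanSpace ℝ (Fin 2)) : ℝ :=
  fderiv ℝ f y (EuclideanSpace.single i (1 : ℝ))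

variable [RiemannianBundle (fun x : N => TangentSpace (𝓡 2) x)]

/-- The matrix `σ_ij` of the metric in the chart `φ`, at the point with coordinates `y`. -/
def metricMatrix (φ : OpenPartialHomeomorph N (EuclideanSpace ℝ (Fin 2)))
    (y : EuclideanSpace ℝ (Fin 2)) : Matrix (Fin 2) (Fin 2) ℝ :=
  Matrix.of fun i j => inner ℝ (coordVec φ y i) (coordVec φ y j)

/-- The component `(Du)^i = σ^ij ∂_j u` of the gradient of `u` in the chart `φ`. -/
def gradCoord (φ : OpenPartialHomeomorph N (EuclideanSpace ℝ (Fin 2))) (u : N → ℝ)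
    (y : EuclideanSpace ℝ (Fin 2)) (i : Fin 2) : ℝ :=
  ∑ j, (metricMatrix φ y)⁻¹ i j * partialD j (u ∘ φ.symm) y

/-- `√(1 + |Du|²)` in the chart `φ`, where `|Du|² = (Du)^i ∂_i u`. -/
def slopeFactor (φ : OpenPartialHomeomorph N (EuclideanSpace ℝ (Fin 2))) (u : N → ℝ)
    (y : EuclideanSpace ℝ (Fin 2)) : ℝ :=
  √(1 + ∑ i, gradCoord φ u y i * partialD i (u ∘ φ.symm) y)

/-- The Riemannian divergence `(det σ)^(-1/2) ∂_i ((det σ)^(1/2) X^i)` of the vector field with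
components `X^i` in the chart `φ`. -/
def divCoord (φ : OpenPartialHomeomorph N (EuclideanSpace ℝ (Fin 2)))
    (X : EuclideanSpace ℝ (Fin 2) → Fin 2 → ℝ) (y : EuclideanSpace ℝ (Fin 2)) : ℝ :=
  (√(metricMatrix φ y).det)⁻¹ *
    ∑ i, partialD i (fun z => √(metricMatrix φ z).det * X z i) y

/-- The mean curvature `H = -div (Du / √(1 + |Du|²))` of the graph of `u` in `N × ℝ`, above the
point with coordinates `y` in the chart `φ`. -/
def graphMeanCurvature (φ : OpenPartialHomeomorph N (EuclideanSpace ℝ (Fin 2))) (u : N → ℝ)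
    (y : EuclideanSpace ℝ (Fin 2)) : ℝ :=
  - divCoord φ (fun z i => gradCoord φ u z i / slopeFactor φ u z) y

/-- The graph of `u` over `Ω` has constant mean curvature `c`. -/
def HasConstMeanCurvature (Ω : Set N) (u : N → ℝ) (c : ℝ) : Prop :=
  ∀ φ ∈ atlas (EuclideanSpace ℝ (Fin 2)) N, ∀ y ∈ φ.target, φ.symm y ∈ Ω →
    graphMeanCurvature φ u y = c

/-- The graph of `u` over `Ω` is minimal. -/
def IsMinimalGraph (Ω : Set N) (u : N → ℝ) : Prop :=
  HasConstMeanCurvature Ω u 0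

/-- The graph of `u` over `Ω` is a CMC graph. -/
def IsCMCGraph (Ω : Set N) (u : N → ℝ) : Prop :=
  ∃ c : ℝ, HasConstMeanCurvature Ω u c

/-- The graph of `u` over `Ω` is a translating graph:
`div (Du / √(1 + |Du|²)) = 1 / √(1 + |Du|²)` on `Ω`. -/
def IsTranslatingGraph (Ω : Set N) (u : N → ℝ) : Prop :=
  ∀ φ ∈ atlas (EuclideanSpace ℝ (Fin 2)) N, ∀ y ∈ φ.target, φ.symm y ∈ Ω →
    divCoord φ (fun z i => gradCoord φ u z i / slopeFactor φ u z) y = 1 / slopeFactor φ u y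

end Graphs

section Surfaces

variable {N : Type*} [TopologicalSpace N] [ChartedSpace (EuclideanSpace ℝ (Fin 2)) N]
  {S : Type*} [TopologicalSpace S] [ChartedSpace (EuclideanSpace ℝ (Fin 2)) S]

/-- `F : S → N × ℝ` is an immersion of class `C^2`, so that it parametrizes a `C^2` surface. -/
structure IsC2Immersion (F : S → N × ℝ) : Prop where
  contMDiff : ContMDiff (𝓡 2) ((𝓡 2).prod 𝓘(ℝ, ℝ)) 2 F
  injective_mfderiv : ∀ s, Function.Injective (mfderiv (𝓡 2) ((𝓡 2).prod 𝓘(ℝ, ℝ)) F s)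

/-- The differential of `F : S → N × ℝ` at `s`, with values in `T N × ℝ`. -/
def pushVec (F : S → N × ℝ) (s : S) (w : TangentSpace (𝓡 2) s) :
    TangentSpace (𝓡 2) (F s).1 × ℝ :=
  (mfderiv (𝓡 2) (𝓡 2) (fun t => (F t).1) s w, mfderiv (𝓡 2) 𝓘(ℝ, ℝ) (fun t => (F t).2) s w)

variable [RiemannianBundle (fun x : N => TangentSpace (𝓡 2) x)]

/-- The product metric `σ + dr²` of `N × ℝ` on tangent vectors at a point above `x`. -/
def prodMetric {x : N} (V W : TangentSpace (𝓡 2) x × ℝ) : ℝ :=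
  inner ℝ V.1 W.1 + V.2 * W.2

/-- `ν` is a continuous unit normal vector field along the immersed surface `F : S → N × ℝ`. -/
structure IsUnitNormal [IsManifold (𝓡 2) ∞ N] (F : S → N × ℝ)
    (ν : ∀ s : S, TangentSpace (𝓡 2) (F s).1 × ℝ) : Prop where
  continuous_horizontal :
    Continuous fun s => (⟨(F s).1, (ν s).1⟩ : TangentBundle (𝓡 2) N)
  continuous_vertical : Continuous fun s => (ν s).2
  unit : ∀ s, prodMetric (ν s) (ν s) = 1
  normal : ∀ s, ∀ w : TangentSpace (𝓡 2) s, prodMetric (ν s) (pushVec F s w) = 0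

/-- The angle function `⟨ν, ∂_r⟩`, where `∂_r` is the vector `(0, 1)`. -/
def angleFunction (F : S → N × ℝ) (ν : ∀ s : S, TangentSpace (𝓡 2) (F s).1 × ℝ) (s : S) : ℝ :=
  prodMetric (ν s) (0, 1)

end Surfaces

end

/-! In coordinates the conormal `m = t₁ × t₂` of a parametrized surface is a covector whose vertical
component (`surfaceVert`) vanishes exactly where the tangent plane is vertical, that is, where the
angle function vanishes. The graph equation `div (Du / W) = c + τ / W`, with `τ = 0` in the minimal
and CMC cases and `c = 0`, `τ = 1` for translators, is multiplied by the cube of that component. It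
becomes `paramOp = σ c |m|³ + τ m₃ |m|²`, where `σ` is the sign of `m₃`. Both sides are continuous
in the 2-jet of the parametrization and remain meaningful at vertical points, so the equation passes
to the limit surface (`exists_surfaceOp_eq_of_tendsto`). The constants `σ c n` converge because
every other term does.

The conormal of a parametrized graph never becomes horizontal, so on a connected patch `m₃` has a
sign; hence `σ m₃ ≥ 0` on the limit. Near a vertical point the limit is a graph `x_i = w (x_j, r)`
over a vertical coordinate plane. There `w` solves a quasilinear elliptic equation whose
coefficients do not involve `r`, and `∂_r w = -m₃ / m₁` has a sign. Formally `∂_r w` solves a linear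
elliptic equation, so the strong maximum principle makes its zero set open. As `w` is only `C²`, the
equation is not differentiated: the differences `w (· + h) - w` satisfy elliptic inequalities with
constants independent of `h`, and a Hopf barrier bounds them below by a multiple of `h`
(`exists_ellipticIneq_vertDiff`, `exists_barrier_le`, `eventually_fderiv_eq_zero_of_sign`). The set
of vertical points is therefore open and closed, and connectedness gives the dichotomy
`forall_isTransverse_or_forall_not`.

The global normal is the limit of the upward unit normals of the graphs
(`exists_isUnitNormal_nonneg`). One nonprincipal ultrafilter selects the orientation of all patches
simultaneously, so the local limits agree on overlaps even where the limit is vertical. -/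

/-- The Euclidean plane. -/
abbrev Plane := EuclideanSpace ℝ (Fin 2)

/-! ### Algebra of the mean curvature operator on 2-jets of parametrized surfaces. -/

/-- The values at a point of the inverse metric `a`, of the first order coefficients `b` of the
Laplacian, and of the derivatives `c i k l` of `a k l`. -/
abbrev MetricCoeffs := (Fin 2 → Fin 2 → ℝ) × (Fin 2 → ℝ) × (Fin 2 → Fin 2 → Fin 2 → ℝ)

/-- `W² = 1 + |p|²` for the covector `p`. -/
def slopeSq (κ : MetricCoeffs) (p : Fin 2 → ℝ) : ℝ :=
  1 + ∑ i, (∑ j, κ.1 i j * p j) * p i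

/-- `W³ div (Du / W)` in terms of the first derivatives `p` and the second derivatives `P`. -/
noncomputable def graphOp (κ : MetricCoeffs) (p : Fin 2 → ℝ) (P : Fin 2 → Fin 2 → ℝ) : ℝ :=
  slopeSq κ p * (∑ i, κ.2.1 i * p i + ∑ i, ∑ j, κ.1 i j * P i j) -
    ∑ i, (∑ j, κ.1 i j * p j) *
      (1 / 2 * ∑ k, ∑ l, κ.2.2 i k l * p k * p l + ∑ k, ∑ l, κ.1 k l * P i k * p l)

/-- The first component of the cross product of two tangent vectors of `ℝ² × ℝ`, whose coordinates
are ordered as `i`, `j`, height. -/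
def crossFst (j : Fin 2) (t₁ t₂ : Plane × ℝ) : ℝ := t₁.1 j * t₂.2 - t₁.2 * t₂.1 j

/-- The second component of the cross product. -/
def crossSnd (i : Fin 2) (t₁ t₂ : Plane × ℝ) : ℝ := t₁.2 * t₂.1 i - t₁.1 i * t₂.2

/-- The vertical component of the cross product. -/
def crossVert (i j : Fin 2) (t₁ t₂ : Plane × ℝ) : ℝ := t₁.1 i * t₂.1 j - t₂.1 i * t₁.1 j

/-- The squared norm of the cross product, as a covector. -/
def conormalSq (κ : MetricCoeffs) (i j : Fin 2) (t₁ t₂ : Plane × ℝ) : ℝ :=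
  crossVert i j t₁ t₂ ^ 2 + κ.1 i i * crossFst j t₁ t₂ ^ 2
    + 2 * κ.1 i j * (crossFst j t₁ t₂ * crossSnd i t₁ t₂) + κ.1 j j * crossSnd i t₁ t₂ ^ 2

/-- The contraction of a second derivative with the cross product. -/
def secondForm (i j : Fin 2) (t₁ t₂ s : Plane × ℝ) : ℝ :=
  crossFst j t₁ t₂ * s.1 i + crossSnd i t₁ t₂ * s.1 j + crossVert i j t₁ t₂ * s.2

/-- The quadratic form of the second derivatives. -/
def formAt (i j : Fin 2) (t₁ t₂ s₁₁ s₁₂ s₂₂ : Plane × ℝ) (v₁ v₂ w₁ w₂ : ℝ) : ℝ :=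
  secondForm i j t₁ t₂ s₁₁ * (v₁ * w₁) + secondForm i j t₁ t₂ s₁₂ * (v₁ * w₂ + v₂ * w₁)
    + secondForm i j t₁ t₂ s₂₂ * (v₂ * w₂)

/-- The lower order part of the mean curvature of a parametrized surface. -/
noncomputable def lowerPart (κ : MetricCoeffs) (i j : Fin 2) (M m₁ m₂ : ℝ) : ℝ :=
  - M * (κ.2.1 i * m₁ + κ.2.1 j * m₂) + 1 / 2 *
    ((κ.1 i i * m₁ + κ.1 i j * m₂) *
        (κ.2.2 i i i * m₁ ^ 2 + (κ.2.2 i i j + κ.2.2 i j i) * (m₁ * m₂) + κ.2.2 i j j * m₂ ^ 2)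
      + (κ.1 i j * m₁ + κ.1 j j * m₂) *
        (κ.2.2 j i i * m₁ ^ 2 + (κ.2.2 j i j + κ.2.2 j j i) * (m₁ * m₂) + κ.2.2 j j j * m₂ ^ 2))

/-- The mean curvature of a parametrized surface, multiplied by the cube of the length of the cross
product of the coordinate tangent vectors. -/
noncomputable def paramOp (κ : MetricCoeffs) (i j : Fin 2) (t₁ t₂ s₁₁ s₁₂ s₂₂ : Plane × ℝ) : ℝ :=
  κ.1 i i * formAt i j t₁ t₂ s₁₁ s₁₂ s₂₂ (t₂.1 j) (-t₁.1 j) (t₂.1 j) (-t₁.1 j)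
  + 2 * κ.1 i j * formAt i j t₁ t₂ s₁₁ s₁₂ s₂₂ (t₂.1 j) (-t₁.1 j) (-t₂.1 i) (t₁.1 i)
  + κ.1 j j * formAt i j t₁ t₂ s₁₁ s₁₂ s₂₂ (-t₂.1 i) (t₁.1 i) (-t₂.1 i) (t₁.1 i)
  + (κ.1 i i * κ.1 j j - κ.1 i j ^ 2) *
      formAt i j t₁ t₂ s₁₁ s₁₂ s₂₂ t₂.2 (-t₁.2) t₂.2 (-t₁.2)
  + lowerPart κ i j (conormalSq κ i j t₁ t₂) (crossFst j t₁ t₂) (crossSnd i t₁ t₂)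

lemma Fin.two_cases_of_ne {i j : Fin 2} (h : i ≠ j) : (i = 0 ∧ j = 1) ∨ (i = 1 ∧ j = 0) := by
  revert i j; decide

section Graph

variable {κ : MetricCoeffs} {i j : Fin 2} {t₁ t₂ s₁₁ s₁₂ s₂₂ : Plane × ℝ}
  {p : Fin 2 → ℝ} {P : Fin 2 → Fin 2 → ℝ}

/-- The tangent plane of a graph is the kernel of `dr - p`, so the conormal is its vertical
component times `(-p, 1)`. Both orders of `(i, j)` are kept, since either horizontal coordinate may
later become the dependent one. -/
lemma crossFst_graph (hij : i ≠ j) (h₁ : t₁.2 = ∑ k, p k * t₁.1 k)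
    (h₂ : t₂.2 = ∑ k, p k * t₂.1 k) :
    crossFst j t₁ t₂ = - crossVert i j t₁ t₂ * p i := by
  rcases Fin.two_cases_of_ne hij with ⟨rfl, rfl⟩ | ⟨rfl, rfl⟩ <;>
  · simp only [crossFst, crossVert, h₁, h₂, Fin.sum_univ_two]; ring

lemma crossSnd_graph (hij : i ≠ j) (h₁ : t₁.2 = ∑ k, p k * t₁.1 k)
    (h₂ : t₂.2 = ∑ k, p k * t₂.1 k) :
    crossSnd i t₁ t₂ = - crossVert i j t₁ t₂ * p j := by
  rcases Fin.two_cases_of_ne hij with ⟨rfl, rfl⟩ | ⟨rfl, rfl⟩ <;>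
  · simp only [crossSnd, crossVert, h₁, h₂, Fin.sum_univ_two]; ring

lemma conormalSq_graph (hij : i ≠ j) (hκ : ∀ k l, κ.1 k l = κ.1 l k)
    (h₁ : t₁.2 = ∑ k, p k * t₁.1 k) (h₂ : t₂.2 = ∑ k, p k * t₂.1 k) :
    conormalSq κ i j t₁ t₂ = crossVert i j t₁ t₂ ^ 2 * slopeSq κ p := by
  rw [conormalSq, crossFst_graph hij h₁ h₂, crossSnd_graph hij h₁ h₂]
  rcases Fin.two_cases_of_ne hij with ⟨rfl, rfl⟩ | ⟨rfl, rfl⟩ <;>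
  · simp only [slopeSq, Fin.sum_univ_two, hκ 1 0]; ring

lemma secondForm_graph {s v w : Plane × ℝ} (hij : i ≠ j) (h₁ : t₁.2 = ∑ k, p k * t₁.1 k)
    (h₂ : t₂.2 = ∑ k, p k * t₂.1 k)
    (hs : s.2 = ∑ k, p k * s.1 k + ∑ k, ∑ l, P k l * v.1 k * w.1 l) :
    secondForm i j t₁ t₂ s = crossVert i j t₁ t₂ * ∑ k, ∑ l, P k l * v.1 k * w.1 l := by
  rw [secondForm, crossFst_graph hij h₁ h₂, crossSnd_graph hij h₁ h₂, hs]
  rcases Fin.two_cases_of_ne hij with ⟨rfl, rfl⟩ | ⟨rfl, rfl⟩ <;>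
  · simp only [Fin.sum_univ_two]; ring

/-- The hypotheses are the chain rule for `r = v (x)` up to order two. Contracting with the conormal
removes the tangential part of the second derivatives and leaves the Hessian. The pairs inserted
into `formAt` are the coefficients of tangent vectors with vanishing `j`-, `i`- and height component
respectively. Every term is cubic in the conormal, whence the power 3. -/
lemma paramOp_graph (hij : i ≠ j) (hκ : ∀ k l, κ.1 k l = κ.1 l k) (hP : ∀ k l, P k l = P l k)
    (h₁ : t₁.2 = ∑ k, p k * t₁.1 k) (h₂ : t₂.2 = ∑ k, p k * t₂.1 k)
    (h₁₁ : s₁₁.2 = ∑ k, p k * s₁₁.1 k + ∑ k, ∑ l, P k l * t₁.1 k * t₁.1 l)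
    (h₁₂ : s₁₂.2 = ∑ k, p k * s₁₂.1 k + ∑ k, ∑ l, P k l * t₁.1 k * t₂.1 l)
    (h₂₂ : s₂₂.2 = ∑ k, p k * s₂₂.1 k + ∑ k, ∑ l, P k l * t₂.1 k * t₂.1 l) :
    paramOp κ i j t₁ t₂ s₁₁ s₁₂ s₂₂ = crossVert i j t₁ t₂ ^ 3 * graphOp κ p P := by
  simp only [paramOp, formAt, secondForm_graph hij h₁ h₂ h₁₁, secondForm_graph hij h₁ h₂ h₁₂,
    secondForm_graph hij h₁ h₂ h₂₂, conormalSq_graph hij hκ h₁ h₂, crossFst_graph hij h₁ h₂,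
    crossSnd_graph hij h₁ h₂, h₁, h₂, lowerPart]
  rcases Fin.two_cases_of_ne hij with ⟨rfl, rfl⟩ | ⟨rfl, rfl⟩ <;>
  · simp only [graphOp, slopeSq, crossVert, Fin.sum_univ_two, hκ 1 0, hP 1 0]; ring

end Graph

section Horizontal

variable {κ : MetricCoeffs} {i j : Fin 2} {t₁ t₂ s₁₁ s₁₂ s₂₂ : Plane × ℝ} {p q P Q R : ℝ}

/-- For a surface `x_i = w (x_j, r)` with slopes `p`, `q` the tangent plane is the kernel of `dx_i -
p dx_j - q dr`, so the conormal is `crossFst` times `(1, -p, -q)`. -/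
lemma crossSnd_horizontal (h₁ : t₁.1 i = p * t₁.1 j + q * t₁.2)
    (h₂ : t₂.1 i = p * t₂.1 j + q * t₂.2) :
    crossSnd i t₁ t₂ = - p * crossFst j t₁ t₂ := by
  simp only [crossFst, crossSnd, h₁, h₂]; ring

lemma crossVert_horizontal (h₁ : t₁.1 i = p * t₁.1 j + q * t₁.2)
    (h₂ : t₂.1 i = p * t₂.1 j + q * t₂.2) :
    crossVert i j t₁ t₂ = - q * crossFst j t₁ t₂ := by
  simp only [crossFst, crossVert, h₁, h₂]; ring

/-- The squared norm of the conormal of a graph over a vertical plane. -/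
def horizontalSq (κ : MetricCoeffs) (i j : Fin 2) (p q : ℝ) : ℝ :=
  q ^ 2 + κ.1 i i - 2 * κ.1 i j * p + κ.1 j j * p ^ 2

/-- The lower order part of the mean curvature of a graph over a vertical plane. -/
noncomputable def horizontalLower (κ : MetricCoeffs) (i j : Fin 2) (p q : ℝ) : ℝ :=
  lowerPart κ i j (horizontalSq κ i j p q) 1 (-p)

lemma conormalSq_horizontal (h₁ : t₁.1 i = p * t₁.1 j + q * t₁.2)
    (h₂ : t₂.1 i = p * t₂.1 j + q * t₂.2) :
    conormalSq κ i j t₁ t₂ = crossFst j t₁ t₂ ^ 2 * horizontalSq κ i j p q := by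
  rw [conormalSq, crossSnd_horizontal h₁ h₂, crossVert_horizontal h₁ h₂, horizontalSq]; ring

lemma secondForm_horizontal {s v w : Plane × ℝ} (h₁ : t₁.1 i = p * t₁.1 j + q * t₁.2)
    (h₂ : t₂.1 i = p * t₂.1 j + q * t₂.2)
    (hs : s.1 i = p * s.1 j + q * s.2 + (P * (v.1 j * w.1 j) +
      Q * (v.1 j * w.2 + v.2 * w.1 j) + R * (v.2 * w.2))) :
    secondForm i j t₁ t₂ s = crossFst j t₁ t₂ * (P * (v.1 j * w.1 j) +
      Q * (v.1 j * w.2 + v.2 * w.1 j) + R * (v.2 * w.2)) := by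
  rw [secondForm, crossSnd_horizontal h₁ h₂, crossVert_horizontal h₁ h₂, hs]; ring

/-- The same operator read over a vertical plane, with `P`, `Q`, `R` in the roles of `w_jj`, `w_jr`,
`w_rr`. Its principal part is explicit, so ellipticity can be checked directly. -/
lemma paramOp_horizontal (h₁ : t₁.1 i = p * t₁.1 j + q * t₁.2)
    (h₂ : t₂.1 i = p * t₂.1 j + q * t₂.2)
    (h₁₁ : s₁₁.1 i = p * s₁₁.1 j + q * s₁₁.2 + (P * (t₁.1 j * t₁.1 j) +
      Q * (t₁.1 j * t₁.2 + t₁.2 * t₁.1 j) + R * (t₁.2 * t₁.2)))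
    (h₁₂ : s₁₂.1 i = p * s₁₂.1 j + q * s₁₂.2 + (P * (t₁.1 j * t₂.1 j) +
      Q * (t₁.1 j * t₂.2 + t₁.2 * t₂.1 j) + R * (t₁.2 * t₂.2)))
    (h₂₂ : s₂₂.1 i = p * s₂₂.1 j + q * s₂₂.2 + (P * (t₂.1 j * t₂.1 j) +
      Q * (t₂.1 j * t₂.2 + t₂.2 * t₂.1 j) + R * (t₂.2 * t₂.2))) :
    paramOp κ i j t₁ t₂ s₁₁ s₁₂ s₂₂ = crossFst j t₁ t₂ ^ 3 *
      ((κ.1 j j * q ^ 2 + (κ.1 i i * κ.1 j j - κ.1 i j ^ 2)) * P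
        + 2 * ((κ.1 i j - κ.1 j j * p) * q) * Q
        + (κ.1 i i - 2 * κ.1 i j * p + κ.1 j j * p ^ 2) * R + horizontalLower κ i j p q) := by
  simp only [paramOp, formAt, secondForm_horizontal h₁ h₂ h₁₁, secondForm_horizontal h₁ h₂ h₁₂,
    secondForm_horizontal h₁ h₂ h₂₂, conormalSq_horizontal h₁ h₂, crossSnd_horizontal h₁ h₂,
    h₁, h₂, lowerPart, crossFst, horizontalLower]
  ring

end Horizontal

/-! ### A strong maximum principle for a directional derivative -/

/-- A negative second derivative would make the point a local maximum as well; the function would be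
locally constant, with zero second derivative. -/
lemma IsLocalMin.deriv_deriv_nonneg {g : ℝ → ℝ} {x : ℝ} (h : IsLocalMin g x)
    (hc : ContinuousAt g x) : 0 ≤ deriv (deriv g) x := by
  by_contra! hneg
  have hmax := isLocalMax_of_deriv_deriv_neg hneg h.deriv_eq_zero hc
  have hconst : g =ᶠ[𝓝 x] fun _ => g x := by
    filter_upwards [h, hmax] with y h₁ h₂ using le_antisymm h₂ h₁
  have : deriv (deriv g) x = 0 := by
    rw [hconst.deriv.deriv_eq]; simp
  exact hneg.ne this

section Hessian

variable {V W : Type*} [NormedAddCommGroup V] [NormedSpace ℝ V]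
  [NormedAddCommGroup W] [NormedSpace ℝ W]

lemma ContDiffAt.differentiableAt_fderiv {g : V → W} {z : V} (h : ContDiffAt ℝ 2 g z) :
    DifferentiableAt ℝ (fderiv ℝ g) z :=
  (h.fderiv_right (m := 1) (by norm_num)).differentiableAt one_ne_zero

lemma deriv_deriv_line {g : V → ℝ} {z : V} (hg : ContDiffAt ℝ 2 g z) (v : V) :
    deriv (deriv fun t : ℝ => g (z + t • v)) 0 = fderiv ℝ (fderiv ℝ g) z v v := by
  have hline : ∀ t : ℝ, HasDerivAt (fun t : ℝ => z + t • v) v t := fun t => by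
    simpa using ((hasDerivAt_id t).smul_const v).const_add z
  have hcont : Tendsto (fun t : ℝ => z + t • v) (𝓝 0) (𝓝 z) := by
    have := (hline 0).continuousAt.tendsto
    simpa using this
  have hd : ∀ᶠ y in 𝓝 z, DifferentiableAt ℝ g y := by
    filter_upwards [hg.eventually (by simp)] with y hy using hy.differentiableAt two_ne_zero
  have h1 : (deriv fun t : ℝ => g (z + t • v)) =ᶠ[𝓝 0] fun t => fderiv ℝ g (z + t • v) v := by
    filter_upwards [hcont.eventually hd] with t ht
    exact (ht.hasFDerivAt.comp_hasDerivAt t (hline t)).deriv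
  rw [h1.deriv_eq]
  have h2 : HasFDerivAt (fderiv ℝ g) (fderiv ℝ (fderiv ℝ g) z) (z + (0 : ℝ) • v) := by
    simpa using hg.differentiableAt_fderiv.hasFDerivAt
  have h3 := h2.comp_hasDerivAt (0 : ℝ) (hline 0)
  exact (h3.clm_apply (hasDerivAt_const (0 : ℝ) v)).deriv.trans (by simp)

lemma IsLocalMin.hessian_nonneg {g : V → ℝ} {z : V} (h : IsLocalMin g z)
    (hg : ContDiffAt ℝ 2 g z) (v : V) : 0 ≤ fderiv ℝ (fderiv ℝ g) z v v := by
  rw [← deriv_deriv_line hg v]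
  have hcont : ContinuousAt (fun t : ℝ => z + t • v) 0 := by fun_prop
  apply IsLocalMin.deriv_deriv_nonneg
  · have : Tendsto (fun t : ℝ => z + t • v) (𝓝 0) (𝓝 z) := by simpa using hcont.tendsto
    have := this.eventually h
    simpa [IsLocalMin, IsMinFilter] using this
  · have : ContinuousAt g (z + (0 : ℝ) • v) := by simpa using hg.continuousAt
    exact ContinuousAt.comp (f := fun t : ℝ => z + t • v) this hcont

lemma ContDiffAt.hessian_symm {g : V → W} {z : V} (hg : ContDiffAt ℝ 2 g z) (v v' : V) :
    fderiv ℝ (fderiv ℝ g) z v v' = fderiv ℝ (fderiv ℝ g) z v' v :=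
  (hg.isSymmSndFDerivAt (by simp)).eq v v'

end Hessian

/-- A positive definite operator is nonnegative at a nonnegative Hessian. -/
lemma trace_mul_nonneg {A B C : ℝ} (hC : 0 < C) (hdet : 0 < A * C - B ^ 2)
    (H : ℝ × ℝ →L[ℝ] ℝ × ℝ →L[ℝ] ℝ) (hs : H (1, 0) (0, 1) = H (0, 1) (1, 0))
    (hH : ∀ v, 0 ≤ H v v) :
    0 ≤ A * H (1, 0) (1, 0) + 2 * B * H (1, 0) (0, 1) + C * H (0, 1) (0, 1) := by
  -- The identity used is `C (A H₁₁ + 2 B H₁₂ + C H₂₂) = H (B, C) (B, C) + (A C - B²) H₁₁`.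
  have h1 := hH (B, C)
  have e : ((B, C) : ℝ × ℝ) = B • (1, 0) + C • (0, 1) := by simp
  rw [e] at h1
  simp only [map_add, map_smul, _root_.add_apply, _root_.smul_apply,
    smul_eq_mul, ← hs] at h1
  have h2 := hH (1, 0)
  have : 0 ≤ C * (A * H (1, 0) (1, 0) + 2 * B * H (1, 0) (0, 1) + C * H (0, 1) (0, 1)) := by
    nlinarith [mul_nonneg hdet.le h2]
  exact nonneg_of_mul_nonneg_right this hC

/-- By Cayley–Hamilton, `tr M ⟨M v, v⟩ - det M |v|² = |M v|²` for the symmetric matrix `M` with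
entries `A`, `B`, `C`. -/
lemma quadraticForm_lower_bound {A B C x y : ℝ} :
    (A * C - B ^ 2) * (x ^ 2 + y ^ 2) ≤ (A + C) * (A * x ^ 2 + 2 * B * (x * y) + C * y ^ 2) := by
  nlinarith [sq_nonneg (A * x + B * y), sq_nonneg (B * x + C * y)]

/-- The squared Euclidean norm on `ℝ × ℝ`. -/
def sqNorm (z : ℝ × ℝ) : ℝ := z.1 ^ 2 + z.2 ^ 2

@[fun_prop]
lemma contDiff_sqNorm {n : WithTop ℕ∞} : ContDiff ℝ n sqNorm := by
  unfold sqNorm; fun_prop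

/-- The radial barrier centred at `c` and vanishing at distance `R`. -/
noncomputable def barrier (α R : ℝ) (c z : ℝ × ℝ) : ℝ :=
  Real.exp (-α * sqNorm (z - c)) - Real.exp (-α * R ^ 2)

lemma contDiff_barrier {α R : ℝ} {c : ℝ × ℝ} {n : WithTop ℕ∞} :
    ContDiff ℝ n (barrier α R c) := by
  unfold barrier
  fun_prop

lemma fderiv_barrier (α R : ℝ) (c z v : ℝ × ℝ) :
    fderiv ℝ (barrier α R c) z v =
      Real.exp (-α * sqNorm (z - c)) * (-α * (2 * (z.1 - c.1) * v.1 + 2 * (z.2 - c.2) * v.2)) := by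
  have h1 : HasFDerivAt (fun z : ℝ × ℝ => z.1 - c.1) (ContinuousLinearMap.fst ℝ ℝ ℝ) z :=
    hasFDerivAt_fst.sub_const _
  have h2 : HasFDerivAt (fun z : ℝ × ℝ => z.2 - c.2) (ContinuousLinearMap.snd ℝ ℝ ℝ) z :=
    hasFDerivAt_snd.sub_const _
  have h3 := ((((h1.pow 2).add (h2.pow 2)).const_mul (-α)).exp).sub_const (Real.exp (-α * R ^ 2))
  have h4 : HasFDerivAt (barrier α R c) _ z := h3
  rw [h4.fderiv]
  simp [sqNorm]
  ring

lemma fderiv_fderiv_barrier (α R : ℝ) (c z v v' : ℝ × ℝ) :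
    fderiv ℝ (fderiv ℝ (barrier α R c)) z v v' =
      Real.exp (-α * sqNorm (z - c)) * (4 * α ^ 2 * (((z.1 - c.1) * v.1 + (z.2 - c.2) * v.2) *
        ((z.1 - c.1) * v'.1 + (z.2 - c.2) * v'.2)) - 2 * α * (v.1 * v'.1 + v.2 * v'.2)) := by
  have hd : DifferentiableAt ℝ (fderiv ℝ (barrier α R c)) z :=
    contDiff_barrier.contDiffAt.differentiableAt_fderiv
  have e1 : fderiv ℝ (fderiv ℝ (barrier α R c)) z v v'
      = fderiv ℝ (fun z => fderiv ℝ (barrier α R c) z v') z v := by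
    rw [fderiv_clm_apply hd (differentiableAt_const v')]; simp
  rw [e1]
  have e2 : (fun z => fderiv ℝ (barrier α R c) z v') = fun z =>
      Real.exp (-α * ((z.1 - c.1) ^ 2 + (z.2 - c.2) ^ 2)) *
        (-α * (2 * (z.1 - c.1) * v'.1 + 2 * (z.2 - c.2) * v'.2)) := by
    funext z; rw [fderiv_barrier]; rfl
  rw [e2]
  have h1 : HasFDerivAt (fun z : ℝ × ℝ => z.1 - c.1) (ContinuousLinearMap.fst ℝ ℝ ℝ) z :=
    hasFDerivAt_fst.sub_const _
  have h2 : HasFDerivAt (fun z : ℝ × ℝ => z.2 - c.2) (ContinuousLinearMap.snd ℝ ℝ ℝ) z :=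
    hasFDerivAt_snd.sub_const _
  have h3 := (((h1.pow 2).add (h2.pow 2)).const_mul (-α)).exp.mul
    ((((h1.const_mul 2).mul_const v'.1).add ((h2.const_mul 2).mul_const v'.2)).const_mul (-α))
  rw [HasFDerivAt.fderiv (f := fun z : ℝ × ℝ =>
      Real.exp (-α * ((z.1 - c.1) ^ 2 + (z.2 - c.2) ^ 2)) *
        (-α * (2 * (z.1 - c.1) * v'.1 + 2 * (z.2 - c.2) * v'.2))) h3]
  simp [sqNorm]
  ring

lemma IsCompact.annulus (c : ℝ × ℝ) (ρ R : ℝ) :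
    IsCompact {z : ℝ × ℝ | ρ ^ 2 ≤ sqNorm (z - c) ∧ sqNorm (z - c) ≤ R ^ 2} := by
  apply Metric.isCompact_of_isClosed_isBounded
  · have : Continuous fun z : ℝ × ℝ => sqNorm (z - c) := by unfold sqNorm; fun_prop
    exact (isClosed_le continuous_const this).inter (isClosed_le this continuous_const)
  · refine (Metric.isBounded_closedBall (x := c) (r := |R|)).subset fun z hz => ?_
    have h2 := hz.2
    simp only [sqNorm, Prod.fst_sub, Prod.snd_sub] at h2
    rw [Metric.mem_closedBall, dist_eq_norm, Prod.norm_def]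
    refine max_le ?_ ?_ <;> rw [Real.norm_eq_abs] <;> apply sq_le_sq.1
    · simp only [Prod.fst_sub]; nlinarith [sq_nonneg (z.2 - c.2)]
    · simp only [Prod.snd_sub]; nlinarith [sq_nonneg (z.1 - c.1)]

/-- Quantitative strong minimum principle: nonnegative supersolutions of a uniformly elliptic
inequality on an annulus are bounded below by a barrier. -/
lemma exists_barrier_le {lam Lam K ρ R : ℝ} (hlam : 0 < lam) (hLam : 0 < Lam) (hK : 0 < K)
    (hρ : 0 < ρ) (hR : 0 < R) :
    ∃ α : ℝ, 0 < α ∧ ∀ (c : ℝ × ℝ) (d : ℝ × ℝ → ℝ) (μ : ℝ), 0 < μ →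
      (∀ z, ρ ^ 2 ≤ sqNorm (z - c) → sqNorm (z - c) ≤ R ^ 2 → ContDiffAt ℝ 2 d z ∧ 0 ≤ d z ∧
        ∃ A B C : ℝ, 0 < C ∧ 0 < A * C - B ^ 2 ∧ A + C ≤ Lam ∧
          (∀ x y : ℝ, lam * (x ^ 2 + y ^ 2) ≤ A * x ^ 2 + 2 * B * (x * y) + C * y ^ 2) ∧
          A * fderiv ℝ (fderiv ℝ d) z (1, 0) (1, 0) + 2 * B * fderiv ℝ (fderiv ℝ d) z (1, 0) (0, 1)
            + C * fderiv ℝ (fderiv ℝ d) z (0, 1) (0, 1) ≤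
            K * (|d z| + |fderiv ℝ d z (1, 0)| + |fderiv ℝ d z (0, 1)|)) →
      (∀ z, sqNorm (z - c) = ρ ^ 2 → μ ≤ d z) →
      ∀ z, ρ ^ 2 ≤ sqNorm (z - c) → sqNorm (z - c) ≤ R ^ 2 → μ * barrier α R c z ≤ d z := by
  -- At a touching point the operator applied to the barrier is at least `4 α² lam ρ² - 2 α Lam`, up
  -- to the exponential factor, while the lower order terms are at most `K (1 + 4 α R)`. This `α`
  -- makes the former larger, and it depends only on the constants, not on `c`, `d` or `μ`.
  set α : ℝ := 1 + (2 * Lam + K + 4 * K * R) / (4 * lam * ρ ^ 2) with hαdef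
  have hα1 : 1 ≤ α := by
    have : 0 ≤ (2 * Lam + K + 4 * K * R) / (4 * lam * ρ ^ 2) := by positivity
    linarith
  have hα : 2 * Lam + K + 4 * K * R < α * (4 * lam * ρ ^ 2) := by
    rw [hαdef, add_mul, div_mul_cancel₀ _ (by positivity)]
    have : 0 < 4 * lam * ρ ^ 2 := by positivity
    linarith
  have hα0 : 0 < α := by linarith
  refine ⟨α, hα0, fun c d μ hμ hd hin z hz₁ hz₂ => ?_⟩
  by_contra! hlt
  set g : ℝ × ℝ → ℝ := fun z => d z - μ * barrier α R c z with hg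
  have hgc : ContinuousOn g {z : ℝ × ℝ | ρ ^ 2 ≤ sqNorm (z - c) ∧ sqNorm (z - c) ≤ R ^ 2} := by
    intro y hy
    have hb : Continuous (barrier α R c) := (contDiff_barrier (n := 0)).continuous
    exact ((hd y hy.1 hy.2).1.continuousAt.sub
      (continuousAt_const.mul hb.continuousAt)).continuousWithinAt
  obtain ⟨x, hx, hmin⟩ := (IsCompact.annulus c ρ R).exists_isMinOn ⟨z, hz₁, hz₂⟩ hgc
  have hxneg : g x < 0 := lt_of_le_of_lt (hmin ⟨hz₁, hz₂⟩) (by simp only [hg]; linarith)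
  obtain ⟨hdx, hdx0, A, B, C, hC, hdet, htr, hell, hop⟩ := hd x hx.1 hx.2
  have hexp1 : Real.exp (-α * sqNorm (x - c)) ≤ 1 := by
    rw [Real.exp_le_one_iff]
    have h1 : 0 ≤ sqNorm (x - c) := by unfold sqNorm; positivity
    have h2 := mul_nonneg hα0.le h1
    linarith
  -- A negative minimum is interior: on the inner circle `d ≥ μ` and the barrier is at most 1, and
  -- on the outer circle the barrier vanishes while `d ≥ 0`.
  have hx1 : ρ ^ 2 < sqNorm (x - c) := by
    refine lt_of_le_of_ne hx.1 fun he => ?_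
    have h1 := hin x he.symm
    have h2 : barrier α R c x ≤ 1 := by
      unfold barrier; linarith [Real.exp_pos (-α * R ^ 2)]
    simp only [hg] at hxneg
    have h3 := mul_le_mul_of_nonneg_left h2 hμ.le
    linarith
  have hx2 : sqNorm (x - c) < R ^ 2 := by
    refine lt_of_le_of_ne hx.2 fun he => ?_
    simp only [hg, barrier, he, sub_self, mul_zero, sub_zero] at hxneg
    linarith
  have hloc : IsLocalMin g x := by
    have hc : ContinuousAt (fun z : ℝ × ℝ => sqNorm (z - c)) x := by
      unfold sqNorm; fun_prop
    filter_upwards [hc.eventually (lt_mem_nhds hx1), hc.eventually (gt_mem_nhds hx2)]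
      with y h1 h2 using hmin ⟨h1.le, h2.le⟩
  have hb : ContDiffAt ℝ 2 (barrier α R c) x := contDiff_barrier.contDiffAt
  have hμb : ContDiffAt ℝ 2 (fun z => μ * barrier α R c z) x := contDiffAt_const.mul hb
  have hgx : ContDiffAt ℝ 2 g x := hdx.sub hμb
  -- At the minimum the gradients of `d` and of the scaled barrier agree, so the first order terms
  -- are controlled by the barrier alone.
  have hfd : ∀ v, fderiv ℝ d x v = μ * fderiv ℝ (barrier α R c) x v := fun v => by
    have h0 : fderiv ℝ g x = 0 := hloc.fderiv_eq_zero
    have h1 : fderiv ℝ g x = fderiv ℝ d x - μ • fderiv ℝ (barrier α R c) x := by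
      rw [hg, fderiv_fun_sub (hdx.differentiableAt two_ne_zero)
        (hμb.differentiableAt two_ne_zero), fderiv_const_mul (hb.differentiableAt two_ne_zero)]
    rw [h0] at h1
    have := congrArg (fun T => T v) h1
    simp at this
    linarith
  have hH : fderiv ℝ (fderiv ℝ g) x
      = fderiv ℝ (fderiv ℝ d) x - μ • fderiv ℝ (fderiv ℝ (barrier α R c)) x := by
    have h1 : fderiv ℝ g =ᶠ[𝓝 x] fun y => fderiv ℝ d y - μ • fderiv ℝ (barrier α R c) y := by
      filter_upwards [hdx.eventually (by simp), hb.eventually (by simp)] with y h1 h2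
      rw [hg, fderiv_fun_sub (h1.differentiableAt two_ne_zero)
        ((contDiffAt_const.mul h2).differentiableAt two_ne_zero),
        fderiv_const_mul (h2.differentiableAt two_ne_zero)]
    rw [h1.fderiv_eq]
    exact (hdx.differentiableAt_fderiv.hasFDerivAt.sub
      (hb.differentiableAt_fderiv.hasFDerivAt.const_smul μ)).fderiv
  have htrace := trace_mul_nonneg hC hdet (fderiv ℝ (fderiv ℝ g) x) (hgx.hessian_symm _ _)
    (fun v => hloc.hessian_nonneg hgx v)
  set E := Real.exp (-α * sqNorm (x - c)) with hE
  have hEpos : 0 < E := Real.exp_pos _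
  rw [hH] at htrace
  simp only [_root_.sub_apply, _root_.smul_apply, smul_eq_mul,
    fderiv_fderiv_barrier, ← hE] at htrace
  have hq := hell (x.1 - c.1) (x.2 - c.2)
  have hsq : sqNorm (x - c) = (x.1 - c.1) ^ 2 + (x.2 - c.2) ^ 2 := rfl
  rw [hsq] at hx1 hx2
  -- Negativity of `g` at the minimum bounds `d` by the barrier, so the zeroth order term needs no
  -- sign condition.
  have hdle : |d x| ≤ μ * E := by
    rw [abs_of_nonneg hdx0]
    have : d x < μ * barrier α R c x := by simp only [hg] at hxneg; linarith
    have h2 : barrier α R c x ≤ E := by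
      unfold barrier; linarith [Real.exp_pos (-α * R ^ 2)]
    exact this.le.trans (mul_le_mul_of_nonneg_left h2 hμ.le)
  have hx1R : |x.1 - c.1| ≤ R := abs_le_of_sq_le_sq (by linarith [sq_nonneg (x.2 - c.2)]) hR.le
  have hx2R : |x.2 - c.2| ≤ R := abs_le_of_sq_le_sq (by linarith [sq_nonneg (x.1 - c.1)]) hR.le
  have hd1 : |fderiv ℝ d x (1, 0)| ≤ μ * E * (2 * α * R) := by
    rw [hfd, fderiv_barrier, ← hE]
    have : μ * (E * (-α * (2 * (x.1 - c.1) * 1 + 2 * (x.2 - c.2) * 0)))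
      = -(μ * E * (2 * α)) * (x.1 - c.1) := by ring
    rw [this, abs_mul, abs_neg, abs_of_pos (by positivity)]
    calc _ ≤ μ * E * (2 * α) * R := by gcongr
      _ = _ := by ring
  have hd2 : |fderiv ℝ d x (0, 1)| ≤ μ * E * (2 * α * R) := by
    rw [hfd, fderiv_barrier, ← hE]
    have : μ * (E * (-α * (2 * (x.1 - c.1) * 0 + 2 * (x.2 - c.2) * 1)))
      = -(μ * E * (2 * α)) * (x.2 - c.2) := by ring
    rw [this, abs_mul, abs_neg, abs_of_pos (by positivity)]
    calc _ ≤ μ * E * (2 * α) * R := by gcongr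
      _ = _ := by ring
  have hK1 : K * (|d x| + |fderiv ℝ d x (1, 0)| + |fderiv ℝ d x (0, 1)|)
      ≤ μ * E * (K * (1 + 4 * α * R)) := by
    calc _ ≤ K * (μ * E + μ * E * (2 * α * R) + μ * E * (2 * α * R)) := by gcongr
      _ = _ := by ring
  have hlow : μ * E * (4 * α ^ 2 * (lam * ρ ^ 2) - 2 * α * Lam) ≤
      μ * E * (4 * α ^ 2 * (A * (x.1 - c.1) ^ 2 + 2 * B * ((x.1 - c.1) * (x.2 - c.2))
        + C * (x.2 - c.2) ^ 2) - 2 * α * (A + C)) := by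
    have h1 : lam * ρ ^ 2 ≤ A * (x.1 - c.1) ^ 2 + 2 * B * ((x.1 - c.1) * (x.2 - c.2))
        + C * (x.2 - c.2) ^ 2 := (mul_le_mul_of_nonneg_left hx1.le hlam.le).trans hq
    gcongr
  have hstrict : K * (1 + 4 * α * R) < 4 * α ^ 2 * (lam * ρ ^ 2) - 2 * α * Lam := by
    have h1 := mul_lt_mul_of_pos_left hα hα0
    have h2 : K ≤ α * K := le_mul_of_one_le_left hK.le hα1
    linarith
  have hfin := mul_lt_mul_of_pos_left hstrict (mul_pos hμ hEpos)
  have hexpand : μ * E * (4 * α ^ 2 * (A * (x.1 - c.1) ^ 2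
        + 2 * B * ((x.1 - c.1) * (x.2 - c.2)) + C * (x.2 - c.2) ^ 2) - 2 * α * (A + C)) ≤
      A * fderiv ℝ (fderiv ℝ d) x (1, 0) (1, 0) + 2 * B * fderiv ℝ (fderiv ℝ d) x (1, 0) (0, 1)
            + C * fderiv ℝ (fderiv ℝ d) x (0, 1) (0, 1) := by
    rw [← sub_nonneg]
    refine htrace.trans_eq ?_
    ring
  linarith

/-! ### Differences of vertical translates, in place of differentiating the equation. -/

/-- The first order jet of `w` at `z`, without the second coordinate of `z`. -/
noncomputable def firstJet (w : ℝ × ℝ → ℝ) (z : ℝ × ℝ) : ℝ × ℝ × ℝ × ℝ :=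
  (z.1, w z, fderiv ℝ w z (1, 0), fderiv ℝ w z (0, 1))

/-- The action of a second order operator with coefficients `A`, `B`, `C`. -/
noncomputable def opAt (A B C : ℝ) (w : ℝ × ℝ → ℝ) (z : ℝ × ℝ) : ℝ :=
  A * fderiv ℝ (fderiv ℝ w) z (1, 0) (1, 0) + 2 * B * fderiv ℝ (fderiv ℝ w) z (1, 0) (0, 1)
    + C * fderiv ℝ (fderiv ℝ w) z (0, 1) (0, 1)

/-- The difference of a function and its translate in the second coordinate. -/
def vertDiff (ε h : ℝ) (w : ℝ × ℝ → ℝ) (z : ℝ × ℝ) : ℝ := ε * (w (z + (0, h)) - w z)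

section VertDiff

variable {ε h : ℝ} {w : ℝ × ℝ → ℝ} {z : ℝ × ℝ}

lemma contDiffAt_vertDiff (h₀ : ContDiffAt ℝ 2 w z) (h₁ : ContDiffAt ℝ 2 w (z + (0, h))) :
    ContDiffAt ℝ 2 (vertDiff ε h w) z := by
  unfold vertDiff
  have : ContDiffAt ℝ 2 (fun y => w (y + (0, h))) z :=
    ContDiffAt.comp z h₁ (contDiffAt_id.add contDiffAt_const)
  exact contDiffAt_const.mul (this.sub h₀)

lemma fderiv_vertDiff (h₀ : ContDiffAt ℝ 2 w z) (h₁ : ContDiffAt ℝ 2 w (z + (0, h))) :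
    fderiv ℝ (vertDiff ε h w) z = ε • (fderiv ℝ w (z + (0, h)) - fderiv ℝ w z) := by
  have h2 := (hasFDerivAt_comp_add_right ((0 : ℝ), h)).2
    (h₁.differentiableAt two_ne_zero).hasFDerivAt
  exact ((h2.sub (h₀.differentiableAt two_ne_zero).hasFDerivAt).const_mul ε).fderiv

lemma fderiv_fderiv_vertDiff (h₀ : ContDiffAt ℝ 2 w z) (h₁ : ContDiffAt ℝ 2 w (z + (0, h))) :
    fderiv ℝ (fderiv ℝ (vertDiff ε h w)) z =
      ε • (fderiv ℝ (fderiv ℝ w) (z + (0, h)) - fderiv ℝ (fderiv ℝ w) z) := by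
  have hev : fderiv ℝ (vertDiff ε h w) =ᶠ[𝓝 z]
      fun y => ε • (fderiv ℝ w (y + (0, h)) - fderiv ℝ w y) := by
    have hc : Tendsto (fun y : ℝ × ℝ => y + (0, h)) (𝓝 z) (𝓝 (z + (0, h))) :=
      (continuous_id.add continuous_const).tendsto z
    filter_upwards [h₀.eventually (by simp), hc.eventually (h₁.eventually (by simp))]
      with y hy₀ hy₁ using fderiv_vertDiff hy₀ hy₁
  rw [hev.fderiv_eq]
  have h2 := (hasFDerivAt_comp_add_right ((0 : ℝ), h)).2 h₁.differentiableAt_fderiv.hasFDerivAt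
  exact ((h2.sub h₀.differentiableAt_fderiv.hasFDerivAt).const_smul ε).fderiv

/-- A lower bound of the vertical derivative on a vertical segment bounds the difference. -/
lemma le_vertDiff {m : ℝ} (hh : 0 ≤ h)
    (hd : ∀ t ∈ Icc 0 h, DifferentiableAt ℝ w (z + (0, t)))
    (hm : ∀ t ∈ Icc 0 h, m ≤ ε * fderiv ℝ w (z + (0, t)) (0, 1)) :
    m * h ≤ vertDiff ε h w z := by
  have hder : ∀ t ∈ Icc 0 h, HasDerivAt (fun t : ℝ => ε * w (z + (0, t)))
      (ε * fderiv ℝ w (z + (0, t)) (0, 1)) t := by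
    intro t ht
    have hline : HasDerivAt (fun t : ℝ => z + ((0 : ℝ), t)) ((0 : ℝ), (1 : ℝ)) t :=
      ((hasDerivAt_const t (0 : ℝ)).prodMk (hasDerivAt_id t)).const_add z
    exact ((hd t ht).hasFDerivAt.comp_hasDerivAt t hline).const_mul ε
  have := (convex_Icc (0 : ℝ) h).mul_sub_le_image_sub_of_le_deriv
    (f := fun t : ℝ => ε * w (z + (0, t)))
    (fun t ht => (hder t ht).continuousAt.continuousWithinAt)
    (fun t ht => (hder t (interior_subset ht)).differentiableAt.differentiableWithinAt)
    (C := m) (fun t ht => by rw [(hder t (interior_subset ht)).deriv]; exact hm t (interior_subset ht))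
    0 (left_mem_Icc.2 hh) h (right_mem_Icc.2 hh) hh
  have e : z + ((0 : ℝ), (0 : ℝ)) = z := by simp
  simp only [e, sub_zero] at this
  unfold vertDiff
  linarith

end VertDiff

/-- Subtract the two equations and let the differences of coefficients act on the unprimed second
derivatives, which are bounded by `M`. The factor `1 + 4 M` counts `f`, `A`, twice `B`, and `C`. -/
lemma abs_opAt_sub_le {A A' B B' C C' f f' L M δ : ℝ} {P Q R P' Q' R' : ℝ}
    (hA : |A' - A| ≤ L * δ) (hB : |B' - B| ≤ L * δ) (hC : |C' - C| ≤ L * δ)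
    (hf : |f' - f| ≤ L * δ) (hP : |P| ≤ M) (hQ : |Q| ≤ M) (hR : |R| ≤ M)
    (h : A * P + 2 * B * Q + C * R = f) (h' : A' * P' + 2 * B' * Q' + C' * R' = f') :
    |A' * (P' - P) + 2 * B' * (Q' - Q) + C' * (R' - R)| ≤ L * (1 + 4 * M) * δ := by
  have e : A' * (P' - P) + 2 * B' * (Q' - Q) + C' * (R' - R) =
      (f' - f) - (A' - A) * P - 2 * ((B' - B) * Q) - (C' - C) * R := by
    rw [← h, ← h']; ring
  have hL : 0 ≤ L * δ := (abs_nonneg _).trans hA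
  have bound : ∀ {x y : ℝ}, |x| ≤ L * δ → |y| ≤ M → |x * y| ≤ L * δ * M := fun hx hy => by
    rw [abs_mul]; exact mul_le_mul hx hy (abs_nonneg _) hL
  have h1 := abs_le.1 (bound hA hP)
  have h2 := abs_le.1 (bound hB hQ)
  have h3 := abs_le.1 (bound hC hR)
  have h4 := abs_le.1 hf
  rw [e, abs_le]
  constructor <;> linarith

/-- Barriers are radial for the Euclidean norm, whereas metric balls in `ℝ × ℝ` are those of the sup
norm; this lemma and the next compare the two. -/
lemma dist_le_of_sqNorm_sub_le {c z : ℝ × ℝ} {s : ℝ} (hs : 0 ≤ s) (h : sqNorm (z - c) ≤ s ^ 2) :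
    dist z c ≤ s := by
  simp only [sqNorm, Prod.fst_sub, Prod.snd_sub] at h
  rw [Prod.dist_eq, Real.dist_eq, Real.dist_eq]
  exact max_le (abs_le_of_sq_le_sq (by linarith [sq_nonneg (z.2 - c.2)]) hs)
    (abs_le_of_sq_le_sq (by linarith [sq_nonneg (z.1 - c.1)]) hs)

lemma sqNorm_sub_lt_of_dist_lt {c z : ℝ × ℝ} {s : ℝ} (h : dist z c < s) :
    sqNorm (z - c) < 2 * s ^ 2 := by
  rw [Prod.dist_eq, Real.dist_eq, Real.dist_eq, max_lt_iff] at h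
  have h1 := sq_lt_sq' (by linarith [abs_lt.1 h.1]) (abs_lt.1 h.1).2
  have h2 := sq_lt_sq' (by linarith [abs_lt.1 h.2]) (abs_lt.1 h.2).2
  simp only [sqNorm, Prod.fst_sub, Prod.snd_sub]
  linarith

lemma elliptic_lower_bound {a b c δ Lam x y : ℝ} (hδ : 0 < δ) (hLam : 0 < Lam) (hc : 0 < c)
    (hdet : δ < a * c - b ^ 2) (htr : a + c < Lam) :
    δ / Lam * (x ^ 2 + y ^ 2) ≤ a * x ^ 2 + 2 * b * (x * y) + c * y ^ 2 := by
  have h1 := quadraticForm_lower_bound (A := a) (B := b) (C := c) (x := x) (y := y)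
  have ha : 0 < a := by
    by_contra! hneg
    nlinarith [sq_nonneg b]
  have hs : 0 ≤ x ^ 2 + y ^ 2 := by positivity
  have hq : 0 ≤ a * x ^ 2 + 2 * b * (x * y) + c * y ^ 2 :=
    nonneg_of_mul_nonneg_right ((mul_nonneg (hδ.trans hdet).le hs).trans h1) (by positivity)
  rw [div_mul_eq_mul_div, div_le_iff₀ hLam]
  calc _ ≤ (a * c - b ^ 2) * (x ^ 2 + y ^ 2) := by gcongr
    _ ≤ _ := h1
    _ ≤ Lam * (a * x ^ 2 + 2 * b * (x * y) + c * y ^ 2) := by gcongr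
    _ = _ := mul_comm _ _

/-- `d` satisfies, at `z`, a linear elliptic differential inequality with controlled constants. -/
def EllipticIneq (lam Lam K : ℝ) (d : ℝ × ℝ → ℝ) (z : ℝ × ℝ) : Prop :=
  ∃ A B C : ℝ, 0 < C ∧ 0 < A * C - B ^ 2 ∧ A + C ≤ Lam ∧
    (∀ x y : ℝ, lam * (x ^ 2 + y ^ 2) ≤ A * x ^ 2 + 2 * B * (x * y) + C * y ^ 2) ∧
    opAt A B C d z ≤ K * (|d z| + |fderiv ℝ d z (1, 0)| + |fderiv ℝ d z (0, 1)|)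

/-- The difference of two vertical translates of a solution of a quasilinear elliptic equation that
is invariant under vertical translation satisfies a linear elliptic inequality. -/
lemma exists_ellipticIneq_vertDiff {w : ℝ × ℝ → ℝ} {z₀ : ℝ × ℝ} (hw : ContDiffAt ℝ 2 w z₀)
    {A B C f : ℝ × ℝ × ℝ × ℝ → ℝ} (hA : ContDiffAt ℝ 1 A (firstJet w z₀))
    (hB : ContDiffAt ℝ 1 B (firstJet w z₀)) (hC : ContDiffAt ℝ 1 C (firstJet w z₀))
    (hf : ContDiffAt ℝ 1 f (firstJet w z₀)) (hC0 : 0 < C (firstJet w z₀))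
    (hdet : 0 < A (firstJet w z₀) * C (firstJet w z₀) - B (firstJet w z₀) ^ 2)
    (heq : ∀ᶠ z in 𝓝 z₀,
      opAt (A (firstJet w z)) (B (firstJet w z)) (C (firstJet w z)) w z = f (firstJet w z))
    {ε : ℝ} (hε : |ε| = 1) :
    ∃ lam Lam K δ : ℝ, 0 < lam ∧ 0 < Lam ∧ 0 < K ∧ 0 < δ ∧ ∀ z ∈ Metric.ball z₀ δ,
      ContDiffAt ℝ 2 w z ∧ ∀ h, z + (0, h) ∈ Metric.ball z₀ δ →
        EllipticIneq lam Lam K (vertDiff ε h w) z := by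
  -- Lipschitz dependence of the coefficients on the jet suffices; third derivatives of `w` never
  -- occur.
  obtain ⟨KA, tA, htA, hKA⟩ := hA.exists_lipschitzOnWith
  obtain ⟨KB, tB, htB, hKB⟩ := hB.exists_lipschitzOnWith
  obtain ⟨KC, tC, htC, hKC⟩ := hC.exists_lipschitzOnWith
  obtain ⟨Kf, tf, htf, hKf⟩ := hf.exists_lipschitzOnWith
  set L : ℝ := KA + KB + KC + Kf with hLdef
  have hDw : ContinuousAt (fderiv ℝ w) z₀ := hw.differentiableAt_fderiv.continuousAt
  have hjet : ContinuousAt (firstJet w) z₀ := by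
    unfold firstJet
    exact continuousAt_fst.prodMk (hw.continuousAt.prodMk
      ((hDw.clm_apply continuousAt_const).prodMk (hDw.clm_apply continuousAt_const)))
  have hD2 : ContinuousAt (fderiv ℝ (fderiv ℝ w)) z₀ :=
    ((hw.fderiv_right (m := 1) (by norm_num)).fderiv_right (m := 0) (by norm_num)).continuousAt
  have hD2n : ContinuousAt (fun z => ‖fderiv ℝ (fderiv ℝ w) z‖) z₀ :=
    ContinuousAt.norm (E := ℝ × ℝ →L[ℝ] ℝ × ℝ →L[ℝ] ℝ) hD2
  set M : ℝ := ‖fderiv ℝ (fderiv ℝ w) z₀‖ + 1 with hMdef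
  have hM0 : 0 ≤ M := by positivity
  set δ₀ : ℝ := (A (firstJet w z₀) * C (firstJet w z₀) - B (firstJet w z₀) ^ 2) / 2 with hδ₀
  have hδ₀pos : 0 < δ₀ := by positivity
  have hA0 : 0 < A (firstJet w z₀) := by
    by_contra! h
    nlinarith [sq_nonneg (B (firstJet w z₀))]
  set Lam : ℝ := A (firstJet w z₀) + C (firstJet w z₀) + 1 with hLamdef
  have hLam : 0 < Lam := by positivity
  set lam : ℝ := δ₀ / Lam with hlamdef
  have hlam : 0 < lam := by positivity
  set K : ℝ := L * (1 + 4 * M) + 1 with hKdef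
  have hK : 0 < K := by
    have : 0 ≤ L := by positivity
    positivity
  have cA := hA.continuousAt.comp hjet
  have cB := hB.continuousAt.comp hjet
  have cC := hC.continuousAt.comp hjet
  have hgood : ∀ᶠ z in 𝓝 z₀, ContDiffAt ℝ 2 w z ∧ firstJet w z ∈ tA ∧ firstJet w z ∈ tB ∧
      firstJet w z ∈ tC ∧ firstJet w z ∈ tf ∧
      ‖fderiv ℝ (fderiv ℝ w) z‖ ≤ M ∧
      0 < C (firstJet w z) ∧ δ₀ < A (firstJet w z) * C (firstJet w z) - B (firstJet w z) ^ 2 ∧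
      A (firstJet w z) + C (firstJet w z) < Lam := by
    filter_upwards [hw.eventually (by simp), hjet.eventually_mem htA, hjet.eventually_mem htB,
      hjet.eventually_mem htC, hjet.eventually_mem htf,
      hD2n.eventually_lt_const (u := M) (by simp [hMdef]),
      cC.eventually (lt_mem_nhds hC0),
      ((cA.mul cC).sub (cB.pow 2)).eventually (lt_mem_nhds (a := δ₀) (by
        change δ₀ < A (firstJet w z₀) * C (firstJet w z₀) - B (firstJet w z₀) ^ 2
        linarith)),
      (cA.add cC).eventually_lt_const (u := Lam) (by
        change A (firstJet w z₀) + C (firstJet w z₀) < Lam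
        linarith)] with z h1 h2 h3 h4 h5 h6 h7 h8 h9
    exact ⟨h1, h2, h3, h4, h5, h6.le, h7, h8, h9⟩
  obtain ⟨δ, hδ, hball⟩ := Metric.eventually_nhds_iff_ball.1 (hgood.and heq)
  refine ⟨lam, Lam, K, δ, hlam, hLam, hK, hδ, fun z hz => ⟨(hball z hz).1.1, fun h hz' => ?_⟩⟩
  obtain ⟨⟨h1, h2, h3, h4, h5, h6, -, -, -⟩, h10⟩ := hball z hz
  obtain ⟨⟨h1', h2', h3', h4', h5', -, hC', hdet', htr'⟩, h10'⟩ := hball _ hz'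
  set D := |vertDiff ε h w z| + |fderiv ℝ (vertDiff ε h w) z (1, 0)|
        + |fderiv ℝ (vertDiff ε h w) z (0, 1)| with hDdef
  have habs : ∀ x : ℝ, |ε * x| = |x| := fun x => by rw [abs_mul, hε, one_mul]
  -- Here vertical invariance enters: the jet omits the height and the first coordinate is
  -- unchanged, so two jets differ only through `vertDiff` and its gradient.
  have hdist : dist (firstJet w (z + (0, h))) (firstJet w z) ≤ D := by
    rw [hDdef, fderiv_vertDiff h1 h1']
    simp only [vertDiff, _root_.smul_apply, _root_.sub_apply, smul_eq_mul, habs, firstJet,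
      Prod.dist_eq, Real.dist_eq, Prod.fst_add, add_zero, sub_self, abs_zero]
    refine max_le (by positivity) (max_le ?_ (max_le ?_ ?_)) <;>
    linarith [abs_nonneg (w (z + (0, h)) - w z),
      abs_nonneg (fderiv ℝ w (z + (0, h)) (1, 0) - fderiv ℝ w z (1, 0)),
      abs_nonneg (fderiv ℝ w (z + (0, h)) (0, 1) - fderiv ℝ w z (0, 1))]
  have hD0 : 0 ≤ D := by positivity
  have hlip : ∀ {g : ℝ × ℝ × ℝ × ℝ → ℝ} {Kg : NNReal} {t : Set (ℝ × ℝ × ℝ × ℝ)},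
      LipschitzOnWith Kg g t → (Kg : ℝ) ≤ L → firstJet w (z + (0, h)) ∈ t → firstJet w z ∈ t →
      |g (firstJet w (z + (0, h))) - g (firstJet w z)| ≤ L * D := by
    intro g Kg t hg hKg hm hm'
    rw [← Real.dist_eq]
    exact (hg.dist_le_mul _ hm _ hm').trans (mul_le_mul hKg hdist dist_nonneg (by positivity))
  have hbd : ∀ v v' : ℝ × ℝ, ‖v‖ ≤ 1 → ‖v'‖ ≤ 1 → |fderiv ℝ (fderiv ℝ w) z v v'| ≤ M := by
    intro v v' hv hv'
    rw [← Real.norm_eq_abs]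
    calc _ ≤ ‖fderiv ℝ (fderiv ℝ w) z‖ * ‖v‖ * ‖v'‖ := ContinuousLinearMap.le_opNorm₂ _ _ _
      _ ≤ M * 1 * 1 := by gcongr
      _ = M := by ring
  have n1 : ‖((1, 0) : ℝ × ℝ)‖ ≤ 1 := by simp [Prod.norm_def]
  have n2 : ‖((0, 1) : ℝ × ℝ)‖ ≤ 1 := by simp [Prod.norm_def]
  have kA : (KA : ℝ) ≤ L := by rw [hLdef]; linarith [KB.2, KC.2, Kf.2]
  have kB : (KB : ℝ) ≤ L := by rw [hLdef]; linarith [KA.2, KC.2, Kf.2]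
  have kC : (KC : ℝ) ≤ L := by rw [hLdef]; linarith [KB.2, KA.2, Kf.2]
  have kf : (Kf : ℝ) ≤ L := by rw [hLdef]; linarith [KB.2, KC.2, KA.2]
  have key := abs_opAt_sub_le (hlip hKA kA h2' h2) (hlip hKB kB h3' h3) (hlip hKC kC h4' h4)
    (hlip hKf kf h5' h5) (hbd _ _ n1 n1) (hbd _ _ n1 n2) (hbd _ _ n2 n2) h10 h10'
  have e : opAt (A (firstJet w (z + (0, h)))) (B (firstJet w (z + (0, h))))
      (C (firstJet w (z + (0, h)))) (vertDiff ε h w) z = ε *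
      (A (firstJet w (z + (0, h))) * (fderiv ℝ (fderiv ℝ w) (z + (0, h)) (1, 0) (1, 0)
          - fderiv ℝ (fderiv ℝ w) z (1, 0) (1, 0))
        + 2 * B (firstJet w (z + (0, h))) * (fderiv ℝ (fderiv ℝ w) (z + (0, h)) (1, 0) (0, 1)
          - fderiv ℝ (fderiv ℝ w) z (1, 0) (0, 1))
        + C (firstJet w (z + (0, h))) * (fderiv ℝ (fderiv ℝ w) (z + (0, h)) (0, 1) (0, 1)
          - fderiv ℝ (fderiv ℝ w) z (0, 1) (0, 1))) := by
    rw [opAt, fderiv_fderiv_vertDiff h1 h1']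
    simp only [_root_.smul_apply, _root_.sub_apply, smul_eq_mul]
    ring
  -- The coefficients of the linear inequality are those at the translated point, matching the
  -- primed ones in `abs_opAt_sub_le`.
  refine ⟨_, _, _, hC', hδ₀pos.trans hdet', htr'.le,
    fun x y => elliptic_lower_bound hδ₀pos hLam hC' hdet' htr', ?_⟩
  refine (le_abs_self _).trans ?_
  rw [e, habs]
  refine key.trans ?_
  rw [hKdef]
  linarith

/-- Propagation of positivity of a vertical derivative whose difference quotients satisfy elliptic
inequalities. -/
lemma fderiv_eq_zero_of_ellipticIneq {w : ℝ × ℝ → ℝ} {z₀ c : ℝ × ℝ} {ε lam Lam K δ : ℝ}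
    (hε : |ε| = 1) (hlam : 0 < lam) (hLam : 0 < Lam) (hK : 0 < K) (hδ : 0 < δ)
    (hball : ∀ z ∈ Metric.ball z₀ δ, ContDiffAt ℝ 2 w z ∧
      ∀ h, z + (0, h) ∈ Metric.ball z₀ δ → EllipticIneq lam Lam K (vertDiff ε h w) z)
    (hsign : ∀ z ∈ Metric.ball z₀ δ, 0 ≤ ε * fderiv ℝ w z (0, 1))
    (hzero : fderiv ℝ w z₀ (0, 1) = 0) (hc : c ∈ Metric.ball z₀ (δ / 8)) :
    fderiv ℝ w c (0, 1) = 0 := by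
  by_contra hne
  have hcδ : c ∈ Metric.ball z₀ δ := Metric.ball_subset_ball (by linarith) hc
  set m : ℝ := ε * fderiv ℝ w c (0, 1) with hm
  have hmpos : 0 < m := lt_of_le_of_ne (hsign c hcδ) (by
    rw [hm]
    refine (mul_ne_zero ?_ hne).symm
    rintro rfl
    simp at hε)
  have hDc : ContinuousAt (fun z => ε * fderiv ℝ w z (0, 1)) c :=
    continuousAt_const.mul
      ((hball c hcδ).1.differentiableAt_fderiv.continuousAt.clm_apply continuousAt_const)
  obtain ⟨r, hr, hrball⟩ := Metric.eventually_nhds_iff_ball.1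
    (hDc.eventually (lt_mem_nhds (a := m / 2) (by linarith)))
  -- With `t ≤ h < ρ`, a vertical segment starting on the inner circle stays where the derivative
  -- exceeds `m / 2`, and one starting in the disc of radius `R = δ / 2` about `c` stays in the ball
  -- of radius `δ`.
  set ρ : ℝ := min (r / 2) (δ / 8) with hρdef
  have hρ : 0 < ρ := by positivity
  have hρr : ρ ≤ r / 2 := min_le_left _ _
  have hρδ : ρ ≤ δ / 8 := min_le_right _ _
  set R : ℝ := δ / 2 with hRdef
  have hR : 0 < R := by positivity
  -- The exponent is fixed before `h` is chosen, so the bound survives division by `h` and the limit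
  -- `h → 0`.
  obtain ⟨α, hα, hbar⟩ := exists_barrier_le hlam hLam hK hρ hR
  have hvert : ∀ (z : ℝ × ℝ) (t : ℝ), dist (z + (0, t)) z = |t| := by
    intro z t
    rw [dist_eq_norm, add_sub_cancel_left, Prod.norm_def]
    simp
  have hz₀c : dist z₀ c < δ / 8 := by rw [dist_comm]; exact hc
  -- The derivative vanishes at `z₀` but exceeds `m / 2` throughout the inner disc.
  have hz₀1 : ρ ^ 2 ≤ sqNorm (z₀ - c) := by
    by_contra! h
    have h1 := dist_le_of_sqNorm_sub_le hρ.le h.le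
    have h2 := hrball z₀ (by rw [Metric.mem_ball]; linarith)
    rw [hzero, mul_zero] at h2
    linarith
  have hz₀2 : sqNorm (z₀ - c) < R ^ 2 := by
    refine (sqNorm_sub_lt_of_dist_lt hz₀c).trans ?_
    rw [hRdef]
    linarith [sq_pos_of_pos hδ]
  have hηpos : 0 < barrier α R c z₀ := by
    unfold barrier
    rw [sub_pos, Real.exp_lt_exp]
    linarith [mul_lt_mul_of_pos_left hz₀2 hα]
  have hlow : ∀ h ∈ Ioo 0 ρ, m / 2 * barrier α R c z₀ ≤ vertDiff ε h w z₀ / h := by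
    intro h hh
    have hseg : ∀ z, sqNorm (z - c) ≤ R ^ 2 → ∀ t ∈ Icc 0 h, z + (0, t) ∈ Metric.ball z₀ δ := by
      intro z hz t ht
      rw [Metric.mem_ball]
      have h1 := dist_le_of_sqNorm_sub_le hR.le hz
      have h2 := hvert z t
      rw [abs_of_nonneg ht.1] at h2
      have h3 := dist_triangle4 (z + (0, t)) z c z₀
      have h4 : dist c z₀ < δ / 8 := hc
      have h5 : t ≤ h := ht.2
      have h6 : h < ρ := hh.2
      rw [hRdef] at h1
      linarith
    have hseg0 : ∀ z, sqNorm (z - c) ≤ R ^ 2 → z ∈ Metric.ball z₀ δ := by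
      intro z hz
      have h1 := hseg z hz 0 (left_mem_Icc.2 hh.1.le)
      have e : z + ((0 : ℝ), (0 : ℝ)) = z := by simp
      rwa [e] at h1
    rw [le_div_iff₀ hh.1]
    have hdiff : ∀ z, sqNorm (z - c) ≤ R ^ 2 → ∀ t ∈ Icc 0 h,
        DifferentiableAt ℝ w (z + (0, t)) := fun z hz t ht =>
      (hball _ (hseg z hz t ht)).1.differentiableAt two_ne_zero
    -- On the inner circle the mean value inequality bounds the difference below by `m / 2 * h`.
    have hmain := hbar c (vertDiff ε h w) (m / 2 * h) (mul_pos (by linarith) hh.1)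
      (fun z _ hz => by
        have g0 := hball z (hseg0 z hz)
        have hzh := hseg z hz h (right_mem_Icc.2 hh.1.le)
        refine ⟨contDiffAt_vertDiff g0.1 (hball _ hzh).1, ?_, g0.2 h hzh⟩
        have := le_vertDiff (m := 0) hh.1.le (hdiff z hz)
          (fun t ht => hsign _ (hseg z hz t ht))
        simpa using this)
      (fun z hz => by
        have hzR : sqNorm (z - c) ≤ R ^ 2 := by
          rw [hz, hRdef]; exact pow_le_pow_left₀ hρ.le (by linarith) 2
        refine le_vertDiff hh.1.le (hdiff z hzR) fun t ht => (hrball _ ?_).le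
        rw [Metric.mem_ball]
        have h1 := dist_le_of_sqNorm_sub_le hρ.le hz.le
        have h2 := hvert z t
        rw [abs_of_nonneg ht.1] at h2
        have h3 := dist_triangle (z + (0, t)) z c
        have h5 : t ≤ h := ht.2
        have h6 : h < ρ := hh.2
        linarith)
      z₀ hz₀1 hz₀2.le
    linarith
  -- The quotients at `z₀` tend to the vanishing derivative there, contradicting the uniform
  -- positive lower bound.
  have hlim : Tendsto (fun h => vertDiff ε h w z₀ / h) (𝓝[>] 0) (𝓝 0) := by
    have hline : HasDerivAt (fun t : ℝ => z₀ + ((0 : ℝ), t)) ((0 : ℝ), (1 : ℝ)) 0 :=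
      ((hasDerivAt_const _ (0 : ℝ)).prodMk (hasDerivAt_id (0 : ℝ))).const_add z₀
    have e : z₀ + ((0 : ℝ), (0 : ℝ)) = z₀ := by simp
    have hw0 : HasFDerivAt w (fderiv ℝ w z₀) (z₀ + ((0 : ℝ), (0 : ℝ))) := by
      rw [e]
      exact ((hball z₀ (Metric.mem_ball_self hδ)).1.differentiableAt two_ne_zero).hasFDerivAt
    have h1 := (hw0.comp_hasDerivAt (0 : ℝ) hline).const_mul ε
    rw [hzero, mul_zero, hasDerivAt_iff_tendsto_slope] at h1
    refine (h1.mono_left (nhdsWithin_mono _ fun x hx => ne_of_gt hx)).congr fun h => ?_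
    simp only [slope, vertDiff, sub_zero, vsub_eq_sub, Function.comp, e, smul_eq_mul]
    ring
  have := ge_of_tendsto hlim (by
    filter_upwards [Ioo_mem_nhdsGT hρ] with h hh using hlow h hh)
  have h2 : 0 < m / 2 * barrier α R c z₀ := by positivity
  linarith

/-- If the derivative of a solution of a quasilinear elliptic equation in a direction under which
the equation is invariant has a sign, then its zero set is open. -/
theorem eventually_fderiv_eq_zero_of_sign {w : ℝ × ℝ → ℝ} {z₀ : ℝ × ℝ} (hw : ContDiffAt ℝ 2 w z₀)
    {A B C f : ℝ × ℝ × ℝ × ℝ → ℝ} (hA : ContDiffAt ℝ 1 A (firstJet w z₀))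
    (hB : ContDiffAt ℝ 1 B (firstJet w z₀)) (hC : ContDiffAt ℝ 1 C (firstJet w z₀))
    (hf : ContDiffAt ℝ 1 f (firstJet w z₀)) (hC0 : 0 < C (firstJet w z₀))
    (hdet : 0 < A (firstJet w z₀) * C (firstJet w z₀) - B (firstJet w z₀) ^ 2)
    (heq : ∀ᶠ z in 𝓝 z₀,
      opAt (A (firstJet w z)) (B (firstJet w z)) (C (firstJet w z)) w z = f (firstJet w z))
    {ε : ℝ} (hε : |ε| = 1) (hsign : ∀ᶠ z in 𝓝 z₀, 0 ≤ ε * fderiv ℝ w z (0, 1))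
    (hzero : fderiv ℝ w z₀ (0, 1) = 0) :
    ∀ᶠ z in 𝓝 z₀, fderiv ℝ w z (0, 1) = 0 := by
  obtain ⟨lam, Lam, K, δ, hlam, hLam, hK, hδ, hball⟩ :=
    exists_ellipticIneq_vertDiff hw hA hB hC hf hC0 hdet heq hε
  obtain ⟨δ', hδ', hball'⟩ := Metric.eventually_nhds_iff_ball.1 hsign
  have hle : Metric.ball z₀ (min δ δ') ⊆ Metric.ball z₀ δ := Metric.ball_subset_ball (min_le_left _ _)
  have hle' : Metric.ball z₀ (min δ δ') ⊆ Metric.ball z₀ δ' :=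
    Metric.ball_subset_ball (min_le_right _ _)
  filter_upwards [Metric.ball_mem_nhds z₀ (show 0 < min δ δ' / 8 by positivity)] with c hc
  exact fderiv_eq_zero_of_ellipticIneq hε hlam hLam hK (lt_min hδ hδ')
    (fun z hz => ⟨(hball z (hle hz)).1, fun h hz' => (hball z (hle hz)).2 h (hle hz')⟩)
    (fun z hz => hball' z (hle' hz)) hzero hc

/-! ### Jets of parametrized surfaces -/

section SecondDerivative

variable {V W X : Type*} [NormedAddCommGroup V] [NormedSpace ℝ V] [NormedAddCommGroup W]
  [NormedSpace ℝ W] [NormedAddCommGroup X] [NormedSpace ℝ X]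

lemma fderiv_fderiv_comp {g : W → X} {k : V → W} {x : V} (hg : ContDiffAt ℝ 2 g (k x))
    (hk : ContDiffAt ℝ 2 k x) (v v' : V) :
    fderiv ℝ (fderiv ℝ (g ∘ k)) x v v' =
      fderiv ℝ (fderiv ℝ g) (k x) (fderiv ℝ k x v) (fderiv ℝ k x v') +
        fderiv ℝ g (k x) (fderiv ℝ (fderiv ℝ k) x v v') := by
  have hev : fderiv ℝ (g ∘ k) =ᶠ[𝓝 x] fun y => (fderiv ℝ g (k y)).comp (fderiv ℝ k y) := by
    filter_upwards [hk.continuousAt.eventually (hg.eventually (by simp)), hk.eventually (by simp)]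
      with y h1 h2
    exact fderiv_comp y (h1.differentiableAt two_ne_zero) (h2.differentiableAt two_ne_zero)
  rw [hev.fderiv_eq]
  have h1 : HasFDerivAt (fun y => fderiv ℝ g (k y))
      ((fderiv ℝ (fderiv ℝ g) (k x)).comp (fderiv ℝ k x)) x :=
    hg.differentiableAt_fderiv.hasFDerivAt.comp x (hk.differentiableAt two_ne_zero).hasFDerivAt
  rw [(h1.clm_comp hk.differentiableAt_fderiv.hasFDerivAt).fderiv]
  simp [add_comm]

lemma fderiv_clm_comp_apply (T : W →L[ℝ] X) {k : V → W} {x : V} (hk : ContDiffAt ℝ 2 k x) (v : V) :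
    fderiv ℝ (fun y => T (k y)) x v = T (fderiv ℝ k x v) := by
  have h : HasFDerivAt (fun y => T (k y)) (T.comp (fderiv ℝ k x)) x :=
    T.hasFDerivAt.comp x (hk.differentiableAt two_ne_zero).hasFDerivAt
  rw [h.fderiv]
  rfl

lemma fderiv_fderiv_clm_comp_apply (T : W →L[ℝ] X) {k : V → W} {x : V} (hk : ContDiffAt ℝ 2 k x)
    (v v' : V) :
    fderiv ℝ (fderiv ℝ fun y => T (k y)) x v v' = T (fderiv ℝ (fderiv ℝ k) x v v') := by
  have := fderiv_fderiv_comp (g := T) T.contDiff.contDiffAt hk v v'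
  have h2 : fderiv ℝ (fderiv ℝ T) (k x) = 0 := by
    have : fderiv ℝ T = fun _ => T := by funext y; exact T.fderiv
    rw [this]; simp
  rw [h2, T.fderiv] at this
  simpa [Function.comp_def] using this

end SecondDerivative

/-- The coordinate vector of the plane. -/
noncomputable abbrev planeVec (a : Fin 2) : Plane := EuclideanSpace.single a (1 : ℝ)

/-- The tangent vector in direction `a` of the parametrized surface `f`. -/
noncomputable def tangentAt (f : Plane → Plane × ℝ) (z : Plane) (a : Fin 2) : Plane × ℝ :=
  fderiv ℝ f z (planeVec a)

/-- The second derivative in directions `a`, `b` of the parametrized surface `f`. -/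
noncomputable def secondAt (f : Plane → Plane × ℝ) (z : Plane) (a b : Fin 2) : Plane × ℝ :=
  fderiv ℝ (fderiv ℝ f) z (planeVec a) (planeVec b)

/-- The mean curvature expression of the parametrized surface `f`. -/
noncomputable def surfaceOp (κ : Plane → MetricCoeffs) (i j : Fin 2) (f : Plane → Plane × ℝ)
    (z : Plane) : ℝ :=
  paramOp (κ (f z).1) i j (tangentAt f z 0) (tangentAt f z 1) (secondAt f z 0 0) (secondAt f z 0 1)
    (secondAt f z 1 1)

/-- The squared length of the conormal of the parametrized surface `f`. -/
noncomputable def surfaceConormalSq (κ : Plane → MetricCoeffs) (i j : Fin 2)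
    (f : Plane → Plane × ℝ) (z : Plane) : ℝ :=
  conormalSq (κ (f z).1) i j (tangentAt f z 0) (tangentAt f z 1)

/-- The Jacobian of the horizontal part of the parametrized surface `f`. -/
noncomputable def surfaceVert (i j : Fin 2) (f : Plane → Plane × ℝ) (z : Plane) : ℝ :=
  crossVert i j (tangentAt f z 0) (tangentAt f z 1)

/-- The first component of the conormal of the parametrized surface `f`. -/
noncomputable def surfaceFst (j : Fin 2) (f : Plane → Plane × ℝ) (z : Plane) : ℝ :=
  crossFst j (tangentAt f z 0) (tangentAt f z 1)

/-- The second component of the conormal of the parametrized surface `f`. -/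
noncomputable def surfaceSnd (i : Fin 2) (f : Plane → Plane × ℝ) (z : Plane) : ℝ :=
  crossSnd i (tangentAt f z 0) (tangentAt f z 1)

/-- The point of the plane with `i`-th coordinate `x` and `j`-th coordinate `y`. -/
noncomputable def planePoint (i j : Fin 2) (x y : ℝ) : Plane := x • planeVec i + y • planeVec j

lemma planePoint_self {i j : Fin 2} (hij : i ≠ j) (v : Plane) : planePoint i j (v i) (v j) = v := by
  rcases Fin.two_cases_of_ne hij with ⟨rfl, rfl⟩ | ⟨rfl, rfl⟩ <;>
  · ext k
    fin_cases k <;> simp [planePoint]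

lemma planeVec_sum (v : Plane) : v = v 0 • planeVec 0 + v 1 • planeVec 1 :=
  (planePoint_self (by decide) v).symm

/-- The projection of a parametrized surface to a vertical coordinate plane. -/
noncomputable def sideProj (j : Fin 2) : Plane × ℝ →L[ℝ] ℝ × ℝ :=
  ((EuclideanSpace.proj j : Plane →L[ℝ] ℝ).comp (ContinuousLinearMap.fst ℝ Plane ℝ)).prod
    (ContinuousLinearMap.snd ℝ Plane ℝ)

@[simp] lemma sideProj_apply (j : Fin 2) (t : Plane × ℝ) : sideProj j t = (t.1 j, t.2) := rfl

/-- The horizontal coordinate `i` as a linear form. -/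
noncomputable def coordProj (i : Fin 2) : Plane × ℝ →L[ℝ] ℝ :=
  (EuclideanSpace.proj i : Plane →L[ℝ] ℝ).comp (ContinuousLinearMap.fst ℝ Plane ℝ)

@[simp] lemma coordProj_apply (i : Fin 2) (t : Plane × ℝ) : coordProj i t = t.1 i := rfl

/-- `crossFst j` is, by Cramer's rule, the Jacobian determinant of the projection to the `(x_j,
r)`-plane. -/
lemma injective_sideProj_comp {j : Fin 2} {T : Plane →L[ℝ] Plane × ℝ}
    (h : crossFst j (T (planeVec 0)) (T (planeVec 1)) ≠ 0) :
    Function.Injective ((sideProj j).comp T) := by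
  rw [injective_iff_map_eq_zero]
  intro v hv
  have hv' := planeVec_sum v
  set t₁ := T (planeVec 0)
  set t₂ := T (planeVec 1)
  have e : T v = v 0 • t₁ + v 1 • t₂ := by
    conv_lhs => rw [hv']
    simp [t₁, t₂]
  rw [ContinuousLinearMap.comp_apply, e] at hv
  simp only [sideProj_apply, Prod.fst_add, Prod.snd_add, Prod.smul_fst, Prod.smul_snd,
    PiLp.add_apply, PiLp.smul_apply, smul_eq_mul, Prod.mk_eq_zero] at hv
  unfold crossFst at h
  have h0 : v 0 = 0 := by
    have : v 0 * (t₁.1 j * t₂.2 - t₁.2 * t₂.1 j) = 0 := by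
      linear_combination t₂.2 * hv.1 - t₂.1 j * hv.2
    exact (mul_eq_zero.1 this).resolve_right h
  have h1 : v 1 = 0 := by
    have : v 1 * (t₁.1 j * t₂.2 - t₁.2 * t₂.1 j) = 0 := by
      linear_combination t₁.1 j * hv.2 - t₁.2 * hv.1
    exact (mul_eq_zero.1 this).resolve_right h
  rw [hv', h0, h1]
  simp

/-- A surface transverse to a horizontal coordinate direction is a graph over the corresponding
vertical coordinate plane. -/
lemma exists_horizontal_graph {f : Plane → Plane × ℝ} {z₀ : Plane} {i j : Fin 2}
    (hf : ContDiffAt ℝ 2 f z₀) (h : surfaceFst j f z₀ ≠ 0) :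
    ∃ (w : ℝ × ℝ → ℝ) (q : ℝ × ℝ → Plane), ContDiffAt ℝ 2 w (sideProj j (f z₀)) ∧
      (∀ᶠ z in 𝓝 z₀, w (sideProj j (f z)) = (f z).1 i) ∧
      Tendsto q (𝓝 (sideProj j (f z₀))) (𝓝 z₀) ∧
      ∀ᶠ y in 𝓝 (sideProj j (f z₀)), sideProj j (f (q y)) = y := by
  set P : Plane → ℝ × ℝ := fun z => sideProj j (f z) with hP
  have hPc : ContDiffAt ℝ 2 P z₀ := (sideProj j).contDiff.contDiffAt.comp z₀ hf
  have hinj := injective_sideProj_comp (j := j) (T := fderiv ℝ f z₀) h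
  let e₀ : Plane ≃ₗ[ℝ] ℝ × ℝ := LinearEquiv.ofInjectiveOfFinrankEq
    ((sideProj j).comp (fderiv ℝ f z₀) : Plane →ₗ[ℝ] ℝ × ℝ) hinj (by simp)
  let e : Plane ≃L[ℝ] ℝ × ℝ := e₀.toContinuousLinearEquiv
  have hder : HasFDerivAt P (e : Plane →L[ℝ] ℝ × ℝ) z₀ := by
    have h1 : HasFDerivAt P ((sideProj j).comp (fderiv ℝ f z₀)) z₀ :=
      (sideProj j).hasFDerivAt.comp z₀ (hf.differentiableAt two_ne_zero).hasFDerivAt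
    convert h1 using 1
    exact ContinuousLinearMap.ext fun v => rfl
  have h2 : (2 : WithTop ℕ∞) ≠ 0 := two_ne_zero
  -- The inverse function theorem for the projected surface; `w` is the coordinate `x_i` along the
  -- local inverse, and `q` is that inverse.
  set Φ := hPc.toOpenPartialHomeomorph P hder h2 with hΦ
  have hΦc : ⇑Φ = P := hPc.toOpenPartialHomeomorph_coe hder h2
  have hmem : z₀ ∈ Φ.source := hPc.mem_toOpenPartialHomeomorph_source hder h2
  have hq : ContDiffAt ℝ 2 Φ.symm (P z₀) := hPc.to_localInverse hder h2
  have hq0 : Φ.symm (P z₀) = z₀ := by rw [← hΦc]; exact Φ.left_inv hmem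
  have hmem' : P z₀ ∈ Φ.target := by rw [← hΦc]; exact Φ.map_source hmem
  refine ⟨fun y => (f (Φ.symm y)).1 i, Φ.symm, ?_, ?_, ?_, ?_⟩
  · have : ContDiffAt ℝ 2 (fun y => f (Φ.symm y)) (P z₀) :=
      ContDiffAt.comp (P z₀) (g := f) (by rw [hq0]; exact hf) hq
    exact (coordProj i).contDiff.contDiffAt.comp (P z₀) this
  · filter_upwards [Φ.open_source.mem_nhds hmem] with z hz
    have : Φ.symm (P z) = z := by rw [← hΦc]; exact Φ.left_inv hz
    change (f (Φ.symm (P z))).1 i = _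
    rw [this]
  · have := hq.continuousAt.tendsto
    rwa [hq0] at this
  · filter_upwards [Φ.open_target.mem_nhds hmem'] with y hy
    have := Φ.right_inv hy
    rwa [hΦc] at this

/-- The coefficient of the second derivatives in the mean curvature equation of a graph over a
vertical plane. -/
noncomputable def horizontalCoeff (κ : MetricCoeffs) (i j : Fin 2) (p q : ℝ) : Fin 3 → ℝ :=
  ![κ.1 j j * q ^ 2 + (κ.1 i i * κ.1 j j - κ.1 i j ^ 2), (κ.1 i j - κ.1 j j * p) * q,
    κ.1 i i - 2 * κ.1 i j * p + κ.1 j j * p ^ 2]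

/-- The mean curvature of a surface that is locally the graph of `w` over a vertical plane. -/
lemma surfaceOp_horizontal {κ : Plane → MetricCoeffs} {f : Plane → Plane × ℝ} {z : Plane}
    {i j : Fin 2} {w : ℝ × ℝ → ℝ} (hf : ContDiffAt ℝ 2 f z)
    (hw : ContDiffAt ℝ 2 w (sideProj j (f z)))
    (hfw : ∀ᶠ z' in 𝓝 z, w (sideProj j (f z')) = (f z').1 i) {p q : ℝ}
    (hp : fderiv ℝ w (sideProj j (f z)) (1, 0) = p) (hq : fderiv ℝ w (sideProj j (f z)) (0, 1) = q) :
    surfaceVert i j f z = -q * surfaceFst j f z ∧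
    surfaceConormalSq κ i j f z = surfaceFst j f z ^ 2 * horizontalSq (κ (f z).1) i j p q ∧
    surfaceOp κ i j f z = surfaceFst j f z ^ 3 *
      (opAt (horizontalCoeff (κ (f z).1) i j p q 0) (horizontalCoeff (κ (f z).1) i j p q 1)
        (horizontalCoeff (κ (f z).1) i j p q 2) w (sideProj j (f z))
        + horizontalLower (κ (f z).1) i j p q) := by
  have hpair : ∀ (T : ℝ × ℝ →L[ℝ] ℝ) (a b : ℝ), T (a, b) = a * T (1, 0) + b * T (0, 1) := by
    intro T a b
    have : ((a, b) : ℝ × ℝ) = a • (1, 0) + b • (0, 1) := by simp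
    rw [this, map_add, map_smul, map_smul, smul_eq_mul, smul_eq_mul]
  have hPc : ContDiffAt ℝ 2 (fun z => sideProj j (f z)) z :=
    (sideProj j).contDiff.contDiffAt.comp z hf
  have hev : (fun z => coordProj i (f z)) =ᶠ[𝓝 z] w ∘ fun z => sideProj j (f z) := by
    filter_upwards [hfw] with z' hz' using hz'.symm
  have hwd : DifferentiableAt ℝ w (sideProj j (f z)) := hw.differentiableAt two_ne_zero
  have hfirst : ∀ v, (fderiv ℝ f z v).1 i = p * (fderiv ℝ f z v).1 j + q * (fderiv ℝ f z v).2 := by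
    intro v
    have h1 := fderiv_clm_comp_apply (coordProj i) hf v
    have h2 : fderiv ℝ (w ∘ fun z => sideProj j (f z)) z v =
        fderiv ℝ w (sideProj j (f z)) (sideProj j (fderiv ℝ f z v)) := by
      rw [fderiv_comp z hwd (hPc.differentiableAt two_ne_zero), ContinuousLinearMap.comp_apply,
        fderiv_clm_comp_apply (sideProj j) hf v]
    rw [hev.fderiv_eq, h2, sideProj_apply j (fderiv ℝ f z v), hpair, hp, hq, coordProj_apply] at h1
    linarith
  have hsymm := hw.hessian_symm (0, 1) (1, 0)
  set H := fderiv ℝ (fderiv ℝ w) (sideProj j (f z)) with hH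
  have hsecond : ∀ v v', (fderiv ℝ (fderiv ℝ f) z v v').1 i =
      p * (fderiv ℝ (fderiv ℝ f) z v v').1 j + q * (fderiv ℝ (fderiv ℝ f) z v v').2
      + (H (1, 0) (1, 0) * ((fderiv ℝ f z v).1 j * (fderiv ℝ f z v').1 j)
        + H (1, 0) (0, 1) * ((fderiv ℝ f z v).1 j * (fderiv ℝ f z v').2
          + (fderiv ℝ f z v).2 * (fderiv ℝ f z v').1 j)
        + H (0, 1) (0, 1) * ((fderiv ℝ f z v).2 * (fderiv ℝ f z v').2)) := by
    intro v v'
    have h1 := fderiv_fderiv_clm_comp_apply (coordProj i) hf v v'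
    have hev' : fderiv ℝ (fun z => coordProj i (f z)) =ᶠ[𝓝 z]
      fderiv ℝ (w ∘ fun z => sideProj j (f z)) := hev.fderiv
    have h2 := fderiv_fderiv_comp (g := w) (k := fun z => sideProj j (f z)) hw hPc v v'
    rw [fderiv_fderiv_clm_comp_apply _ hf, fderiv_clm_comp_apply _ hf,
      fderiv_clm_comp_apply _ hf, sideProj_apply j (fderiv ℝ f z v),
      sideProj_apply j (fderiv ℝ f z v'), sideProj_apply j (fderiv ℝ (fderiv ℝ f) z v v'),
      hpair (fderiv ℝ w (sideProj j (f z))), hp, hq, ← hH, hpair] at h2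
    rw [hev'.fderiv_eq, h2, coordProj_apply] at h1
    have e1 : ∀ (a b : ℝ) (v : ℝ × ℝ), H (a, b) v = a * H (1, 0) v + b * H (0, 1) v := by
      intro a b v
      have : ((a, b) : ℝ × ℝ) = a • (1, 0) + b • (0, 1) := by simp
      rw [this, map_add, map_smul, map_smul]
      rfl
    rw [e1 _ _ (1, 0), e1 _ _ (0, 1), hsymm] at h1
    rw [← h1]
    ring
  refine ⟨crossVert_horizontal (hfirst _) (hfirst _), conormalSq_horizontal (hfirst _) (hfirst _),
    ?_⟩
  exact paramOp_horizontal (κ := κ (f z).1) (hfirst _) (hfirst _) (hsecond _ _) (hsecond _ _)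
    (hsecond _ _)

/-! ### Regularity and ellipticity of the equation over a vertical plane. -/

section HorizontalRegularity

variable {K : ℝ × ℝ × ℝ × ℝ → MetricCoeffs} {J : ℝ × ℝ × ℝ × ℝ}

lemma contDiffAt_inverseMetric (hK : ContDiffAt ℝ 1 K J) (k l : Fin 2) :
    ContDiffAt ℝ 1 (fun x => (K x).1 k l) J :=
  contDiffAt_pi.1 (contDiffAt_pi.1 hK.fst k) l

lemma contDiffAt_laplaceCoeff (hK : ContDiffAt ℝ 1 K J) (k : Fin 2) :
    ContDiffAt ℝ 1 (fun x => (K x).2.1 k) J :=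
  contDiffAt_pi.1 hK.snd.fst k

lemma contDiffAt_derivCoeff (hK : ContDiffAt ℝ 1 K J) (k l m : Fin 2) :
    ContDiffAt ℝ 1 (fun x => (K x).2.2 k l m) J :=
  contDiffAt_pi.1 (contDiffAt_pi.1 (contDiffAt_pi.1 hK.snd.snd k) l) m

lemma contDiffAt_horizontalCoeff (hK : ContDiffAt ℝ 1 K J) (i j : Fin 2) (k : Fin 3) :
    ContDiffAt ℝ 1 (fun x => horizontalCoeff (K x) i j x.2.2.1 x.2.2.2 k) J := by
  have h := contDiffAt_inverseMetric hK
  have h₁ := h i i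
  have h₂ := h i j
  have h₃ := h j j
  fin_cases k <;> simp [horizontalCoeff] <;> fun_prop

lemma contDiffAt_horizontalSq (hK : ContDiffAt ℝ 1 K J) (i j : Fin 2) :
    ContDiffAt ℝ 1 (fun x => horizontalSq (K x) i j x.2.2.1 x.2.2.2) J := by
  have h := contDiffAt_inverseMetric hK
  have h₁ := h i i
  have h₂ := h i j
  have h₃ := h j j
  unfold horizontalSq
  fun_prop

lemma contDiffAt_horizontalLower (hK : ContDiffAt ℝ 1 K J) (i j : Fin 2) :
    ContDiffAt ℝ 1 (fun x => horizontalLower (K x) i j x.2.2.1 x.2.2.2) J := by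
  have h := contDiffAt_inverseMetric hK
  have h₁ := h i i
  have h₂ := h i j
  have h₃ := h j j
  have b₁ := contDiffAt_laplaceCoeff hK i
  have b₂ := contDiffAt_laplaceCoeff hK j
  have c := contDiffAt_derivCoeff hK
  have c₁ := c i i i
  have c₂ := c i i j
  have c₃ := c i j i
  have c₄ := c i j j
  have c₅ := c j i i
  have c₆ := c j i j
  have c₇ := c j j i
  have c₈ := c j j j
  have hs := contDiffAt_horizontalSq hK i j
  unfold horizontalLower lowerPart
  fun_prop

end HorizontalRegularity

/-- Completing the square, the first expression times `κ.1 j j` equals `det + (κ.1 j j * p - κ.1 i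
j)²`. It is the squared length of `dx_i - p dx_j` and also the coefficient of `w_rr`. -/
lemma horizontalSq_pos {κ : MetricCoeffs} {i j : Fin 2} {p q : ℝ} (hpos : 0 < κ.1 j j)
    (hdet : 0 < κ.1 i i * κ.1 j j - κ.1 i j ^ 2) :
    0 < κ.1 i i - 2 * κ.1 i j * p + κ.1 j j * p ^ 2 ∧ 0 < horizontalSq κ i j p q := by
  have h : 0 < κ.1 i i - 2 * κ.1 i j * p + κ.1 j j * p ^ 2 := by
    have h1 : 0 < κ.1 j j * (κ.1 i i - 2 * κ.1 i j * p + κ.1 j j * p ^ 2) := by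
      nlinarith [sq_nonneg (κ.1 j j * p - κ.1 i j)]
    exact pos_of_mul_pos_right h1 hpos.le
  refine ⟨h, ?_⟩
  unfold horizontalSq
  nlinarith [sq_nonneg q]

/-- A surface whose mean curvature is given by a vertically invariant expression, and whose angle
function has a sign, has vertical tangent planes near each vertical tangent plane. -/
theorem eventually_surfaceVert_eq_zero {κ : Plane → MetricCoeffs} {f : Plane → Plane × ℝ}
    {z₀ : Plane} {i j : Fin 2} (hij : i ≠ j) (hf : ContDiffAt ℝ 2 f z₀)
    (hκ : ContDiffAt ℝ 1 κ (f z₀).1) (hpos : 0 < (κ (f z₀).1).1 j j)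
    (hdet : 0 < (κ (f z₀).1).1 i i * (κ (f z₀).1).1 j j - (κ (f z₀).1).1 i j ^ 2)
    (hfst : surfaceFst j f z₀ ≠ 0) (hvert : surfaceVert i j f z₀ = 0) {c τ σ : ℝ}
    (heq : ∀ᶠ z in 𝓝 z₀, surfaceOp κ i j f z =
      c * √(surfaceConormalSq κ i j f z) ^ 3
        + τ * (surfaceVert i j f z * surfaceConormalSq κ i j f z))
    (hσ : |σ| = 1) (hsign : ∀ᶠ z in 𝓝 z₀, 0 ≤ σ * surfaceVert i j f z) :
    ∀ᶠ z in 𝓝 z₀, surfaceVert i j f z = 0 := by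
  obtain ⟨w, g, hw, hwf, hg, hfg⟩ := exists_horizontal_graph (i := i) hf hfst
  set y₀ := sideProj j (f z₀) with hy₀
  have hwf₀ : w y₀ = (f z₀).1 i := hwf.self_of_nhds
  have hP : Tendsto (fun z => sideProj j (f z)) (𝓝 z₀) (𝓝 y₀) :=
    ((sideProj j).continuous.continuousAt.comp hf.continuousAt).tendsto
  -- The sign of the transversal component of the conormal.
  obtain ⟨s, hs, hsm⟩ : ∃ s : ℝ, |s| = 1 ∧ ∀ᶠ z in 𝓝 z₀, 0 < s * surfaceFst j f z := by
    have hcont : ContinuousAt (surfaceFst j f) z₀ := by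
      have hD : ContinuousAt (fderiv ℝ f) z₀ := hf.differentiableAt_fderiv.continuousAt
      have ht : ∀ a, ContinuousAt (fun z => tangentAt f z a) z₀ := fun a =>
        hD.clm_apply continuousAt_const
      have hp : ∀ a k, ContinuousAt (fun z => (tangentAt f z a).1 k) z₀ := fun a k =>
        (coordProj k).continuous.continuousAt.comp (ht a)
      exact ((hp 0 j).mul (ht 1).snd).sub ((ht 0).snd.mul (hp 1 j))
    rcases lt_or_gt_of_ne hfst with h | h
    · refine ⟨-1, by simp, ?_⟩
      filter_upwards [hcont.eventually_lt_const h] with z hz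
      linarith
    · refine ⟨1, by simp, ?_⟩
      filter_upwards [hcont.eventually_const_lt h] with z hz
      linarith
  -- The equation of the graph, with coefficients that are functions of the jet.
  set K : ℝ × ℝ × ℝ × ℝ → MetricCoeffs := fun J => κ (planePoint i j J.2.1 J.1) with hK
  have hpt : ∀ᶠ z in 𝓝 z₀, ContDiffAt ℝ 2 f z ∧ ContDiffAt ℝ 2 w (sideProj j (f z)) ∧
      (∀ᶠ z' in 𝓝 z, w (sideProj j (f z')) = (f z').1 i) ∧
      K (firstJet w (sideProj j (f z))) = κ (f z).1 := by
    filter_upwards [hf.eventually (by simp), hP.eventually (hw.eventually (by simp)),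
      eventually_eventually_nhds.2 hwf] with z h1 h2 h3
    refine ⟨h1, h2, h3, ?_⟩
    have := h3.self_of_nhds
    simp only [hK, firstJet, this]
    rw [sideProj_apply, planePoint_self hij]
  obtain ⟨-, -, -, hK₀⟩ := hpt.self_of_nhds
  have hKc : ContDiffAt ℝ 1 K (firstJet w y₀) := by
    have hpp : planePoint i j (firstJet w y₀).2.1 (firstJet w y₀).1 = (f z₀).1 := by
      simp only [firstJet, hwf₀]
      rw [hy₀, sideProj_apply, planePoint_self hij]
    have h1 : ContDiff ℝ 1 fun J : ℝ × ℝ × ℝ × ℝ => planePoint i j J.2.1 J.1 := by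
      unfold planePoint; fun_prop
    exact ContDiffAt.comp _ (g := κ) (by rw [hpp]; exact hκ) h1.contDiffAt
  rw [← hK₀] at hpos hdet
  have hq₀ : fderiv ℝ w y₀ (0, 1) = 0 := by
    obtain ⟨h1, h2, h3, -⟩ := hpt.self_of_nhds
    have h4 := (surfaceOp_horizontal (κ := κ) h1 h2 h3 rfl rfl).1
    rw [hvert, eq_comm, mul_eq_zero, neg_eq_zero] at h4
    exact h4.resolve_right hfst
  -- Result of dividing the equation by `surfaceFst ^ 3`: the square root of the conormal
  -- contributes `(s * surfaceFst) ^ 3`, with `s ^ 3 = s`, and `surfaceVert = -q * surfaceFst`.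
  set F : ℝ × ℝ × ℝ × ℝ → ℝ := fun J =>
    c * s * √(horizontalSq (K J) i j J.2.2.1 J.2.2.2) ^ 3
      - τ * (J.2.2.2 * horizontalSq (K J) i j J.2.2.1 J.2.2.2)
      - horizontalLower (K J) i j J.2.2.1 J.2.2.2 with hF
  have hFc : ContDiffAt ℝ 1 F (firstJet w y₀) := by
    have h1 := contDiffAt_horizontalSq hKc i j
    have h2 := contDiffAt_horizontalLower hKc i j
    have h3 : ContDiffAt ℝ 1 (fun J => √(horizontalSq (K J) i j J.2.2.1 J.2.2.2))
        (firstJet w y₀) :=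
      h1.sqrt (horizontalSq_pos hpos hdet).2.ne'
    simp only [hF]
    fun_prop
  have hmain : ∀ᶠ z in 𝓝 z₀,
      opAt (horizontalCoeff (K (firstJet w (sideProj j (f z)))) i j
          (firstJet w (sideProj j (f z))).2.2.1 (firstJet w (sideProj j (f z))).2.2.2 0)
        (horizontalCoeff (K (firstJet w (sideProj j (f z)))) i j
          (firstJet w (sideProj j (f z))).2.2.1 (firstJet w (sideProj j (f z))).2.2.2 1)
        (horizontalCoeff (K (firstJet w (sideProj j (f z)))) i j
          (firstJet w (sideProj j (f z))).2.2.1 (firstJet w (sideProj j (f z))).2.2.2 2)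
        w (sideProj j (f z)) = F (firstJet w (sideProj j (f z))) ∧
      0 ≤ (-(σ * s)) * fderiv ℝ w (sideProj j (f z)) (0, 1) := by
    filter_upwards [hpt, heq, hsign, hsm] with z ⟨h1, h2, h3, h4⟩ h5 h6 h7
    obtain ⟨e1, e2, e3⟩ := surfaceOp_horizontal (κ := κ) h1 h2 h3 rfl rfl
    have hm0 : surfaceFst j f z ≠ 0 := by
      intro h0; rw [h0, mul_zero] at h7; exact h7.false
    have habs : |surfaceFst j f z| = s * surfaceFst j f z := by
      rw [← abs_of_pos h7, abs_mul, hs, one_mul]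
    constructor
    · rw [e3, e2, e1, Real.sqrt_mul (sq_nonneg _), Real.sqrt_sq_eq_abs, habs] at h5
      have hss : s ^ 2 = 1 := by rw [← sq_abs, hs, one_pow]
      simp only [h4, hF]
      simp only [firstJet]
      refine mul_left_cancel₀ (pow_ne_zero 3 hm0) ?_
      linear_combination h5 + c * √(horizontalSq (κ (f z).1) i j
        (fderiv ℝ w (sideProj j (f z)) (1, 0)) (fderiv ℝ w (sideProj j (f z)) (0, 1))) ^ 3 * s
        * surfaceFst j f z ^ 3 * hss
    · rw [e1] at h6
      have h8 : 0 ≤ s * surfaceFst j f z *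
          (-(σ * s) * fderiv ℝ w (sideProj j (f z)) (0, 1)) := by
        have hss : s * s = 1 := by rw [← sq, ← sq_abs, hs, one_pow]
        have : s * surfaceFst j f z * (-(σ * s) * fderiv ℝ w (sideProj j (f z)) (0, 1)) =
            (s * s) * (σ * (-fderiv ℝ w (sideProj j (f z)) (0, 1) * surfaceFst j f z)) := by ring
        rw [this, hss, one_mul]
        exact h6
      exact nonneg_of_mul_nonneg_right h8 h7
  -- Every point near `y₀` is the projection of a surface point, so relations along the surface
  -- become relations on an open set of the vertical plane.
  have hmain' := hg.eventually hmain
  have hPhi := eventually_fderiv_eq_zero_of_sign (w := w) (z₀ := y₀) hw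
    (A := fun J => horizontalCoeff (K J) i j J.2.2.1 J.2.2.2 0)
    (B := fun J => horizontalCoeff (K J) i j J.2.2.1 J.2.2.2 1)
    (C := fun J => horizontalCoeff (K J) i j J.2.2.1 J.2.2.2 2) (f := F)
    (contDiffAt_horizontalCoeff hKc i j 0) (contDiffAt_horizontalCoeff hKc i j 1)
    (contDiffAt_horizontalCoeff hKc i j 2) hFc
    (horizontalSq_pos (q := 0) hpos hdet).1
    (by
      have h1 := (horizontalSq_pos (p := (firstJet w y₀).2.2.1) (q := 0) hpos hdet).1
      have h2 : (firstJet w y₀).2.2.2 = 0 := hq₀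
      -- At `q = 0` the mixed coefficient vanishes, and the determinant factors into the determinant
      -- of the inverse metric times the coefficient of `w_rr`.
      simp only [horizontalCoeff, h2, Matrix.cons_val]
      have := mul_pos hdet h1
      linarith)
    (by
      filter_upwards [hmain', hfg] with y h1 h2
      rw [h2] at h1
      exact h1.1)
    (ε := -(σ * s)) (by rw [abs_neg, abs_mul, hσ, hs, one_mul])
    (by
      filter_upwards [hmain', hfg] with y h1 h2
      rw [h2] at h1
      exact h1.2)
    hq₀
  filter_upwards [hpt, hP.eventually hPhi] with z ⟨h1, h2, h3, _⟩ h4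
  rw [(surfaceOp_horizontal (κ := κ) h1 h2 h3 rfl rfl).1, h4, neg_zero, zero_mul]

/-! ### Limits of parametrized graphs -/

/-- The first derivatives of a function on the plane. -/
noncomputable def gradAt (v : Plane → ℝ) (x : Plane) (k : Fin 2) : ℝ := fderiv ℝ v x (planeVec k)

/-- The second derivatives of a function on the plane. -/
noncomputable def hessAt (v : Plane → ℝ) (x : Plane) (k l : Fin 2) : ℝ :=
  fderiv ℝ (fderiv ℝ v) x (planeVec k) (planeVec l)

/-- The equation `div (Dv / W) = c + τ / W` for the graph of `v`, multiplied by `W³`. -/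
def GraphEq (κ : Plane → MetricCoeffs) (c τ : ℝ) (v : Plane → ℝ) (x : Plane) : Prop :=
  graphOp (κ x) (gradAt v x) (hessAt v x) =
    c * √(slopeSq (κ x) (gradAt v x)) ^ 3 + τ * slopeSq (κ x) (gradAt v x)

section Graph

variable {f : Plane → Plane × ℝ} {v : Plane → ℝ} {z : Plane}

lemma fderiv_apply_eq_sum {W : Type*} [NormedAddCommGroup W] [NormedSpace ℝ W]
    (T : Plane →L[ℝ] W) (x : Plane) : T x = ∑ k, x k • T (planeVec k) := by
  conv_lhs => rw [planeVec_sum x]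
  simp [Fin.sum_univ_two]

lemma fderiv_snd_of_graph (hf : ContDiffAt ℝ 2 f z) (hv : ContDiffAt ℝ 2 v (f z).1)
    (hfv : ∀ᶠ z' in 𝓝 z, (f z').2 = v (f z').1) (x : Plane) :
    (fderiv ℝ f z x).2 = ∑ k, gradAt v (f z).1 k * (fderiv ℝ f z x).1 k := by
  have h1 := fderiv_clm_comp_apply (ContinuousLinearMap.snd ℝ Plane ℝ) hf x
  have h2 := fderiv_clm_comp_apply (ContinuousLinearMap.fst ℝ Plane ℝ) hf x
  have hfc : ContDiffAt ℝ 2 (fun z => (f z).1) z := hf.fst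
  have hev : (fun z => (f z).2) =ᶠ[𝓝 z] v ∘ fun z => (f z).1 := hfv
  have h3 : fderiv ℝ (v ∘ fun z => (f z).1) z x = fderiv ℝ v (f z).1 (fderiv ℝ f z x).1 := by
    rw [fderiv_comp z (hv.differentiableAt two_ne_zero) (hfc.differentiableAt two_ne_zero),
      ContinuousLinearMap.comp_apply]
    exact congrArg _ h2
  refine h1.symm.trans ?_
  simp only [ContinuousLinearMap.coe_snd']
  rw [hev.fderiv_eq, h3, fderiv_apply_eq_sum]
  exact Finset.sum_congr rfl fun k _ => by simp [gradAt, mul_comm]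

lemma fderiv_fderiv_snd_of_graph (hf : ContDiffAt ℝ 2 f z) (hv : ContDiffAt ℝ 2 v (f z).1)
    (hfv : ∀ᶠ z' in 𝓝 z, (f z').2 = v (f z').1) (x y : Plane) :
    (fderiv ℝ (fderiv ℝ f) z x y).2 =
      ∑ k, gradAt v (f z).1 k * (fderiv ℝ (fderiv ℝ f) z x y).1 k +
      ∑ k, ∑ l, hessAt v (f z).1 k l * (fderiv ℝ f z x).1 k * (fderiv ℝ f z y).1 l := by
  have h1 := fderiv_fderiv_clm_comp_apply (ContinuousLinearMap.snd ℝ Plane ℝ) hf x y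
  have h2 := fderiv_fderiv_clm_comp_apply (ContinuousLinearMap.fst ℝ Plane ℝ) hf x y
  have h2' := fderiv_clm_comp_apply (ContinuousLinearMap.fst ℝ Plane ℝ) hf
  simp only [ContinuousLinearMap.coe_snd', ContinuousLinearMap.coe_fst'] at h1 h2 h2'
  have hfc : ContDiffAt ℝ 2 (fun z => (f z).1) z := hf.fst
  have hev : (fun z => (f z).2) =ᶠ[𝓝 z] v ∘ fun z => (f z).1 := hfv
  have hev' : fderiv ℝ (fun z => (f z).2) =ᶠ[𝓝 z] fderiv ℝ (v ∘ fun z => (f z).1) := hev.fderiv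
  have h3 := fderiv_fderiv_comp (g := v) (k := fun z => (f z).1) hv hfc x y
  rw [h2, h2', h2'] at h3
  rw [← h1, hev'.fderiv_eq, h3, add_comm]
  congr 1
  · rw [fderiv_apply_eq_sum]
    exact Finset.sum_congr rfl fun k _ => by simp [gradAt, mul_comm]
  · rw [fderiv_apply_eq_sum (fderiv ℝ (fderiv ℝ v) (f z).1)]
    simp only [_root_.sum_apply, _root_.smul_apply]
    refine Finset.sum_congr rfl fun k _ => ?_
    rw [fderiv_apply_eq_sum _ (fderiv ℝ f z y).1, smul_eq_mul, Finset.mul_sum]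
    exact Finset.sum_congr rfl fun l _ => by simp only [hessAt, smul_eq_mul]; ring

/-- The conormal and the mean curvature of a parametrized graph. -/
lemma surface_of_graph {κ : Plane → MetricCoeffs} {i j : Fin 2} (hij : i ≠ j)
    (hκ : ∀ k l, (κ (f z).1).1 k l = (κ (f z).1).1 l k)
    (hf : ContDiffAt ℝ 2 f z) (hv : ContDiffAt ℝ 2 v (f z).1)
    (hfv : ∀ᶠ z' in 𝓝 z, (f z').2 = v (f z').1) :
    surfaceFst j f z = -surfaceVert i j f z * gradAt v (f z).1 i ∧
    surfaceSnd i f z = -surfaceVert i j f z * gradAt v (f z).1 j ∧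
    surfaceConormalSq κ i j f z =
      surfaceVert i j f z ^ 2 * slopeSq (κ (f z).1) (gradAt v (f z).1) ∧
    surfaceOp κ i j f z =
      surfaceVert i j f z ^ 3 * graphOp (κ (f z).1) (gradAt v (f z).1) (hessAt v (f z).1) := by
  have h1 := fderiv_snd_of_graph hf hv hfv
  have h2 := fderiv_fderiv_snd_of_graph hf hv hfv
  refine ⟨crossFst_graph hij (h1 _) (h1 _), crossSnd_graph hij (h1 _) (h1 _),
    conormalSq_graph hij hκ (h1 _) (h1 _), ?_⟩
  exact paramOp_graph hij hκ (fun k l => hv.hessian_symm _ _) (h1 _) (h1 _) (h2 _ _) (h2 _ _)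
    (h2 _ _)

/-- The equation of a parametrized graph. -/
lemma surfaceOp_of_graphEq {κ : Plane → MetricCoeffs} {i j : Fin 2} (hij : i ≠ j)
    (hκ : ∀ k l, (κ (f z).1).1 k l = (κ (f z).1).1 l k)
    (hf : ContDiffAt ℝ 2 f z) (hv : ContDiffAt ℝ 2 v (f z).1)
    (hfv : ∀ᶠ z' in 𝓝 z, (f z').2 = v (f z').1) {c τ σ : ℝ} (hσ : |σ| = 1)
    (hsign : 0 < σ * surfaceVert i j f z) (heq : GraphEq κ c τ v (f z).1) :
    surfaceOp κ i j f z = σ * c * √(surfaceConormalSq κ i j f z) ^ 3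
      + τ * (surfaceVert i j f z * surfaceConormalSq κ i j f z) := by
  obtain ⟨-, -, h1, h2⟩ := surface_of_graph hij hκ hf hv hfv
  -- The cube of the conormal length carries `σ³`, compensated by the factor `σ` before `c`; the
  -- `τ`-term is odd in `surfaceVert` and needs no sign.
  have habs : |surfaceVert i j f z| = σ * surfaceVert i j f z := by
    rw [← abs_of_pos hsign, abs_mul, hσ, one_mul]
  have hss : σ ^ 2 = 1 := by rw [← sq_abs, hσ, one_pow]
  rw [h2, h1, heq, Real.sqrt_mul (sq_nonneg _), Real.sqrt_sq_eq_abs, habs]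
  linear_combination (-c * surfaceVert i j f z ^ 3 *
    √(slopeSq (κ (f z).1) (gradAt v (f z).1)) ^ 3 * (σ ^ 2 + 1)) * hss

end Graph

section Continuity

variable {i j : Fin 2}

@[fun_prop]
lemma continuous_coord {X : Type*} [TopologicalSpace X] {g : X → Plane} (hg : Continuous g)
    (k : Fin 2) : Continuous fun x => (g x) k :=
  (EuclideanSpace.proj k : Plane →L[ℝ] ℝ).continuous.comp hg

lemma continuous_crossVert (i j : Fin 2) :
    Continuous fun x : (Plane × ℝ) × (Plane × ℝ) => crossVert i j x.1 x.2 := by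
  unfold crossVert; fun_prop

lemma continuous_crossFst (j : Fin 2) :
    Continuous fun x : (Plane × ℝ) × (Plane × ℝ) => crossFst j x.1 x.2 := by
  unfold crossFst; fun_prop

lemma continuous_conormalSq (i j : Fin 2) :
    Continuous fun x : MetricCoeffs × (Plane × ℝ) × (Plane × ℝ) =>
      conormalSq x.1 i j x.2.1 x.2.2 := by
  unfold conormalSq crossVert crossFst crossSnd; fun_prop

lemma continuous_paramOp (i j : Fin 2) :
    Continuous fun x : MetricCoeffs × (Plane × ℝ) × (Plane × ℝ) × (Plane × ℝ) × (Plane × ℝ) ×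
      (Plane × ℝ) => paramOp x.1 i j x.2.1 x.2.2.1 x.2.2.2.1 x.2.2.2.2.1 x.2.2.2.2.2 := by
  unfold paramOp formAt secondForm lowerPart conormalSq crossVert crossFst crossSnd; fun_prop

end Continuity

/-- A nowhere vanishing continuous function on a preconnected set has a sign. -/
lemma IsPreconnected.forall_pos_or_forall_neg {X : Type*} [TopologicalSpace X] {s : Set X}
    (hs : IsPreconnected s) {g : X → ℝ} (hg : ContinuousOn g s) (h0 : ∀ x ∈ s, g x ≠ 0) :
    (∀ x ∈ s, 0 < g x) ∨ ∀ x ∈ s, g x < 0 := by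
  by_contra! h
  obtain ⟨⟨x, hx, hgx⟩, y, hy, hgy⟩ := h
  obtain ⟨t, ht, hgt⟩ := hs.intermediate_value hx hy hg ⟨hgx, hgy⟩
  exact h0 t ht hgt

/-- A sequence of nowhere vanishing functions on a preconnected set has a sign along an
ultrafilter. -/
lemma exists_sign_of_ne_zero {X : Type*} [TopologicalSpace X] {s : Set X} (hs : IsPreconnected s)
    (𝒰 : Ultrafilter ℕ) {g : ℕ → X → ℝ}
    (hg : ∀ᶠ n in 𝒰, ContinuousOn (g n) s ∧ ∀ x ∈ s, g n x ≠ 0) :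
    ∃ σ : ℝ, |σ| = 1 ∧ ∀ᶠ n in 𝒰, ∀ x ∈ s, 0 < σ * g n x := by
  have h : ∀ᶠ n in 𝒰, (∀ x ∈ s, 0 < g n x) ∨ ∀ x ∈ s, g n x < 0 := by
    filter_upwards [hg] with n hn using hs.forall_pos_or_forall_neg hn.1 hn.2
  -- An ultrafilter decides between the two signs, which replaces passing to a subsequence.
  rcases Ultrafilter.eventually_or.1 h with h | h
  · refine ⟨1, by simp, ?_⟩
    filter_upwards [h] with n hn x hx
    simpa using hn x hx
  · refine ⟨-1, by simp, ?_⟩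
    filter_upwards [h] with n hn x hx
    simpa using hn x hx

/-- Convergence of the 2-jets of a family of parametrized surfaces at a point. -/
structure TendstoJet (l : Filter ℕ) (F : ℕ → Plane → Plane × ℝ) (f : Plane → Plane × ℝ)
    (z : Plane) : Prop where
  point : Tendsto (fun n => F n z) l (𝓝 (f z))
  tangent : ∀ a, Tendsto (fun n => tangentAt (F n) z a) l (𝓝 (tangentAt f z a))
  second : ∀ a b, Tendsto (fun n => secondAt (F n) z a b) l (𝓝 (secondAt f z a b))

section Limits

variable {l : Filter ℕ} {F : ℕ → Plane → Plane × ℝ} {f : Plane → Plane × ℝ} {z : Plane}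
  {κ : Plane → MetricCoeffs}

lemma TendstoJet.surfaceVert (h : TendstoJet l F f z) (i j : Fin 2) :
    Tendsto (fun n => surfaceVert i j (F n) z) l (𝓝 (surfaceVert i j f z)) :=
  ((continuous_crossVert i j).tendsto (tangentAt f z 0, tangentAt f z 1)).comp
    ((h.tangent 0).prodMk_nhds (h.tangent 1))

lemma TendstoJet.coeffs (h : TendstoJet l F f z) (hκ : ContinuousAt κ (f z).1) :
    Tendsto (fun n => κ (F n z).1) l (𝓝 (κ (f z).1)) :=
  hκ.tendsto.comp ((continuous_fst.tendsto (f z)).comp h.point)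

lemma TendstoJet.surfaceConormalSq (h : TendstoJet l F f z) (hκ : ContinuousAt κ (f z).1)
    (i j : Fin 2) :
    Tendsto (fun n => surfaceConormalSq κ i j (F n) z) l (𝓝 (surfaceConormalSq κ i j f z)) := by
  have h1 := (h.coeffs hκ).prodMk_nhds ((h.tangent 0).prodMk_nhds (h.tangent 1))
  have h2 := ((continuous_conormalSq i j).tendsto _).comp h1
  unfold _root_.surfaceConormalSq
  exact h2

lemma TendstoJet.surfaceOp (h : TendstoJet l F f z) (hκ : ContinuousAt κ (f z).1) (i j : Fin 2) :
    Tendsto (fun n => surfaceOp κ i j (F n) z) l (𝓝 (surfaceOp κ i j f z)) := by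
  have h1 := (h.coeffs hκ).prodMk_nhds ((h.tangent 0).prodMk_nhds ((h.tangent 1).prodMk_nhds
      ((h.second 0 0).prodMk_nhds ((h.second 0 1).prodMk_nhds (h.second 1 1)))))
  exact ((continuous_paramOp i j).tendsto _).comp h1

/-- The limit of parametrized graphs of constant mean curvature, or of translating graphs,
satisfies the same equation. -/
theorem exists_surfaceOp_eq_of_tendsto [l.NeBot] {B : Set Plane} {i j : Fin 2}
    {v : ℕ → Plane → ℝ} {c : ℕ → ℝ} {τ σ : ℝ} (hij : i ≠ j) (hσ : |σ| = 1)
    (hconv : ∀ z ∈ B, TendstoJet l F f z) (hκ : ∀ z ∈ B, ContinuousAt κ (f z).1)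
    (hpos : ∀ z ∈ B, 0 < surfaceConormalSq κ i j f z)
    (hF : ∀ᶠ n in l, ∀ z ∈ B, (∀ k l, (κ (F n z).1).1 k l = (κ (F n z).1).1 l k) ∧
      ContDiffAt ℝ 2 (F n) z ∧ ContDiffAt ℝ 2 (v n) (F n z).1 ∧
      (∀ᶠ z' in 𝓝 z, (F n z').2 = v n (F n z').1) ∧ 0 < σ * surfaceVert i j (F n) z ∧
      GraphEq κ (c n) τ (v n) (F n z).1) :
    ∃ c₀ : ℝ, ∀ z ∈ B, surfaceOp κ i j f z = c₀ * √(surfaceConormalSq κ i j f z) ^ 3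
      + τ * (surfaceVert i j f z * surfaceConormalSq κ i j f z) := by
  rcases B.eq_empty_or_nonempty with rfl | ⟨z₀, hz₀⟩
  · simp
  -- No bound on `c n` is assumed: solving the equation for `σ * c n` expresses it through
  -- convergent quantities with nonvanishing denominator. The sequence does not depend on `z`, hence
  -- neither does its limit.
  have key : ∀ z ∈ B, Tendsto (fun n => σ * c n) l
      (𝓝 ((surfaceOp κ i j f z - τ * (surfaceVert i j f z * surfaceConormalSq κ i j f z)) /
        √(surfaceConormalSq κ i j f z) ^ 3)) := by
    intro z hz
    have h := hconv z hz
    have hc := h.surfaceConormalSq (hκ z hz) i j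
    have hlim := ((h.surfaceOp (hκ z hz) i j).sub
      (((h.surfaceVert i j).mul hc).const_mul τ)).div
      ((hc.sqrt).pow 3) (pow_ne_zero 3 (Real.sqrt_pos.2 (hpos z hz)).ne')
    refine hlim.congr' ?_
    filter_upwards [hF, hc.eventually_const_lt (hpos z hz)] with n hn hn'
    obtain ⟨h1, h2, h3, h4, h5, h6⟩ := hn z hz
    rw [Pi.div_apply, surfaceOp_of_graphEq hij h1 h2 h3 h4 hσ h5 h6, add_sub_cancel_right, mul_div_assoc,
      div_self (pow_ne_zero 3 (Real.sqrt_pos.2 hn').ne'), mul_one]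
  refine ⟨(surfaceOp κ i j f z₀ - τ * (surfaceVert i j f z₀ * surfaceConormalSq κ i j f z₀)) /
    √(surfaceConormalSq κ i j f z₀) ^ 3, fun z hz => ?_⟩
  have h1 := tendsto_nhds_unique (key z hz) (key z₀ hz₀)
  have h2 : √(surfaceConormalSq κ i j f z) ^ 3 ≠ 0 :=
    pow_ne_zero 3 (Real.sqrt_pos.2 (hpos z hz)).ne'
  rw [← h1, div_mul_cancel₀ _ h2]
  ring

end Limits

/-! ### The mean curvature operator in a chart -/

/-- Product rule, where the derivative of `1 / W` contributes `-∂_i W / W²` and, by symmetry of `a`,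
`W ∂_i W = ½ (∂_i a) (p, p) + a (∂_i p, p)`. After multiplication by `W³` only powers of `W²`
remain. -/
lemma divergence_expansion {s : Plane → ℝ} {a : Plane → Fin 2 → Fin 2 → ℝ}
    {p : Plane → Fin 2 → ℝ} {y : Plane} (hs : DifferentiableAt ℝ s y)
    (ha : ∀ k l, DifferentiableAt ℝ (fun z => a z k l) y)
    (hp : ∀ k, DifferentiableAt ℝ (fun z => p z k) y) (hs0 : s y ≠ 0)
    (hsymm : ∀ z k l, a z k l = a z l k)
    (hpos : 0 < 1 + ∑ k, (∑ l, a y k l * p y l) * p y k) :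
    (s y)⁻¹ * ∑ i, fderiv ℝ (fun z => s z * ((∑ l, a z i l * p z l) /
        √(1 + ∑ k, (∑ l, a z k l * p z l) * p z k))) y (planeVec i) =
      graphOp (a y, fun j => (s y)⁻¹ * ∑ i, fderiv ℝ (fun z => s z * a z i j) y (planeVec i),
          fun i k l => fderiv ℝ (fun z => a z k l) y (planeVec i)) (p y)
        (fun k l => fderiv ℝ (fun z => p z l) y (planeVec k)) /
        √(1 + ∑ k, (∑ l, a y k l * p y l) * p y k) ^ 3 := by
  have hg : ∀ k, HasFDerivAt (fun z => ∑ l, a z k l * p z l) _ y := fun k =>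
    HasFDerivAt.fun_sum fun l _ => (ha k l).hasFDerivAt.mul (hp l).hasFDerivAt
  have hQ : HasFDerivAt (fun z => 1 + ∑ k, (∑ l, a z k l * p z l) * p z k) _ y :=
    (HasFDerivAt.fun_sum fun k _ => (hg k).mul (hp k).hasFDerivAt).const_add 1
  have hW := hQ.sqrt hpos.ne'
  have hWpos : 0 < √(1 + ∑ k, (∑ l, a y k l * p y l) * p y k) := Real.sqrt_pos.2 hpos
  have hW2 := Real.sq_sqrt hpos.le
  have hWinv : HasFDerivAt (fun z => (√(1 + ∑ k, (∑ l, a z k l * p z l) * p z k))⁻¹) _ y :=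
    (hasDerivAt_inv hWpos.ne').comp_hasFDerivAt y hW
  have hX : ∀ i, HasFDerivAt (fun z => s z * ((∑ l, a z i l * p z l) /
        √(1 + ∑ k, (∑ l, a z k l * p z l) * p z k))) _ y := fun i =>
    hs.hasFDerivAt.mul ((hg i).mul hWinv)
  have hsa : ∀ i j, fderiv ℝ (fun z => s z * a z i j) y = _ := fun i j =>
    (hs.hasFDerivAt.mul (ha i j).hasFDerivAt).fderiv
  have ha10 : ∀ i, fderiv ℝ (fun z => a z 1 0) y (planeVec i)
      = fderiv ℝ (fun z => a z 0 1) y (planeVec i) := fun i => by simp only [hsymm _ 1 0]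
  simp only [(hX _).fderiv, hsa, graphOp, slopeSq]
  set W := √(1 + ∑ k, (∑ l, a y k l * p y l) * p y k) with hWdef
  rw [← hW2]
  rw [eq_div_iff (by positivity)]
  simp only [Fin.sum_univ_two, _root_.add_apply, _root_.smul_apply, smul_eq_mul,
    ha10, hsymm y 1 0]
  field_simp
  ring

/-! ### The metric in a chart -/

section Chart

variable {N : Type*} [TopologicalSpace N] [ChartedSpace (EuclideanSpace ℝ (Fin 2)) N]

section Frame

variable [IsManifold (𝓡 2) 1 N]

/-- The tangent vector at `x` with given coordinates in the chart at `x₀`. -/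
noncomputable def chartLift (x₀ x : N) : Plane →L[ℝ] TangentSpace (𝓡 2) x :=
  (trivializationAt Plane (TangentSpace (𝓡 2)) x₀).symmL ℝ x

/-- The coordinates of a tangent vector in the chart at `x₀`. -/
noncomputable def chartCoord (x₀ x : N) : TangentSpace (𝓡 2) x →L[ℝ] Plane :=
  (trivializationAt Plane (TangentSpace (𝓡 2)) x₀).continuousLinearMapAt ℝ x

lemma chartLift_chartCoord {x₀ x : N} (hx : x ∈ (chartAt Plane x₀).source) (v : TangentSpace (𝓡 2) x) :
    chartLift x₀ x (chartCoord x₀ x v) = v :=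
  (trivializationAt Plane (TangentSpace (𝓡 2)) x₀).symmL_continuousLinearMapAt (by simpa using hx) v

lemma chartCoord_chartLift {x₀ x : N} (hx : x ∈ (chartAt Plane x₀).source) (v : Plane) :
    chartCoord x₀ x (chartLift x₀ x v) = v :=
  (trivializationAt Plane (TangentSpace (𝓡 2)) x₀).continuousLinearMapAt_symmL (by simpa using hx) v

lemma chartCoord_eq_mfderiv {x₀ x : N} (hx : x ∈ (chartAt Plane x₀).source) :
    chartCoord x₀ x = mfderiv (𝓡 2) 𝓘(ℝ, Plane) (chartAt Plane x₀) x := by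
  have h := TangentBundle.continuousLinearMapAt_trivializationAt (I := 𝓡 2) hx
  unfold chartCoord
  rw [h]
  simp only [mfld_simps]
  rfl

lemma mfderiv_chartAt_symm {x₀ : N} {y : Plane} (hy : y ∈ (chartAt Plane x₀).target) (v : Plane) :
    mfderiv (𝓡 2) (𝓡 2) (chartAt Plane x₀).symm y v =
      chartLift x₀ ((chartAt Plane x₀).symm y) v := by
  have hx : (chartAt Plane x₀).symm y ∈ (chartAt Plane x₀).source :=
    (chartAt Plane x₀).map_target hy
  have h := congrArg (fun T : Plane →L[ℝ] Plane => T v)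
    ((mdifferentiable_chart (I := 𝓡 2) x₀).comp_symm_deriv hy)
  rw [← chartLift_chartCoord hx (mfderiv (𝓡 2) (𝓡 2) (chartAt Plane x₀).symm y v),
    chartCoord_eq_mfderiv hx]
  exact congrArg _ h

/-- Coordinate vector fields are the frame of the bundle trivialization; smoothness of that frame
gives smoothness of the metric coefficients. -/
lemma coordVec_eq_chartLift {x₀ : N} {y : Plane} (hy : y ∈ (chartAt Plane x₀).target) (i : Fin 2) :
    coordVec (chartAt Plane x₀) y i = chartLift x₀ ((chartAt Plane x₀).symm y) (planeVec i) :=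
  mfderiv_chartAt_symm hy _

end Frame

lemma contMDiffOn_chartLift [IsManifold (𝓡 2) ∞ N] (x₀ : N) (v : Plane) :
    ContMDiffOn (𝓡 2) ((𝓡 2).prod 𝓘(ℝ, Plane)) ∞
      (fun x => (⟨x, chartLift x₀ x v⟩ : TangentBundle (𝓡 2) N)) (chartAt Plane x₀).source := by
  have h := (trivializationAt Plane (TangentSpace (𝓡 2)) x₀).contMDiffOn_section_baseSet_iff (IB := 𝓡 2) (n := ∞)
    (s := fun x => chartLift x₀ x v)
  rw [TangentBundle.trivializationAt_baseSet] at h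
  rw [h]
  refine (contMDiffOn_const (c := v)).congr fun x hx => ?_
  have := chartCoord_chartLift hx v
  exact ((trivializationAt Plane (TangentSpace (𝓡 2)) x₀).continuousLinearMapAt_apply_of_mem
    (R := ℝ) (by simpa using hx) _).symm.trans this

variable [RiemannianBundle (fun x : N => TangentSpace (𝓡 2) x)]

/-- The coefficients of the mean curvature operator in the chart `φ`. -/
noncomputable def chartCoeffs (φ : OpenPartialHomeomorph N Plane) (y : Plane) : MetricCoeffs :=
  (fun k l => (metricMatrix φ y)⁻¹ k l,
    fun l => (√(metricMatrix φ y).det)⁻¹ * ∑ k, fderiv ℝ (fun z => √(metricMatrix φ z).det *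
      (metricMatrix φ z)⁻¹ k l) y (planeVec k),
    fun i k l => fderiv ℝ (fun z => (metricMatrix φ z)⁻¹ k l) y (planeVec i))

lemma metricMatrix_comm (φ : OpenPartialHomeomorph N Plane) (y : Plane) (i j : Fin 2) :
    metricMatrix φ y i j = metricMatrix φ y j i := by
  simp only [metricMatrix, Matrix.of_apply]
  exact real_inner_comm _ _

lemma inv_metricMatrix_comm (φ : OpenPartialHomeomorph N Plane) (y : Plane) (i j : Fin 2) :
    (metricMatrix φ y)⁻¹ i j = (metricMatrix φ y)⁻¹ j i := by
  have h : (metricMatrix φ y)ᵀ = metricMatrix φ y := by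
    ext i j; exact metricMatrix_comm φ y j i
  conv_rhs => rw [← h, ← Matrix.transpose_nonsing_inv]
  rfl

lemma inv_metricMatrix_eq (φ : OpenPartialHomeomorph N Plane) (y : Plane) :
    (metricMatrix φ y)⁻¹ = (metricMatrix φ y).det⁻¹ •
      !![metricMatrix φ y 1 1, -metricMatrix φ y 0 1; -metricMatrix φ y 1 0, metricMatrix φ y 0 0] := by
  rw [Matrix.inv_def, Ring.inverse_eq_inv', Matrix.adjugate_fin_two]

variable [IsManifold (𝓡 2) ∞ N]

/-- The metric in the chart at `x₀`. -/
noncomputable def frameMetric (x₀ x : N) (i j : Fin 2) : ℝ :=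
  inner ℝ (chartLift x₀ x (planeVec i)) (chartLift x₀ x (planeVec j))

lemma metricMatrix_eq_frameMetric {x₀ : N} {y : Plane} (hy : y ∈ (chartAt Plane x₀).target) (i j : Fin 2) :
    metricMatrix (chartAt Plane x₀) y i j = frameMetric x₀ ((chartAt Plane x₀).symm y) i j := by
  simp only [metricMatrix, Matrix.of_apply, coordVec_eq_chartLift hy, frameMetric]

lemma frameMetric_comm (x₀ x : N) (i j : Fin 2) : frameMetric x₀ x i j = frameMetric x₀ x j i :=
  real_inner_comm _ _

lemma inner_chartLift (x₀ x : N) (v w : Plane) :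
    inner ℝ (chartLift x₀ x v) (chartLift x₀ x w) = ∑ i, ∑ j, v i * w j * frameMetric x₀ x i j := by
  conv_lhs => rw [planeVec_sum v, planeVec_sum w]
  simp only [map_add, map_smul, inner_add_left, inner_add_right, real_inner_smul_left,
    real_inner_smul_right, Fin.sum_univ_two, frameMetric]
  ring

lemma inner_chartLift_self_pos {x₀ x : N} (hx : x ∈ (chartAt Plane x₀).source) {v : Plane}
    (hv : v ≠ 0) : 0 < inner ℝ (chartLift x₀ x v) (chartLift x₀ x v) := by
  refine real_inner_self_pos.2 fun h => hv ?_
  rw [← chartCoord_chartLift hx v, h, map_zero]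

lemma frameMetric_self_pos {x₀ x : N} (hx : x ∈ (chartAt Plane x₀).source) (i : Fin 2) :
    0 < frameMetric x₀ x i i :=
  inner_chartLift_self_pos hx (by
    intro h
    have := congrArg (fun v : Plane => v i) h
    simp at this)

/-- The vector with coordinates `(-g₀₁, g₀₀)` has squared length `g₀₀` times the determinant. -/
lemma frameMetric_det_pos {x₀ x : N} (hx : x ∈ (chartAt Plane x₀).source) :
    0 < frameMetric x₀ x 0 0 * frameMetric x₀ x 1 1 - frameMetric x₀ x 0 1 ^ 2 := by
  have h0 := frameMetric_self_pos hx 0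
  have h := inner_chartLift_self_pos hx
    (v := planePoint 0 1 (-frameMetric x₀ x 0 1) (frameMetric x₀ x 0 0)) (by
      intro h
      have := congrArg (fun v : Plane => v 1) h
      simp [planePoint] at this
      exact h0.ne' this)
  rw [inner_chartLift] at h
  simp [planePoint, Fin.sum_univ_two, frameMetric_comm x₀ x 1 0] at h
  refine (mul_pos_iff_of_pos_left h0).1 ?_
  linarith

lemma metricMatrix_det_pos {x₀ : N} {y : Plane} (hy : y ∈ (chartAt Plane x₀).target) :
    0 < (metricMatrix (chartAt Plane x₀) y).det := by
  have h := frameMetric_det_pos ((chartAt Plane x₀).map_target hy)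
  rw [Matrix.det_fin_two]
  simp only [metricMatrix_eq_frameMetric hy]
  rw [frameMetric_comm _ _ 1 0]
  linarith

/-- The inverse is the adjugate over the determinant: its diagonal consists of the metric's diagonal
entries, exchanged and divided by `det`, and its determinant is `1 / det`. -/
lemma inv_metricMatrix_pos {x₀ : N} {y : Plane} (hy : y ∈ (chartAt Plane x₀).target) {i j : Fin 2}
    (hij : i ≠ j) : 0 < (metricMatrix (chartAt Plane x₀) y)⁻¹ j j ∧
      0 < (metricMatrix (chartAt Plane x₀) y)⁻¹ i i * (metricMatrix (chartAt Plane x₀) y)⁻¹ j j -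
        (metricMatrix (chartAt Plane x₀) y)⁻¹ i j ^ 2 := by
  have hd := metricMatrix_det_pos hy
  have hp : ∀ k, 0 < metricMatrix (chartAt Plane x₀) y k k := fun k => by
    rw [metricMatrix_eq_frameMetric hy]
    exact frameMetric_self_pos ((chartAt Plane x₀).map_target hy) k
  have hc := metricMatrix_comm (chartAt Plane x₀) y 1 0
  rw [inv_metricMatrix_eq]
  have hd' := hd
  rw [Matrix.det_fin_two, hc] at hd'
  have key := mul_pos (pow_pos (inv_pos.2 hd) 2) hd'
  have h0 := mul_pos (inv_pos.2 hd) (hp 0)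
  have h1 := mul_pos (inv_pos.2 hd) (hp 1)
  rcases Fin.two_cases_of_ne hij with ⟨rfl, rfl⟩ | ⟨rfl, rfl⟩ <;> simp [hc] <;>
    exact ⟨by assumption, by linarith⟩

variable [IsContMDiffRiemannianBundle (𝓡 2) ∞ (EuclideanSpace ℝ (Fin 2))
      (fun x : N => TangentSpace (𝓡 2) x)]

lemma contMDiffOn_frameMetric (x₀ : N) (i j : Fin 2) :
    ContMDiffOn (𝓡 2) 𝓘(ℝ, ℝ) ∞ (fun x => frameMetric x₀ x i j) (chartAt Plane x₀).source :=
  (contMDiffOn_chartLift x₀ (planeVec i)).inner_bundle (contMDiffOn_chartLift x₀ (planeVec j))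

lemma contDiffAt_metricMatrix {x₀ : N} {y : Plane} (hy : y ∈ (chartAt Plane x₀).target)
    (i j : Fin 2) : ContDiffAt ℝ ∞ (fun z => metricMatrix (chartAt Plane x₀) z i j) y := by
  have h1 : ContMDiffOn (𝓡 2) 𝓘(ℝ, ℝ) ∞
      (fun z => frameMetric x₀ ((chartAt Plane x₀).symm z) i j) (chartAt Plane x₀).target :=
    (contMDiffOn_frameMetric x₀ i j).comp (contMDiffOn_chart_symm (x := x₀))
      fun z hz => (chartAt Plane x₀).map_target hz
  have h2 := (contMDiffOn_iff_contDiffOn.1 h1).contDiffAt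
    ((chartAt Plane x₀).open_target.mem_nhds hy)
  refine h2.congr_of_eventuallyEq ?_
  filter_upwards [(chartAt Plane x₀).open_target.mem_nhds hy] with z hz
  exact metricMatrix_eq_frameMetric hz i j

lemma contDiffAt_det_metricMatrix {x₀ : N} {y : Plane} (hy : y ∈ (chartAt Plane x₀).target) :
    ContDiffAt ℝ ∞ (fun z => (metricMatrix (chartAt Plane x₀) z).det) y := by
  have h := contDiffAt_metricMatrix hy
  simp only [Matrix.det_fin_two]
  exact ((h 0 0).mul (h 1 1)).sub ((h 0 1).mul (h 1 0))

lemma contDiffAt_inv_metricMatrix {x₀ : N} {y : Plane} (hy : y ∈ (chartAt Plane x₀).target)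
    (i j : Fin 2) : ContDiffAt ℝ ∞ (fun z => (metricMatrix (chartAt Plane x₀) z)⁻¹ i j) y := by
  have h := contDiffAt_metricMatrix hy
  have hd := (contDiffAt_det_metricMatrix hy).inv (metricMatrix_det_pos hy).ne'
  have key : ∀ {g : Plane → ℝ}, ContDiffAt ℝ ∞ g y →
      (∀ z, (metricMatrix (chartAt Plane x₀) z)⁻¹ i j = g z) →
      ContDiffAt ℝ ∞ (fun z => (metricMatrix (chartAt Plane x₀) z)⁻¹ i j) y := fun hg he =>
    hg.congr_of_eventuallyEq (Eventually.of_forall he)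
  match i, j with
  | 0, 0 => exact key (hd.mul (h 1 1)) fun z => by rw [inv_metricMatrix_eq]; simp
  | 0, 1 => exact key (hd.mul (h 0 1).neg) fun z => by rw [inv_metricMatrix_eq]; simp
  | 1, 0 => exact key (hd.mul (h 1 0).neg) fun z => by rw [inv_metricMatrix_eq]; simp
  | 1, 1 => exact key (hd.mul (h 0 0)) fun z => by rw [inv_metricMatrix_eq]; simp

lemma contDiffAt_sqrt_det {x₀ : N} {y : Plane} (hy : y ∈ (chartAt Plane x₀).target) :
    ContDiffAt ℝ ∞ (fun z => √(metricMatrix (chartAt Plane x₀) z).det) y :=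
  (contDiffAt_det_metricMatrix hy).sqrt (metricMatrix_det_pos hy).ne'

/-- `C¹` is what the maximum principle requires, to obtain Lipschitz coefficients. -/
lemma contDiffAt_chartCoeffs {x₀ : N} {y : Plane} (hy : y ∈ (chartAt Plane x₀).target) :
    ContDiffAt ℝ 1 (chartCoeffs (chartAt Plane x₀)) y := by
  have ha := contDiffAt_inv_metricMatrix hy
  have hs := contDiffAt_sqrt_det hy
  have hd : ∀ {g : Plane → ℝ} (v : Plane), ContDiffAt ℝ ∞ g y →
      ContDiffAt ℝ 1 (fun z => fderiv ℝ g z v) y := fun v hg =>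
    (hg.fderiv_right (m := 1) (by norm_cast)).clm_apply contDiffAt_const
  refine ContDiffAt.prodMk ?_ (ContDiffAt.prodMk ?_ ?_)
  · exact contDiffAt_pi.2 fun k => contDiffAt_pi.2 fun l => (ha k l).of_le (by norm_cast)
  · refine contDiffAt_pi.2 fun l => ContDiffAt.mul ?_ (ContDiffAt.sum fun k _ => ?_)
    · exact ((hs.inv (Real.sqrt_pos.2 (metricMatrix_det_pos hy)).ne')).of_le (by norm_cast)
    · exact hd _ (hs.mul (ha k l))
  · exact contDiffAt_pi.2 fun i => contDiffAt_pi.2 fun k => contDiffAt_pi.2 fun l =>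
      hd _ (ha k l)

lemma slopeSq_pos {κ : MetricCoeffs} (hsymm : κ.1 1 0 = κ.1 0 1) (h0 : 0 < κ.1 1 1)
    (hdet : 0 < κ.1 0 0 * κ.1 1 1 - κ.1 0 1 ^ 2) (p : Fin 2 → ℝ) : 0 < slopeSq κ p := by
  simp only [slopeSq, Fin.sum_univ_two, hsymm]
  have h : 0 ≤ κ.1 1 1 * (κ.1 0 0 * p 0 ^ 2 + 2 * κ.1 0 1 * p 0 * p 1 + κ.1 1 1 * p 1 ^ 2) := by
    nlinarith [sq_nonneg (κ.1 0 1 * p 0 + κ.1 1 1 * p 1), mul_nonneg hdet.le (sq_nonneg (p 0))]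
  nlinarith [nonneg_of_mul_nonneg_right h h0]

lemma divCoord_eq {x₀ : N} {y : Plane} (hy : y ∈ (chartAt Plane x₀).target) {u : N → ℝ}
    (hu : ContDiffAt ℝ 2 (u ∘ (chartAt Plane x₀).symm) y) :
    0 < slopeSq (chartCoeffs (chartAt Plane x₀) y) (gradAt (u ∘ (chartAt Plane x₀).symm) y) ∧
    slopeFactor (chartAt Plane x₀) u y =
      √(slopeSq (chartCoeffs (chartAt Plane x₀) y) (gradAt (u ∘ (chartAt Plane x₀).symm) y)) ∧
    divCoord (chartAt Plane x₀) (fun z i => gradCoord (chartAt Plane x₀) u z i /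
        slopeFactor (chartAt Plane x₀) u z) y =
      graphOp (chartCoeffs (chartAt Plane x₀) y) (gradAt (u ∘ (chartAt Plane x₀).symm) y)
        (hessAt (u ∘ (chartAt Plane x₀).symm) y) /
      √(slopeSq (chartCoeffs (chartAt Plane x₀) y) (gradAt (u ∘ (chartAt Plane x₀).symm) y)) ^ 3 := by
  have hpos : 0 < slopeSq (chartCoeffs (chartAt Plane x₀) y)
      (gradAt (u ∘ (chartAt Plane x₀).symm) y) :=
    slopeSq_pos (inv_metricMatrix_comm _ _ _ _) (inv_metricMatrix_pos hy zero_ne_one).1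
      (inv_metricMatrix_pos hy zero_ne_one).2 _
  refine ⟨hpos, rfl, ?_⟩
  have h := divergence_expansion (s := fun z => √(metricMatrix (chartAt Plane x₀) z).det)
    (a := fun z k l => (metricMatrix (chartAt Plane x₀) z)⁻¹ k l)
    (p := gradAt (u ∘ (chartAt Plane x₀).symm)) (y := y)
    ((contDiffAt_sqrt_det hy).differentiableAt (by simp))
    (fun k l => (contDiffAt_inv_metricMatrix hy k l).differentiableAt (by simp))
    (fun k => hu.differentiableAt_fderiv.clm_apply (differentiableAt_const _))
    (Real.sqrt_pos.2 (metricMatrix_det_pos hy)).ne' (fun z => inv_metricMatrix_comm _ z) hpos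
  refine Eq.trans h ?_
  congr 2
  funext k l
  have := fderiv_clm_apply (c := fderiv ℝ (u ∘ (chartAt Plane x₀).symm)) (u := fun _ => planeVec l)
    hu.differentiableAt_fderiv (differentiableAt_const _)
  unfold gradAt hessAt
  rw [this]
  simp

/-- The constant changes sign because the mean curvature is minus the divergence. -/
lemma graphEq_of_constMeanCurvature {x₀ : N} {y : Plane} (hy : y ∈ (chartAt Plane x₀).target)
    {u : N → ℝ} (hu : ContDiffAt ℝ 2 (u ∘ (chartAt Plane x₀).symm) y) {c : ℝ}
    (h : graphMeanCurvature (chartAt Plane x₀) u y = c) :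
    GraphEq (chartCoeffs (chartAt Plane x₀)) (-c) 0 (u ∘ (chartAt Plane x₀).symm) y := by
  obtain ⟨h1, h2, h3⟩ := divCoord_eq hy hu
  rw [graphMeanCurvature, h3] at h
  unfold GraphEq
  rw [← h, neg_neg, div_mul_cancel₀ _ (pow_ne_zero 3 (Real.sqrt_pos.2 h1).ne')]
  ring

lemma graphEq_of_translating {x₀ : N} {y : Plane} (hy : y ∈ (chartAt Plane x₀).target)
    {u : N → ℝ} (hu : ContDiffAt ℝ 2 (u ∘ (chartAt Plane x₀).symm) y)
    (h : divCoord (chartAt Plane x₀) (fun z i => gradCoord (chartAt Plane x₀) u z i /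
        slopeFactor (chartAt Plane x₀) u z) y = 1 / slopeFactor (chartAt Plane x₀) u y) :
    GraphEq (chartCoeffs (chartAt Plane x₀)) 0 1 (u ∘ (chartAt Plane x₀).symm) y := by
  obtain ⟨h1, h2, h3⟩ := divCoord_eq hy hu
  rw [h3, h2] at h
  unfold GraphEq
  have hW := Real.sqrt_pos.2 h1
  have hsq := Real.sq_sqrt h1.le
  rw [div_eq_div_iff (pow_ne_zero 3 hW.ne') hW.ne', one_mul] at h
  rw [zero_mul, zero_add, one_mul, ← hsq]
  refine mul_right_cancel₀ hW.ne' ?_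
  rw [h]
  ring

end Chart

/-! ### Surfaces in charts -/

/-- The tangent vectors `t₁`, `t₂` are linearly independent. -/
def IsRegularPair (t : (Plane × ℝ) × (Plane × ℝ)) : Prop :=
  crossFst 0 t.1 t.2 ≠ 0 ∨ crossFst 1 t.1 t.2 ≠ 0 ∨ crossVert 0 1 t.1 t.2 ≠ 0

lemma isOpen_isRegularPair : IsOpen {t | IsRegularPair t} :=
  ((continuous_crossFst 0).isOpen_preimage _ isOpen_ne).union
    (((continuous_crossFst 1).isOpen_preimage _ isOpen_ne).union
      ((continuous_crossVert 0 1).isOpen_preimage _ isOpen_ne))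

/-- If the cross product vanished, then for each component `k` the combination `(t₁)_k t₂ - (t₂)_k
t₁` would be zero, so `(t₁)_k = 0` by injectivity, and finally `t₁ = 0`. -/
lemma isRegularPair_of_injective {T : Plane →L[ℝ] Plane × ℝ} (hT : Function.Injective T) :
    IsRegularPair (T (planeVec 0), T (planeVec 1)) := by
  by_contra h
  simp only [IsRegularPair, not_or, not_not] at h
  obtain ⟨h0, h1, hv⟩ := h
  unfold crossFst at h0 h1
  unfold crossVert at hv
  rw [injective_iff_map_eq_zero] at hT
  set t₁ := T (planeVec 0) with ht₁
  set t₂ := T (planeVec 1) with ht₂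
  have key : ∀ a : ℝ, ∀ b : ℝ, a • t₂ - b • t₁ = 0 → a = 0 := by
    intro a b hab
    have := hT (a • planeVec 1 - b • planeVec 0) (by rw [map_sub, map_smul, map_smul]; exact hab)
    simpa using congrArg (fun v : Plane => v 1) this
  have ext' : ∀ t : Plane × ℝ, t.1 0 = 0 → t.1 1 = 0 → t.2 = 0 → t = 0 := by
    intro t e0 e1 e2
    refine Prod.ext ?_ e2
    ext k
    fin_cases k
    · exact e0
    · exact e1
  have c0 : t₁.1 0 = 0 := key _ (t₂.1 0) (ext' _ (by simp; ring) (by simp; linarith)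
    (by simp; linarith))
  have c1 : t₁.1 1 = 0 := key _ (t₂.1 1) (ext' _ (by simp; linarith) (by simp; ring)
    (by simp; linarith))
  have c2 : t₁.2 = 0 := key _ t₂.2 (ext' _ (by simp; linarith) (by simp; linarith)
    (by simp; ring))
  have := hT (planeVec 0) (ext' _ c0 c1 c2)
  simpa using congrArg (fun v : Plane => v 0) this

/-- The two tangent vectors of a parametrized surface. -/
noncomputable def tangentPair (f : Plane → Plane × ℝ) (z : Plane) : (Plane × ℝ) × (Plane × ℝ) :=
  (tangentAt f z 0, tangentAt f z 1)

/-- This is the squared norm of a nonzero covector for the positive definite inverse of the product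
metric. -/
lemma conormalSq_pos {κ : MetricCoeffs} {i j : Fin 2} {t : (Plane × ℝ) × (Plane × ℝ)} (hij : i ≠ j)
    (ht : IsRegularPair t) (hpos : 0 < κ.1 j j) (hdet : 0 < κ.1 i i * κ.1 j j - κ.1 i j ^ 2) :
    0 < conormalSq κ i j t.1 t.2 := by
  have h : crossFst j t.1 t.2 ≠ 0 ∨ crossSnd i t.1 t.2 ≠ 0 ∨ crossVert i j t.1 t.2 ≠ 0 := by
    by_contra hcon
    simp only [not_or, not_not] at hcon
    obtain ⟨h1, h2, h3⟩ := hcon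
    unfold crossFst at h1
    unfold crossSnd at h2
    unfold crossVert at h3
    unfold IsRegularPair crossFst crossVert at ht
    rcases Fin.two_cases_of_ne hij with ⟨rfl, rfl⟩ | ⟨rfl, rfl⟩ <;>
    rcases ht with ht | ht | ht <;> exact ht (by linarith)
  unfold conormalSq
  generalize crossFst j t.1 t.2 = m₁ at *
  generalize crossSnd i t.1 t.2 = m₂ at *
  generalize crossVert i j t.1 t.2 = m₃ at *
  have hq : 0 ≤ κ.1 j j * (κ.1 i i * m₁ ^ 2 + 2 * κ.1 i j * (m₁ * m₂) + κ.1 j j * m₂ ^ 2) := by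
    nlinarith [sq_nonneg (κ.1 i j * m₁ + κ.1 j j * m₂), mul_nonneg hdet.le (sq_nonneg m₁)]
  have hq' := nonneg_of_mul_nonneg_right hq hpos
  rcases eq_or_ne m₃ 0 with h3 | h3
  · have hq2 : 0 < κ.1 j j * (κ.1 i i * m₁ ^ 2 + 2 * κ.1 i j * (m₁ * m₂) + κ.1 j j * m₂ ^ 2) := by
      rcases eq_or_ne m₁ 0 with h1 | h1
      · have h2 : m₂ ≠ 0 := by tauto
        rw [h1]
        have := mul_pos hpos (mul_pos hpos (sq_pos_of_ne_zero h2))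
        linarith
      · nlinarith [sq_nonneg (κ.1 i j * m₁ + κ.1 j j * m₂), mul_pos hdet (sq_pos_of_ne_zero h1)]
    have := (mul_pos_iff_of_pos_left hpos).1 hq2
    nlinarith [sq_nonneg m₃]
  · have := sq_pos_of_ne_zero h3
    linarith

lemma TendstoUniformlyOn.eventually_forall_mem {α β ι : Type*} [PseudoMetricSpace β] {l : Filter ι}
    {F : ι → α → β} {f : α → β} {s : Set α} {U : Set β} (h : TendstoUniformlyOn F f l s)
    (hs : IsCompact (f '' s)) (hU : IsOpen U) (hsU : f '' s ⊆ U) : ∀ᶠ n in l, ∀ x ∈ s, F n x ∈ U := by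
  obtain ⟨δ, hδ, hδU⟩ := hs.exists_thickening_subset_open hU hsU
  filter_upwards [Metric.tendstoUniformlyOn_iff.1 h δ hδ] with n hn x hx
  exact hδU (Metric.mem_thickening_iff.2 ⟨f x, mem_image_of_mem f hx, by
    rw [dist_comm]; exact hn x hx⟩)

section LocalRep

variable {N : Type*} [TopologicalSpace N] [ChartedSpace (EuclideanSpace ℝ (Fin 2)) N]
  {S : Type*} [TopologicalSpace S] [ChartedSpace (EuclideanSpace ℝ (Fin 2)) S]

/-- The expression of `F : S → N × ℝ` in the charts at `s₀` and at `x₀`. -/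
noncomputable def localRep (x₀ : N) (s₀ : S) (F : S → N × ℝ) (z : Plane) : Plane × ℝ :=
  (chartAt Plane x₀ (F ((chartAt Plane s₀).symm z)).1, (F ((chartAt Plane s₀).symm z)).2)

/-- The product chart of `N × ℝ` above the chart at `x₀`. -/
noncomputable def prodChart (x₀ : N) : OpenPartialHomeomorph (N × ℝ) (ModelProd Plane ℝ) :=
  (chartAt Plane x₀).prod (OpenPartialHomeomorph.refl ℝ)

lemma prodChart_mem_atlas (x₀ : N) : prodChart x₀ ∈ atlas (ModelProd Plane ℝ) (N × ℝ) :=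
  ⟨chartAt Plane x₀, chart_mem_atlas _ _, OpenPartialHomeomorph.refl ℝ,
    by simp [chartedSpaceSelf_atlas], rfl⟩

lemma mem_prodChart_source {x₀ : N} {p : N × ℝ} :
    p ∈ (prodChart x₀).source ↔ p.1 ∈ (chartAt Plane x₀).source := by
  simp [prodChart]

lemma IsC2Immersion.injective_pushVec {G : S → N × ℝ} (hG : IsC2Immersion G) {s : S}
    {w : TangentSpace (𝓡 2) s} (h : pushVec G s w = 0) : w = 0 := by
  have hs := hG.contMDiff s
  have h1 : MDifferentiableAt (𝓡 2) (𝓡 2) (fun t => (G t).1) s :=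
    hs.fst.mdifferentiableAt two_ne_zero
  have h2 : MDifferentiableAt (𝓡 2) 𝓘(ℝ, ℝ) (fun t => (G t).2) s :=
    hs.snd.mdifferentiableAt two_ne_zero
  have h3 := mfderiv_prodMk h1 h2
  refine (injective_iff_map_eq_zero (mfderiv (𝓡 2) ((𝓡 2).prod 𝓘(ℝ, ℝ)) G s)).1
    (hG.injective_mfderiv s) w ?_
  have h4 := congrArg (fun T : Plane →L[ℝ] Plane × ℝ => T w) h3
  exact h4.trans h

variable [IsManifold (𝓡 2) ∞ N] [IsManifold (𝓡 2) 2 S] {x₀ : N} {s₀ : S} {F : S → N × ℝ} {z : Plane}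

lemma contDiffAt_localRep (hz : z ∈ (chartAt Plane s₀).target)
    (hx : (F ((chartAt Plane s₀).symm z)).1 ∈ (chartAt Plane x₀).source)
    (hF : ContMDiffAt (𝓡 2) ((𝓡 2).prod 𝓘(ℝ, ℝ)) 2 F ((chartAt Plane s₀).symm z)) :
    ContDiffAt ℝ 2 (localRep x₀ s₀ F) z := by
  have hsymm : ContMDiffAt (𝓡 2) (𝓡 2) 2 (chartAt Plane s₀).symm z :=
    (contMDiffOn_chart_symm (I := 𝓡 2) (n := 2) (x := s₀)).contMDiffAt
      ((chartAt Plane s₀).open_target.mem_nhds hz)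
  have hchart : ContMDiffAt (𝓡 2) (𝓡 2) 2 (chartAt Plane x₀) (F ((chartAt Plane s₀).symm z)).1 :=
    (contMDiffOn_chart (I := 𝓡 2) (n := 2) (x := x₀)).contMDiffAt
      ((chartAt Plane x₀).open_source.mem_nhds hx)
  have h1 : ContMDiffAt (𝓡 2) (𝓡 2) 2
      (fun z => chartAt Plane x₀ (F ((chartAt Plane s₀).symm z)).1) z :=
    hchart.comp z (hF.fst.comp z hsymm)
  have h2 : ContMDiffAt (𝓡 2) 𝓘(ℝ, ℝ) 2 (fun z => (F ((chartAt Plane s₀).symm z)).2) z :=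
    hF.snd.comp z hsymm
  exact (contMDiffAt_iff_contDiffAt.1 h1).prodMk (contMDiffAt_iff_contDiffAt.1 h2)

/-- The dictionary between coordinate derivatives and the intrinsic differential, through which
immersivity, transversality and normality are transported. -/
lemma fderiv_localRep (hz : z ∈ (chartAt Plane s₀).target)
    (hx : (F ((chartAt Plane s₀).symm z)).1 ∈ (chartAt Plane x₀).source)
    (hF : ContMDiffAt (𝓡 2) ((𝓡 2).prod 𝓘(ℝ, ℝ)) 2 F ((chartAt Plane s₀).symm z)) (v : Plane) :
    fderiv ℝ (localRep x₀ s₀ F) z v =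
      (chartCoord x₀ (F ((chartAt Plane s₀).symm z)).1
        (pushVec F ((chartAt Plane s₀).symm z) (chartLift s₀ ((chartAt Plane s₀).symm z) v)).1,
      (pushVec F ((chartAt Plane s₀).symm z) (chartLift s₀ ((chartAt Plane s₀).symm z) v)).2) := by
  have hsymm : MDifferentiableAt (𝓡 2) (𝓡 2) (chartAt Plane s₀).symm z :=
    (mdifferentiable_chart (I := 𝓡 2) s₀).mdifferentiableAt_symm hz
  have hchart : MDifferentiableAt (𝓡 2) (𝓡 2) (chartAt Plane x₀)
      (F ((chartAt Plane s₀).symm z)).1 :=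
    (mdifferentiable_chart (I := 𝓡 2) x₀).mdifferentiableAt hx
  have hF1 : MDifferentiableAt (𝓡 2) (𝓡 2) (fun t => (F t).1) ((chartAt Plane s₀).symm z) :=
    hF.fst.mdifferentiableAt two_ne_zero
  have hF2 : MDifferentiableAt (𝓡 2) 𝓘(ℝ, ℝ) (fun t => (F t).2) ((chartAt Plane s₀).symm z) :=
    hF.snd.mdifferentiableAt two_ne_zero
  have hd : DifferentiableAt ℝ (localRep x₀ s₀ F) z :=
    (contDiffAt_localRep hz hx hF).differentiableAt two_ne_zero
  have e1 : fderiv ℝ (fun z => (localRep x₀ s₀ F z).1) z v = (fderiv ℝ (localRep x₀ s₀ F) z v).1 := by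
    rw [hd.hasFDerivAt.fst.fderiv]; rfl
  have e2 : fderiv ℝ (fun z => (localRep x₀ s₀ F z).2) z v = (fderiv ℝ (localRep x₀ s₀ F) z v).2 := by
    rw [hd.hasFDerivAt.snd.fderiv]; rfl
  refine Prod.ext ?_ ?_
  · rw [← e1, chartCoord_eq_mfderiv hx]
    have h1 := mfderiv_comp z (g := chartAt Plane x₀)
      (f := (fun t => (F t).1) ∘ (chartAt Plane s₀).symm) hchart (hF1.comp z hsymm)
    have h2 := mfderiv_comp z (g := fun t => (F t).1) (f := (chartAt Plane s₀).symm) hF1 hsymm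
    have h3 := congrArg (fun T : Plane →L[ℝ] Plane => T v) h1
    rw [h2] at h3
    have h4 := mfderiv_chartAt_symm (x₀ := s₀) hz v
    rw [← mfderiv_eq_fderiv]
    refine h3.trans ?_
    simp only [pushVec, ← h4]
    rfl
  · rw [← e2]
    have h2 := mfderiv_comp z (g := fun t => (F t).2) (f := (chartAt Plane s₀).symm) hF2 hsymm
    have h3 := congrArg (fun T : Plane →L[ℝ] ℝ => T v) h2
    have h4 := mfderiv_chartAt_symm (x₀ := s₀) hz v
    rw [← mfderiv_eq_fderiv]
    refine h3.trans ?_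
    simp only [pushVec, ← h4]
    rfl

lemma IsC2Immersion.injective_fderiv_localRep {G : S → N × ℝ} (hG : IsC2Immersion G)
    (hz : z ∈ (chartAt Plane s₀).target)
    (hx : (G ((chartAt Plane s₀).symm z)).1 ∈ (chartAt Plane x₀).source) :
    Function.Injective (fderiv ℝ (localRep x₀ s₀ G) z) := by
  rw [injective_iff_map_eq_zero]
  intro v hv
  rw [fderiv_localRep hz hx (hG.contMDiff _), Prod.mk_eq_zero] at hv
  have h1 : pushVec G ((chartAt Plane s₀).symm z)
      (chartLift s₀ ((chartAt Plane s₀).symm z) v) = 0 := by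
    refine Prod.ext ?_ hv.2
    rw [← chartLift_chartCoord hx (pushVec G ((chartAt Plane s₀).symm z) _).1, hv.1, map_zero]
    rfl
  have h2 := hG.injective_pushVec h1
  rw [← chartCoord_chartLift ((chartAt Plane s₀).map_target hz) v, h2, map_zero]

end LocalRep

/-! ### Local convergence of immersed surfaces -/

section UniformJets

variable {l : Filter ℕ} {f : ℕ → Plane → Plane × ℝ} {g : Plane → Plane × ℝ} {s : Set Plane}

lemma tendstoUniformlyOn_tangentAt
    (h : TendstoUniformlyOn (fun n => iteratedFDeriv ℝ 1 (f n)) (iteratedFDeriv ℝ 1 g) l s)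
    (a : Fin 2) :
    TendstoUniformlyOn (fun n z => tangentAt (f n) z a) (fun z => tangentAt g z a) l s := by
  have h1 := (ContinuousMultilinearMap.apply ℝ (fun _ : Fin 1 => Plane) (Plane × ℝ)
    fun _ => planeVec a).uniformContinuous.comp_tendstoUniformlyOn h
  have e : ∀ (k : Plane → Plane × ℝ), (fun z => tangentAt k z a) =
      (ContinuousMultilinearMap.apply ℝ (fun _ : Fin 1 => Plane) (Plane × ℝ)
        fun _ => planeVec a) ∘ iteratedFDeriv ℝ 1 k := fun k => by
    funext z
    exact (iteratedFDeriv_one_apply (𝕜 := ℝ) (f := k) (x := z) fun _ => planeVec a).symm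
  rw [e g]
  exact h1.congr (Eventually.of_forall fun n z _ => (congrFun (e (f n)) z).symm)

lemma tendstoUniformlyOn_tangentPair
    (h : TendstoUniformlyOn (fun n => iteratedFDeriv ℝ 1 (f n)) (iteratedFDeriv ℝ 1 g) l s) :
    TendstoUniformlyOn (fun n => tangentPair (f n)) (tangentPair g) l s := by
  intro U hU
  have h1 := (tendstoUniformlyOn_tangentAt h 0).prodMk (tendstoUniformlyOn_tangentAt h 1) U hU
  exact (tendsto_id.prodMk tendsto_id).eventually h1

lemma tendstoJet_of_tendstoUniformlyOn
    (h : ∀ k : ℕ, k ≤ 2 →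
      TendstoUniformlyOn (fun n => iteratedFDeriv ℝ k (f n)) (iteratedFDeriv ℝ k g) l s)
    {z : Plane} (hz : z ∈ s) : TendstoJet l f g z where
  point := by
    have h1 := ((ContinuousMultilinearMap.apply ℝ (fun _ : Fin 0 => Plane) (Plane × ℝ)
      ![]).continuous.tendsto _).comp ((h 0 zero_le_two).tendsto_at hz)
    simpa [Function.comp_def] using h1
  tangent a := (tendstoUniformlyOn_tangentAt (h 1 one_le_two) a).tendsto_at hz
  second a b := by
    have h1 := ((ContinuousMultilinearMap.apply ℝ (fun _ : Fin 2 => Plane) (Plane × ℝ)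
      ![planeVec a, planeVec b]).continuous.tendsto _).comp ((h 2 le_rfl).tendsto_at hz)
    simpa [Function.comp_def, iteratedFDeriv_two_apply, secondAt] using h1

end UniformJets

section Patch

variable {N : Type*} [TopologicalSpace N] [ChartedSpace (EuclideanSpace ℝ (Fin 2)) N]
  {S : Type*} [TopologicalSpace S] [ChartedSpace (EuclideanSpace ℝ (Fin 2)) S]

/-- At the point with coordinates `z`, the map `F` is of class `C²`, immersive, and has values in
the graph of `u` above the domain of the chart at `x₀`. -/
structure IsGraphPoint (x₀ : N) (s₀ : S) (Ω : Set N) (u : N → ℝ) (F : S → N × ℝ) (z : Plane) :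
    Prop where
  mem_source : (F ((chartAt Plane s₀).symm z)).1 ∈ (chartAt Plane x₀).source
  contMDiffAt : ContMDiffAt (𝓡 2) ((𝓡 2).prod 𝓘(ℝ, ℝ)) 2 F ((chartAt Plane s₀).symm z)
  regular : IsRegularPair (tangentPair (localRep x₀ s₀ F) z)
  mem_graph : F ((chartAt Plane s₀).symm z) ∈ graphOver Ω u

/-- The set `B` of coordinates is a neighbourhood on which the maps `F n` parametrize graphs and
converge to `G`. -/
structure IsGraphPatch (x₀ : N) (s₀ : S) (Ω : ℕ → Set N) (u : ℕ → N → ℝ) (F : ℕ → S → N × ℝ)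
    (G : S → N × ℝ) (B : Set Plane) : Prop where
  isOpen : IsOpen B
  isPreconnected : IsPreconnected B
  subset_target : B ⊆ (chartAt Plane s₀).target
  mem_source : ∀ z ∈ B, (G ((chartAt Plane s₀).symm z)).1 ∈ (chartAt Plane x₀).source
  tendstoJet : ∀ z ∈ B, TendstoJet atTop (fun n => localRep x₀ s₀ (F n)) (localRep x₀ s₀ G) z
  graphPoint : ∀ᶠ n in atTop, ∀ z ∈ B, IsGraphPoint x₀ s₀ (Ω n) (u n) (F n) z

lemma IsGraphPatch.tendsto_fst {x₀ : N} {s₀ s : S} {Ω : ℕ → Set N} {u : ℕ → N → ℝ}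
    {F : ℕ → S → N × ℝ} {G : S → N × ℝ} {B : Set Plane} (hB : IsGraphPatch x₀ s₀ Ω u F G B)
    (hs : s ∈ (chartAt Plane s₀).source) (hz : chartAt Plane s₀ s ∈ B) :
    Tendsto (fun n => (F n s).1) atTop (𝓝 (G s).1) := by
  have hx := hB.mem_source _ hz
  rw [(chartAt Plane s₀).left_inv hs] at hx
  have h1 := (continuous_fst.tendsto _).comp (hB.tendstoJet _ hz).point
  have h2 : ∀ H : S → N × ℝ, (localRep x₀ s₀ H (chartAt Plane s₀ s)).1 =
      chartAt Plane x₀ (H s).1 := fun H => by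
    simp only [localRep, (chartAt Plane s₀).left_inv hs]
  simp only [Function.comp_def, h2] at h1
  have h3 := ((chartAt Plane x₀).symm.continuousAt
    ((chartAt Plane x₀).map_source hx)).tendsto.comp h1
  rw [(chartAt Plane x₀).left_inv hx] at h3
  refine h3.congr' ?_
  filter_upwards [hB.graphPoint] with n hn
  have h4 := (hn _ hz).mem_source
  rw [(chartAt Plane s₀).left_inv hs] at h4
  exact (chartAt Plane x₀).left_inv h4

section GraphPoint

variable {x₀ : N} {s₀ : S} {F : S → N × ℝ} {Ω : Set N} {u : N → ℝ} {z : Plane}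

lemma IsGraphPoint.fst_mem_target (h : IsGraphPoint x₀ s₀ Ω u F z) :
    (localRep x₀ s₀ F z).1 ∈ (chartAt Plane x₀).target :=
  (chartAt Plane x₀).map_source h.mem_source

lemma IsGraphPoint.symm_fst (h : IsGraphPoint x₀ s₀ Ω u F z) :
    (chartAt Plane x₀).symm (localRep x₀ s₀ F z).1 = (F ((chartAt Plane s₀).symm z)).1 :=
  (chartAt Plane x₀).left_inv h.mem_source

lemma continuousOn_surfaceVert {B : Set Plane} (i j : Fin 2)
    (h : ∀ z ∈ B, ContDiffAt ℝ 2 (localRep x₀ s₀ F) z) :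
    ContinuousOn (surfaceVert i j (localRep x₀ s₀ F)) B := fun z hz => by
  have h := (h z hz).differentiableAt_fderiv.continuousAt
  exact ((continuous_crossVert i j).continuousAt.comp
    ((h.clm_apply (continuousAt_const (y := planeVec 0))).prodMk
      (h.clm_apply (continuousAt_const (y := planeVec 1))))).continuousWithinAt

end GraphPoint

variable [IsManifold (𝓡 2) ∞ N] [IsManifold (𝓡 2) 2 S]

/-- Linear independence of the tangent vectors is an open condition, so uniform `C¹` convergence on
a compact coordinate ball makes `F n` immersive there for large `n`. The open ball is convex, hence
preconnected. -/
lemma exists_isGraphPatch {Ω : ℕ → Set N} {u : ℕ → N → ℝ} {F : ℕ → S → N × ℝ} {G : S → N × ℝ}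
    (hG : IsC2Immersion G)
    (hF : ∀ K : Set S, IsCompact K → ∀ᶠ n in atTop, MapsTo (F n) K (graphOver (Ω n) (u n)))
    (hconv : TendstoLocC2 (𝓡 2) ((𝓡 2).prod 𝓘(ℝ, ℝ)) F G) (s₀ : S) :
    ∃ B, chartAt Plane s₀ s₀ ∈ B ∧ IsGraphPatch (G s₀).1 s₀ Ω u F G B := by
  set x₀ := (G s₀).1 with hx₀
  set φ := chartAt Plane s₀ with hφ
  have hG1 : Continuous fun s => (G s).1 := continuous_fst.comp hG.contMDiff.continuous
  have hz₀ : φ s₀ ∈ φ.target := φ.map_source (mem_chart_source _ _)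
  have hO : φ.target ∩ φ.symm ⁻¹' ((fun s => (G s).1) ⁻¹' (chartAt Plane x₀).source) ∈
      𝓝 (φ s₀) := by
    refine (φ.isOpen_inter_preimage_symm
      ((chartAt Plane x₀).open_source.preimage hG1)).mem_nhds ⟨hz₀, ?_⟩
    simp only [mem_preimage, φ.left_inv (mem_chart_source Plane s₀)]
    exact mem_chart_source _ _
  obtain ⟨ρ, hρ, hball⟩ := Metric.nhds_basis_closedBall.mem_iff.1 hO
  have hcpt : IsCompact (Metric.closedBall (φ s₀) ρ) := isCompact_closedBall _ _
  set K := φ.symm '' Metric.closedBall (φ s₀) ρ with hK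
  have hKc : IsCompact K := hcpt.image_of_continuousOn
    (φ.continuousOn_symm.mono fun z hz => (hball hz).1)
  have hKφ : K ⊆ φ.source := by
    rintro _ ⟨z, hz, rfl⟩
    exact φ.map_target (hball hz).1
  have hKG : MapsTo G K (prodChart x₀).source := by
    rintro _ ⟨z, hz, rfl⟩
    exact mem_prodChart_source.2 (hball hz).2
  obtain ⟨hev, huni⟩ := hconv φ (chart_mem_atlas _ _) (prodChart x₀) (prodChart_mem_atlas x₀) K
    hKc hKφ hKG
  have himage : φ.extend (𝓡 2) '' K = Metric.closedBall (φ s₀) ρ := by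
    rw [hK, image_image]
    refine (image_congr fun z hz => ?_).trans (image_id _)
    exact φ.right_inv (hball hz).1
  rw [himage] at huni
  have hreg : ∀ᶠ n in atTop, ∀ z ∈ Metric.closedBall (φ s₀) ρ,
      tangentPair (localRep x₀ s₀ (F n)) z ∈ {t | IsRegularPair t} := by
    refine (tendstoUniformlyOn_tangentPair (huni 1 one_le_two)).eventually_forall_mem ?_
      isOpen_isRegularPair ?_
    · refine hcpt.image_of_continuousOn fun z hz => ContinuousAt.continuousWithinAt ?_
      have h := (contDiffAt_localRep (hball hz).1 (hball hz).2
        (hG.contMDiff _)).differentiableAt_fderiv.continuousAt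
      exact (h.clm_apply continuousAt_const).prodMk (h.clm_apply continuousAt_const)
    · rintro _ ⟨z, hz, rfl⟩
      exact isRegularPair_of_injective (hG.injective_fderiv_localRep (hball hz).1 (hball hz).2)
  refine ⟨Metric.ball (φ s₀) ρ, Metric.mem_ball_self hρ, Metric.isOpen_ball,
    (convex_ball _ _).isPreconnected,
    fun z hz => (hball (Metric.ball_subset_closedBall hz)).1,
    fun z hz => (hball (Metric.ball_subset_closedBall hz)).2,
    fun z hz => tendstoJet_of_tendstoUniformlyOn huni (Metric.ball_subset_closedBall hz), ?_⟩
  filter_upwards [hev, hreg, hF K hKc] with n h1 h2 h3 z hz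
  have hz' := Metric.ball_subset_closedBall hz
  have hzK : φ.symm z ∈ K := mem_image_of_mem _ hz'
  exact ⟨mem_prodChart_source.1 (h1.1 hzK), h1.2 _ hzK, h2 z hz', h3 hzK⟩

section GraphPoint

variable {x₀ : N} {s₀ : S} {F : S → N × ℝ} {Ω : Set N} {u : N → ℝ} {z : Plane}

lemma IsSmoothGraph.contDiffAt (hu : IsSmoothGraph Ω u) {y : Plane}
    (hy : y ∈ (chartAt Plane x₀).target) (hΩ : (chartAt Plane x₀).symm y ∈ Ω) :
    ContDiffAt ℝ 2 (u ∘ (chartAt Plane x₀).symm) y := by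
  have h1 : ContMDiffAt (𝓡 2) 𝓘(ℝ, ℝ) ∞ u ((chartAt Plane x₀).symm y) :=
    hu.smooth.contMDiffAt (hu.isOpen.mem_nhds hΩ)
  have h2 : ContMDiffAt (𝓡 2) (𝓡 2) ∞ (chartAt Plane x₀).symm y :=
    (contMDiffOn_chart_symm (I := 𝓡 2) (n := ∞) (x := x₀)).contMDiffAt
      ((chartAt Plane x₀).open_target.mem_nhds hy)
  exact (contMDiffAt_iff_contDiffAt.1 (h1.comp y h2)).of_le (by norm_cast)

lemma IsGraphPoint.contDiffAt (h : IsGraphPoint x₀ s₀ Ω u F z) (hu : IsSmoothGraph Ω u) :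
    ContDiffAt ℝ 2 (u ∘ (chartAt Plane x₀).symm) (localRep x₀ s₀ F z).1 :=
  hu.contDiffAt h.fst_mem_target (by rw [h.symm_fst]; exact h.mem_graph.1)

lemma IsGraphPoint.snd_eq (h : IsGraphPoint x₀ s₀ Ω u F z) :
    (localRep x₀ s₀ F z).2 = (u ∘ (chartAt Plane x₀).symm) (localRep x₀ s₀ F z).1 := by
  rw [Function.comp_apply, h.symm_fst]
  exact h.mem_graph.2

/-- For a graph the whole conormal is a multiple of its vertical component, so vanishing of the
latter would contradict regularity of the parametrization. -/
lemma surfaceVert_ne_zero_of_isGraphPoint {B : Set Plane} (hB : IsOpen B)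
    (hBt : B ⊆ (chartAt Plane s₀).target) (hu : IsSmoothGraph Ω u)
    (h : ∀ z ∈ B, IsGraphPoint x₀ s₀ Ω u F z) (hz : z ∈ B) :
    surfaceVert 0 1 (localRep x₀ s₀ F) z ≠ 0 := by
  intro h0
  have hev : ∀ᶠ z' in 𝓝 z, (localRep x₀ s₀ F z').2 =
      (u ∘ (chartAt Plane x₀).symm) (localRep x₀ s₀ F z').1 := by
    filter_upwards [hB.mem_nhds hz] with z' hz' using (h z' hz').snd_eq
  have hf := contDiffAt_localRep (hBt hz) (h z hz).mem_source (h z hz).contMDiffAt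
  have h1 := fderiv_snd_of_graph hf ((h z hz).contDiffAt hu) hev
  have e1 := crossFst_graph (j := 1) zero_ne_one (h1 (planeVec 0)) (h1 (planeVec 1))
  have e0 := crossFst_graph (j := 0) one_ne_zero (h1 (planeVec 0)) (h1 (planeVec 1))
  have e2 : crossVert 1 0 (tangentAt (localRep x₀ s₀ F) z 0) (tangentAt (localRep x₀ s₀ F) z 1) =
      -surfaceVert 0 1 (localRep x₀ s₀ F) z := by
    unfold surfaceVert crossVert; ring
  rcases (h z hz).regular with hr | hr | hr
  · exact hr (e0.trans (by rw [← tangentAt, ← tangentAt, e2, h0]; ring))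
  · refine hr (e1.trans ?_)
    have h0' : crossVert 0 1 (fderiv ℝ (localRep x₀ s₀ F) z (planeVec 0))
      (fderiv ℝ (localRep x₀ s₀ F) z (planeVec 1)) = 0 := h0
    rw [h0']; ring
  · exact hr h0

end GraphPoint

/-- Along an ultrafilter, the graphs of a patch are parametrized with a fixed orientation. -/
lemma IsGraphPatch.exists_sign {x₀ : N} {s₀ : S} {Ω : ℕ → Set N} {u : ℕ → N → ℝ}
    {F : ℕ → S → N × ℝ} {G : S → N × ℝ} {B : Set Plane} (hB : IsGraphPatch x₀ s₀ Ω u F G B)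
    (hgraph : ∀ n, IsSmoothGraph (Ω n) (u n)) {𝒰 : Ultrafilter ℕ} (h𝒰 : (𝒰 : Filter ℕ) ≤ atTop) :
    ∃ σ : ℝ, |σ| = 1 ∧ ∀ᶠ n in 𝒰, ∀ z ∈ B, 0 < σ * surfaceVert 0 1 (localRep x₀ s₀ (F n)) z := by
  refine exists_sign_of_ne_zero hB.isPreconnected 𝒰 ?_
  filter_upwards [h𝒰 hB.graphPoint] with n hn
  refine ⟨continuousOn_surfaceVert 0 1 fun z hz => contDiffAt_localRep (hB.subset_target hz)
    (hn z hz).mem_source (hn z hz).contMDiffAt, fun z hz => ?_⟩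
  exact surfaceVert_ne_zero_of_isGraphPoint hB.isOpen hB.subset_target (hgraph n) hn hz

end Patch

/-! ### Vertical points of the limit surface -/

section Transverse

variable {N : Type*} [TopologicalSpace N] [ChartedSpace (EuclideanSpace ℝ (Fin 2)) N]
  {S : Type*} [TopologicalSpace S] [ChartedSpace (EuclideanSpace ℝ (Fin 2)) S]

/-- The surface parametrized by `F` is transverse to the vertical direction at `s`. -/
def IsTransverse (F : S → N × ℝ) (s : S) : Prop :=
  ∀ w, (pushVec F s w).1 = 0 → w = 0

lemma surfaceVert_swap (i j : Fin 2) (f : Plane → Plane × ℝ) (z : Plane) :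
    surfaceVert j i f z = -surfaceVert i j f z := by
  unfold surfaceVert crossVert; ring

lemma crossVert_ne_zero_iff (T : Plane →L[ℝ] Plane × ℝ) :
    crossVert 0 1 (T (planeVec 0)) (T (planeVec 1)) ≠ 0 ↔ ∀ v, (T v).1 = 0 → v = 0 := by
  have hT : ∀ v k, (T v).1 k = v 0 * (T (planeVec 0)).1 k + v 1 * (T (planeVec 1)).1 k := by
    intro v k
    conv_lhs => rw [planeVec_sum v]
    simp
  unfold crossVert
  constructor
  · intro h v hv
    have h0 := hT v 0
    have h1 := hT v 1
    rw [hv] at h0 h1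
    simp only [PiLp.zero_apply] at h0 h1
    ext k
    refine (mul_eq_zero.1 (?_ : v k * _ = 0)).resolve_right h
    match k with
    | 0 => linear_combination (T (planeVec 1)).1 0 * h1 - (T (planeVec 1)).1 1 * h0
    | 1 => linear_combination (T (planeVec 0)).1 1 * h0 - (T (planeVec 0)).1 0 * h1
  · intro h h0
    have key : ∀ k, (T (planeVec 0)).1 k = 0 := by
      intro k
      have h1 := h ((T (planeVec 1)).1 k • planeVec 0 - (T (planeVec 0)).1 k • planeVec 1) (by
        ext l
        simp only [map_sub, map_smul, Prod.fst_sub, Prod.smul_fst, PiLp.sub_apply,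
          PiLp.smul_apply, smul_eq_mul, PiLp.zero_apply]
        fin_cases k <;> fin_cases l <;> simp <;> linarith)
      simpa using congrArg (fun v : Plane => v 1) h1
    have h1 := h (planeVec 0) (by ext k; exact key k)
    simpa using congrArg (fun v : Plane => v 0) h1

variable [IsManifold (𝓡 2) ∞ N] [IsManifold (𝓡 2) 2 S]

/-- The right side involves no target chart and no coordinates, so the vanishing locus is a
well-defined subset of `S`. -/
lemma surfaceVert_ne_zero_iff {x₀ : N} {s₀ : S} {F : S → N × ℝ} {z : Plane}
    (hz : z ∈ (chartAt Plane s₀).target)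
    (hx : (F ((chartAt Plane s₀).symm z)).1 ∈ (chartAt Plane x₀).source)
    (hF : ContMDiffAt (𝓡 2) ((𝓡 2).prod 𝓘(ℝ, ℝ)) 2 F ((chartAt Plane s₀).symm z)) :
    surfaceVert 0 1 (localRep x₀ s₀ F) z ≠ 0 ↔ IsTransverse F ((chartAt Plane s₀).symm z) := by
  have hs := (chartAt Plane s₀).map_target hz
  refine (crossVert_ne_zero_iff (fderiv ℝ (localRep x₀ s₀ F) z)).trans ?_
  simp only [fderiv_localRep hz hx hF]
  constructor
  · intro h w hw
    have h1 := h (chartCoord s₀ _ w) (by rw [chartLift_chartCoord hs, hw, map_zero])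
    rw [← chartLift_chartCoord hs w, h1, map_zero]
  · intro h v hv
    have h1 := h (chartLift s₀ _ v) (by
      rw [← chartLift_chartCoord hx (pushVec F _ _).1, hv, map_zero])
    rw [← chartCoord_chartLift hs v, h1, map_zero]

section Clopen

variable [RiemannianBundle (fun x : N => TangentSpace (𝓡 2) x)]
  [IsContMDiffRiemannianBundle (𝓡 2) ∞ (EuclideanSpace ℝ (Fin 2))
      (fun x : N => TangentSpace (𝓡 2) x)]
  {Ω : ℕ → Set N} {u : ℕ → N → ℝ} {F : ℕ → S → N × ℝ} {G : S → N × ℝ}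

/-- In every chart, the graphs satisfy `div (Du / W) = c n + τ / W`. -/
lemma exists_graphEq (hgraph : ∀ n, IsSmoothGraph (Ω n) (u n))
    (hcurv : (∀ n, IsMinimalGraph (Ω n) (u n)) ∨ (∀ n, IsCMCGraph (Ω n) (u n)) ∨
      (∀ n, IsTranslatingGraph (Ω n) (u n))) :
    ∃ (τ : ℝ) (c : ℕ → ℝ), ∀ n (x₀ : N), ∀ y ∈ (chartAt Plane x₀).target,
      (chartAt Plane x₀).symm y ∈ Ω n →
      GraphEq (chartCoeffs (chartAt Plane x₀)) (c n) τ (u n ∘ (chartAt Plane x₀).symm) y := by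
  have hcmc : (∀ n, IsCMCGraph (Ω n) (u n)) → ∃ (τ : ℝ) (c : ℕ → ℝ), ∀ n (x₀ : N),
      ∀ y ∈ (chartAt Plane x₀).target, (chartAt Plane x₀).symm y ∈ Ω n →
      GraphEq (chartCoeffs (chartAt Plane x₀)) (c n) τ (u n ∘ (chartAt Plane x₀).symm) y := by
    intro h
    choose c hc using h
    -- The constant may vary with `n`, but for each graph it is the same in all charts.
    exact ⟨(0 : ℝ), fun n => -c n, fun n x₀ y hy hΩ => graphEq_of_constMeanCurvature hy
      ((hgraph n).contDiffAt hy hΩ) (hc n _ (chart_mem_atlas _ _) y hy hΩ)⟩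
  rcases hcurv with h | h | h
  · exact hcmc fun n => ⟨0, h n⟩
  · exact hcmc h
  · exact ⟨1, fun _ => 0, fun n x₀ y hy hΩ => graphEq_of_translating hy
      ((hgraph n).contDiffAt hy hΩ) (h n _ (chart_mem_atlas _ _) y hy hΩ)⟩

lemma IsGraphPatch.surfaceConormalSq_pos {x₀ : N} {s₀ : S} {B : Set Plane}
    (hB : IsGraphPatch x₀ s₀ Ω u F G B) (hG : IsC2Immersion G) {z : Plane} (hz : z ∈ B)
    {i j : Fin 2} (hij : i ≠ j) :
    0 < surfaceConormalSq (chartCoeffs (chartAt Plane x₀)) i j (localRep x₀ s₀ G) z := by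
  have hy : (localRep x₀ s₀ G z).1 ∈ (chartAt Plane x₀).target :=
    (chartAt Plane x₀).map_source (hB.mem_source z hz)
  exact conormalSq_pos (t := tangentPair (localRep x₀ s₀ G) z) hij
    (isRegularPair_of_injective
      (hG.injective_fderiv_localRep (hB.subset_target hz) (hB.mem_source z hz)))
    (inv_metricMatrix_pos hy hij).1 (inv_metricMatrix_pos hy hij).2

/-- If the limit surface is vertical at a point, it is vertical near this point. -/
lemma IsGraphPatch.eventually_surfaceVert_eq_zero {x₀ : N} {s₀ : S} {B : Set Plane}
    (hB : IsGraphPatch x₀ s₀ Ω u F G B) (hgraph : ∀ n, IsSmoothGraph (Ω n) (u n))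
    (hcurv : (∀ n, IsMinimalGraph (Ω n) (u n)) ∨ (∀ n, IsCMCGraph (Ω n) (u n)) ∨
      (∀ n, IsTranslatingGraph (Ω n) (u n)))
    (hG : IsC2Immersion G) {z₀ : Plane} (hz₀ : z₀ ∈ B)
    (h0 : surfaceVert 0 1 (localRep x₀ s₀ G) z₀ = 0) :
    ∀ᶠ z in 𝓝 z₀, surfaceVert 0 1 (localRep x₀ s₀ G) z = 0 := by
  obtain ⟨τ, c, heq⟩ := exists_graphEq hgraph hcurv
  obtain ⟨σ, hσ, hsign⟩ := hB.exists_sign hgraph Nat.hyperfilter_le_atTop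
  set κ := chartCoeffs (chartAt Plane x₀) with hκ
  have hy : ∀ z ∈ B, (localRep x₀ s₀ G z).1 ∈ (chartAt Plane x₀).target := fun z hz =>
    (chartAt Plane x₀).map_source (hB.mem_source z hz)
  -- Either horizontal component of the conormal may be the nonzero one, so the argument is run for
  -- both orders of the coordinates.
  have key : ∀ i j : Fin 2, i ≠ j → surfaceFst j (localRep x₀ s₀ G) z₀ ≠ 0 →
      surfaceVert i j (localRep x₀ s₀ G) z₀ = 0 → ∀ σ : ℝ, |σ| = 1 →
      (∀ᶠ n in hyperfilter ℕ, ∀ z ∈ B, 0 < σ * surfaceVert i j (localRep x₀ s₀ (F n)) z) →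
      ∀ᶠ z in 𝓝 z₀, surfaceVert i j (localRep x₀ s₀ G) z = 0 := by
    intro i j hij hfst hvert σ hσ hsign
    have hjet : ∀ z ∈ B, TendstoJet (hyperfilter ℕ : Filter ℕ)
        (fun n => localRep x₀ s₀ (F n)) (localRep x₀ s₀ G) z := fun z hz =>
      ⟨(hB.tendstoJet z hz).point.mono_left Nat.hyperfilter_le_atTop,
        fun a => ((hB.tendstoJet z hz).tangent a).mono_left Nat.hyperfilter_le_atTop,
        fun a b => ((hB.tendstoJet z hz).second a b).mono_left Nat.hyperfilter_le_atTop⟩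
    obtain ⟨c₀, hc₀⟩ := exists_surfaceOp_eq_of_tendsto (κ := κ) (τ := τ) (c := c)
      (v := fun n => u n ∘ (chartAt Plane x₀).symm) hij hσ hjet
      (fun z hz => (contDiffAt_chartCoeffs (hy z hz)).continuousAt)
      (fun z hz => hB.surfaceConormalSq_pos hG hz hij) (by
        filter_upwards [hsign, Nat.hyperfilter_le_atTop hB.graphPoint] with n hn hn' z hz
        refine ⟨inv_metricMatrix_comm _ _, contDiffAt_localRep (hB.subset_target hz)
          (hn' z hz).mem_source (hn' z hz).contMDiffAt, (hn' z hz).contDiffAt (hgraph n), ?_,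
          hn z hz, heq n x₀ _ (hn' z hz).fst_mem_target ?_⟩
        · filter_upwards [hB.isOpen.mem_nhds hz] with z' hz' using (hn' z' hz').snd_eq
        · rw [(hn' z hz).symm_fst]
          exact (hn' z hz).mem_graph.1)
    have hp := inv_metricMatrix_pos (hy z₀ hz₀) hij
    refine _root_.eventually_surfaceVert_eq_zero (κ := κ) hij (contDiffAt_localRep
      (hB.subset_target hz₀) (hB.mem_source z₀ hz₀) (hG.contMDiff _))
      (contDiffAt_chartCoeffs (hy z₀ hz₀)) hp.1 hp.2 hfst hvert (c := c₀) (τ := τ) ?_ hσ ?_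
    · filter_upwards [hB.isOpen.mem_nhds hz₀] with z hz using hc₀ z hz
    · filter_upwards [hB.isOpen.mem_nhds hz₀] with z hz
      -- The strict sign on the graphs survives in the limit only as a weak one, which is what the
      -- maximum principle takes as input.
      refine ge_of_tendsto (((hjet z hz).surfaceVert i j).const_mul σ) ?_
      filter_upwards [hsign] with n hn using (hn z hz).le
  have hreg := isRegularPair_of_injective
      (hG.injective_fderiv_localRep (hB.subset_target hz₀) (hB.mem_source z₀ hz₀))
  rcases hreg with hr | hr | hr
  -- Exchanging the coordinates reverses the vertical component, hence `-σ`.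
  · have h1 := key 1 0 one_ne_zero hr (by rw [surfaceVert_swap, h0, neg_zero]) (-σ)
      (by rwa [abs_neg]) (by
        filter_upwards [hsign] with n hn z hz
        rw [surfaceVert_swap 0 1, neg_mul_neg]
        exact hn z hz)
    filter_upwards [h1] with z hz
    rw [surfaceVert_swap 1 0, hz, neg_zero]
  · exact key 0 1 zero_ne_one hr h0 σ hσ hsign
  · exact absurd h0 hr

/-- The limit surface is everywhere transverse to the vertical direction, or nowhere. -/
theorem forall_isTransverse_or_forall_not [ConnectedSpace S]
    (hgraph : ∀ n, IsSmoothGraph (Ω n) (u n))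
    (hcurv : (∀ n, IsMinimalGraph (Ω n) (u n)) ∨ (∀ n, IsCMCGraph (Ω n) (u n)) ∨
      (∀ n, IsTranslatingGraph (Ω n) (u n)))
    (hG : IsC2Immersion G)
    (hF : ∀ K : Set S, IsCompact K → ∀ᶠ n in atTop, MapsTo (F n) K (graphOver (Ω n) (u n)))
    (hconv : TendstoLocC2 (𝓡 2) ((𝓡 2).prod 𝓘(ℝ, ℝ)) F G) :
    (∀ s, IsTransverse G s) ∨ ∀ s, ¬ IsTransverse G s := by
  have key : ∀ s₀, (IsTransverse G s₀ → ∀ᶠ s in 𝓝 s₀, IsTransverse G s) ∧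
      (¬ IsTransverse G s₀ → ∀ᶠ s in 𝓝 s₀, ¬ IsTransverse G s) := by
    intro s₀
    obtain ⟨B, hz₀, hB⟩ := exists_isGraphPatch hG hF hconv s₀
    have hiff : ∀ z ∈ B, surfaceVert 0 1 (localRep (G s₀).1 s₀ G) z ≠ 0 ↔
        IsTransverse G ((chartAt Plane s₀).symm z) := fun z hz =>
      surfaceVert_ne_zero_iff (hB.subset_target hz) (hB.mem_source z hz) (hG.contMDiff _)
    have hinv : (chartAt Plane s₀).symm (chartAt Plane s₀ s₀) = s₀ :=
      (chartAt Plane s₀).left_inv (mem_chart_source _ _)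
    have htr : ∀ {p : Plane → Prop}, (∀ᶠ z in 𝓝 (chartAt Plane s₀ s₀), p z) →
        ∀ᶠ s in 𝓝 s₀, s ∈ (chartAt Plane s₀).source ∧ chartAt Plane s₀ s ∈ B ∧
          p (chartAt Plane s₀ s) := fun hp =>
      (eventually_mem_set.2 ((chartAt Plane s₀).open_source.mem_nhds (mem_chart_source _ _))).and
        (((chartAt Plane s₀).continuousAt (mem_chart_source _ _)).eventually
          ((eventually_mem_set.2 (hB.isOpen.mem_nhds hz₀)).and hp))
    constructor
    · intro h
      have h1 := (hiff _ hz₀).2 (by rwa [hinv])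
      have hc := (continuousOn_surfaceVert 0 1 fun z hz => contDiffAt_localRep
        (hB.subset_target hz) (hB.mem_source z hz) (hG.contMDiff _)).continuousAt
        (hB.isOpen.mem_nhds hz₀)
      filter_upwards [htr (hc.eventually_ne h1)] with s hs
      have h2 := (hiff _ hs.2.1).1 hs.2.2
      rwa [(chartAt Plane s₀).left_inv hs.1] at h2
    · intro h
      have h1 : surfaceVert 0 1 (localRep (G s₀).1 s₀ G) (chartAt Plane s₀ s₀) = 0 := by
        by_contra h1
        have h2 := (hiff _ hz₀).1 h1
        rw [hinv] at h2
        exact h h2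
      filter_upwards [htr (hB.eventually_surfaceVert_eq_zero hgraph hcurv hG hz₀ h1)] with s hs h2
      refine (hiff _ hs.2.1).2 ?_ hs.2.2
      rwa [(chartAt Plane s₀).left_inv hs.1]
  have hclopen : IsClopen {s | IsTransverse G s} :=
    ⟨isOpen_compl_iff.1 (isOpen_iff_mem_nhds.2 fun s hs => (key s).2 hs),
      isOpen_iff_mem_nhds.2 fun s hs => (key s).1 hs⟩
  rcases isClopen_iff.1 hclopen with h | h
  · exact Or.inr fun s hs => by simpa [h] using show s ∈ {s | IsTransverse G s} from hs
  · exact Or.inl fun s => by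
      have hs : s ∈ {s | IsTransverse G s} := h ▸ mem_univ s
      exact hs

end Clopen

end Transverse

/-! ### Unit normal vectors -/

/-- The components of the unit normal with conormal `t.1 × t.2`. -/
noncomputable def unitNormalCoords (κ : MetricCoeffs) (t : (Plane × ℝ) × (Plane × ℝ)) : Plane × ℝ :=
  ((√(conormalSq κ 0 1 t.1 t.2))⁻¹ •
    ((κ.1 0 0 * crossFst 1 t.1 t.2 + κ.1 0 1 * crossSnd 0 t.1 t.2) • planeVec 0 +
      (κ.1 1 0 * crossFst 1 t.1 t.2 + κ.1 1 1 * crossSnd 0 t.1 t.2) • planeVec 1),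
    (√(conormalSq κ 0 1 t.1 t.2))⁻¹ * crossVert 0 1 t.1 t.2)

lemma continuousAt_unitNormalCoords {κ : MetricCoeffs} {t : (Plane × ℝ) × (Plane × ℝ)}
    (h : 0 < conormalSq κ 0 1 t.1 t.2) :
    ContinuousAt (fun x : MetricCoeffs × (Plane × ℝ) × (Plane × ℝ) => unitNormalCoords x.1 x.2)
      (κ, t) := by
  have h1 : ContinuousAt (fun x : MetricCoeffs × (Plane × ℝ) × (Plane × ℝ) =>
      (√(conormalSq x.1 0 1 x.2.1 x.2.2))⁻¹) (κ, t) :=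
    (continuous_conormalSq 0 1).continuousAt.sqrt.inv₀ (Real.sqrt_pos.2 h).ne'
  unfold unitNormalCoords
  refine ContinuousAt.prodMk (h1.smul (Continuous.continuousAt ?_))
    (h1.mul (Continuous.continuousAt ?_))
  · unfold crossFst crossSnd; fun_prop
  · unfold crossVert; fun_prop

section UnitNormal

variable {N : Type*} [TopologicalSpace N] [ChartedSpace (EuclideanSpace ℝ (Fin 2)) N]
  {S : Type*} [TopologicalSpace S] [ChartedSpace (EuclideanSpace ℝ (Fin 2)) S]

variable {F : S → N × ℝ} {s : S}

lemma IsTransverse.surjective (h : IsTransverse F s) (ξ : TangentSpace (𝓡 2) (F s).1) :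
    ∃ w, (pushVec F s w).1 = ξ := by
  let T : Plane →ₗ[ℝ] Plane := (mfderiv (𝓡 2) (𝓡 2) (fun t => (F t).1) s).toLinearMap
  have hT : Function.Injective T := (injective_iff_map_eq_zero T).2 h
  exact LinearMap.injective_iff_surjective.1 hT ξ

section Pointwise

variable [RiemannianBundle (fun x : N => TangentSpace (𝓡 2) x)]

/-- `V` is a unit vector normal to the surface parametrized by `F` at `s`. -/
def IsUnitNormalAt (F : S → N × ℝ) (s : S) (V : TangentSpace (𝓡 2) (F s).1 × ℝ) : Prop :=
  prodMetric V V = 1 ∧ ∀ w, prodMetric V (pushVec F s w) = 0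

/-- The tangent plane projects onto the tangent space of `N`; pairing `V` with the tangent vector
above `V.1` gives `|V.1|² = 0`. -/
lemma IsTransverse.fst_eq_zero (h : IsTransverse F s) {V : TangentSpace (𝓡 2) (F s).1 × ℝ}
    (hV : ∀ w, prodMetric V (pushVec F s w) = 0) (h0 : V.2 = 0) : V.1 = 0 := by
  obtain ⟨w, hw⟩ := h.surjective V.1
  have h1 := hV w
  rw [prodMetric, hw, h0, zero_mul, add_zero] at h1
  exact inner_self_eq_zero.1 h1

lemma IsUnitNormalAt.snd_ne_zero {V : TangentSpace (𝓡 2) (F s).1 × ℝ} (hV : IsUnitNormalAt F s V)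
    (h : IsTransverse F s) : V.2 ≠ 0 := by
  intro h0
  have h1 := hV.1
  rw [prodMetric, h.fst_eq_zero hV.2 h0, h0, inner_zero_left] at h1
  norm_num at h1

/-- The combination `W.2 V - V.2 W` is normal with height zero, hence zero; unit length then fixes
the proportionality factor. This uniqueness is what glues the local normals. -/
lemma IsUnitNormalAt.eq_of_snd_pos {V W : TangentSpace (𝓡 2) (F s).1 × ℝ}
    (hV : IsUnitNormalAt F s V) (hW : IsUnitNormalAt F s W) (h : IsTransverse F s)
    (hV0 : 0 < V.2) (hW0 : 0 < W.2) : V = W := by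
  have h1 : W.2 • V.1 - V.2 • W.1 = 0 := h.fst_eq_zero
    (V := (W.2 • V.1 - V.2 • W.1, W.2 * V.2 - V.2 * W.2)) (fun w => by
      have a := hV.2 w
      have b := hW.2 w
      simp only [prodMetric] at a b ⊢
      rw [inner_sub_left, real_inner_smul_left, real_inner_smul_left]
      linear_combination W.2 * a - V.2 * b) (by ring)
  have h2 : W.2 • V.1 = V.2 • W.1 := sub_eq_zero.1 h1
  have h3 : W.2 ^ 2 = V.2 ^ 2 := by
    have a := hV.1
    have b := hW.1
    have c := congrArg (fun ξ => inner ℝ ξ ξ) h2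
    simp only [prodMetric, real_inner_smul_left, real_inner_smul_right] at a b c
    linear_combination -W.2 ^ 2 * a + V.2 ^ 2 * b + c
  have h4 : W.2 = V.2 := (sq_eq_sq₀ hW0.le hV0.le).1 h3
  rw [h4] at h2
  exact Prod.ext (smul_right_injective _ hV0.ne' h2) h4.symm

/-- At such a point a nonzero vertical vector is tangent, so every normal is horizontal. -/
lemma IsC2Immersion.snd_eq_zero_of_not_isTransverse {G : S → N × ℝ} (hG : IsC2Immersion G)
    (h : ¬ IsTransverse G s) {V : TangentSpace (𝓡 2) (G s).1 × ℝ} (hV : IsUnitNormalAt G s V) :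
    V.2 = 0 := by
  unfold IsTransverse at h
  push Not at h
  obtain ⟨w, hw, hw0⟩ := h
  have h1 := hV.2 w
  rw [prodMetric, hw, inner_zero_right, zero_add] at h1
  refine (mul_eq_zero.1 h1).resolve_right fun h2 => hw0 (hG.injective_pushVec (Prod.ext hw h2))

end Pointwise

section Limits

variable [IsManifold (𝓡 2) 1 N]

lemma tendsto_chartLift {α : Type*} {l : Filter α} {x₀ x : N} {y : α → N} {w : α → Plane}
    {v : Plane} (hx : x ∈ (chartAt Plane x₀).source) (hy : Tendsto y l (𝓝 x))
    (hw : Tendsto w l (𝓝 v)) :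
    Tendsto (fun n => (⟨y n, chartLift x₀ (y n) (w n)⟩ : TangentBundle (𝓡 2) N)) l
      (𝓝 ⟨x, chartLift x₀ x v⟩) := by
  let e := trivializationAt Plane (TangentSpace (𝓡 2) : N → Type _) x₀
  have hx' : x ∈ e.baseSet := by simpa [e] using hx
  have h := e.continuousOn_symm.continuousAt (x := (x, v))
    ((e.open_baseSet.prod isOpen_univ).mem_nhds ⟨hx', mem_univ _⟩)
  have h1 := h.tendsto.comp (hy.prodMk_nhds hw)
  have h2 : ∀ {b : N}, b ∈ e.baseSet → ∀ c : Plane, e.symm b c = chartLift x₀ b c :=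
    fun hb c => (e.symmL_apply hb c).symm
  rw [h2 hx'] at h1
  refine h1.congr' ?_
  filter_upwards [hy.eventually_mem (e.open_baseSet.mem_nhds hx')] with n hn
  simp only [Function.comp_apply, h2 hn]

/-- Read in the trivialization at `x`, the claim is uniqueness of limits in the model fibre. -/
lemma tangentBundle_tendsto_unique {α : Type*} {l : Filter α} [l.NeBot] {x : N}
    {a b : TangentSpace (𝓡 2) x} {p q : α → TangentBundle (𝓡 2) N}
    (ha : Tendsto p l (𝓝 ⟨x, a⟩)) (hb : Tendsto q l (𝓝 ⟨x, b⟩)) (h : p =ᶠ[l] q) : a = b := by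
  let e := trivializationAt Plane (TangentSpace (𝓡 2) : N → Type _) x
  have hx : x ∈ e.baseSet := mem_baseSet_trivializationAt _ _ _
  have hc : ∀ c : TangentSpace (𝓡 2) x, ContinuousAt e (⟨x, c⟩ : TangentBundle (𝓡 2) N) :=
    fun c => e.continuousAt (e.mem_source.2 hx)
  have h1 := ((continuous_snd.tendsto _).comp (hc a).tendsto).comp ha
  have h2 := ((continuous_snd.tendsto _).comp (hc b).tendsto).comp (hb.congr' h.symm)
  have h3 := tendsto_nhds_unique h1 h2
  rw [← e.symm_apply_apply_mk hx a, ← e.symm_apply_apply_mk hx b]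
  exact congrArg _ h3

end Limits

section LocalNormal

variable {x₀ : N} {s₀ : S} {σ : ℝ}

lemma fderiv_localRep_chartAt [IsManifold (𝓡 2) ∞ N] [IsManifold (𝓡 2) 2 S]
    (hs : s ∈ (chartAt Plane s₀).source)
    (hx : (F s).1 ∈ (chartAt Plane x₀).source)
    (hF : ContMDiffAt (𝓡 2) ((𝓡 2).prod 𝓘(ℝ, ℝ)) 2 F s) (v : Plane) :
    fderiv ℝ (localRep x₀ s₀ F) (chartAt Plane s₀ s) v =
      (chartCoord x₀ (F s).1 (pushVec F s (chartLift s₀ s v)).1,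
        (pushVec F s (chartLift s₀ s v)).2) := by
  have h := fderiv_localRep (x₀ := x₀) (F := F) ((chartAt Plane s₀).map_source hs)
    (by rwa [(chartAt Plane s₀).left_inv hs]) (by rwa [(chartAt Plane s₀).left_inv hs]) v
  rwa [(chartAt Plane s₀).left_inv hs] at h

variable [RiemannianBundle (fun x : N => TangentSpace (𝓡 2) x)] [IsManifold (𝓡 2) ∞ N]

/-- The components of the unit normal of the surface parametrized by `F`, computed in charts. -/
noncomputable def localNormalCoords (x₀ : N) (s₀ : S) (F : S → N × ℝ) (z : Plane) : Plane × ℝ :=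
  unitNormalCoords (chartCoeffs (chartAt Plane x₀) (localRep x₀ s₀ F z).1)
    (tangentPair (localRep x₀ s₀ F) z)

/-- The unit normal of the surface parametrized by `F`, computed in charts, with orientation `σ`. -/
noncomputable def localNormal (x₀ : N) (s₀ : S) (σ : ℝ) (F : S → N × ℝ) (s : S) :
    TangentSpace (𝓡 2) (F s).1 × ℝ :=
  (chartLift x₀ (F s).1 (σ • (localNormalCoords x₀ s₀ F (chartAt Plane s₀ s)).1),
    σ * (localNormalCoords x₀ s₀ F (chartAt Plane s₀ s)).2)

/-- The horizontal components arise by raising the index of the conormal with the inverse metric;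
the inner product lowers it again. -/
lemma inner_unitNormalCoords {x : N} (hx : x ∈ (chartAt Plane x₀).source)
    (t : (Plane × ℝ) × (Plane × ℝ)) (w : Plane) :
    inner ℝ (chartLift x₀ x (unitNormalCoords (chartCoeffs (chartAt Plane x₀)
      (chartAt Plane x₀ x)) t).1) (chartLift x₀ x w) =
    (√(conormalSq (chartCoeffs (chartAt Plane x₀) (chartAt Plane x₀ x)) 0 1 t.1 t.2))⁻¹ *
      (crossFst 1 t.1 t.2 * w 0 + crossSnd 0 t.1 t.2 * w 1) := by
  have hy := (chartAt Plane x₀).map_source hx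
  have hg : ∀ i j, frameMetric x₀ x i j =
      metricMatrix (chartAt Plane x₀) (chartAt Plane x₀ x) i j := fun i j => by
    rw [metricMatrix_eq_frameMetric hy, (chartAt Plane x₀).left_inv hx]
  have hinv := Matrix.mul_nonsing_inv _ (metricMatrix_det_pos hy).ne'.isUnit
  have e := fun i j => congrFun (congrFun hinv i) j
  simp only [Matrix.mul_apply, Fin.sum_univ_two] at e
  have e00 := e 0 0
  have e01 := e 0 1
  have e10 := e 1 0
  have e11 := e 1 1
  have hc := metricMatrix_comm (chartAt Plane x₀) (chartAt Plane x₀ x) 1 0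
  simp only [Matrix.one_apply, if_true, Fin.isValue, zero_ne_one, one_ne_zero, if_false] at e00 e01 e10 e11
  rw [inner_chartLift]
  simp only [hg, unitNormalCoords, Fin.sum_univ_two, hc] at *
  generalize (√(conormalSq (chartCoeffs (chartAt Plane x₀) (chartAt Plane x₀ x)) 0 1 t.1 t.2))⁻¹ = M
  simp only [chartCoeffs]
  generalize crossFst 1 t.1 t.2 = m₁
  generalize crossSnd 0 t.1 t.2 = m₂
  simp
  linear_combination M * w 0 * (m₁ * e00 + m₂ * e01) + M * w 1 * (m₁ * e10 + m₂ * e11)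

variable [IsManifold (𝓡 2) 2 S]

/-- The vector is divided by the length of the conormal, and orthogonality is the vanishing of the
triple products of `t₁ × t₂` with `t₁` and `t₂`. -/
lemma isUnitNormalAt_localNormal (hs : s ∈ (chartAt Plane s₀).source)
    (hx : (F s).1 ∈ (chartAt Plane x₀).source)
    (hF : ContMDiffAt (𝓡 2) ((𝓡 2).prod 𝓘(ℝ, ℝ)) 2 F s)
    (hreg : IsRegularPair (tangentPair (localRep x₀ s₀ F) (chartAt Plane s₀ s))) (hσ : |σ| = 1) :
    IsUnitNormalAt F s (localNormal x₀ s₀ σ F s) := by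
  have hy := (chartAt Plane x₀).map_source hx
  have hσ2 : σ ^ 2 = 1 := by rw [← sq_abs, hσ, one_pow]
  have hrep : (localRep x₀ s₀ F (chartAt Plane s₀ s)).1 = chartAt Plane x₀ (F s).1 := by
    simp only [localRep, (chartAt Plane s₀).left_inv hs]
  have hp := inv_metricMatrix_pos hy zero_ne_one
  have hpos := conormalSq_pos (κ := chartCoeffs (chartAt Plane x₀) (chartAt Plane x₀ (F s).1))
    zero_ne_one hreg hp.1 hp.2
  have hin := inner_unitNormalCoords hx (tangentPair (localRep x₀ s₀ F) (chartAt Plane s₀ s))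
  have hsymm : (chartCoeffs (chartAt Plane x₀) (chartAt Plane x₀ (F s).1)).1 1 0 =
      (chartCoeffs (chartAt Plane x₀) (chartAt Plane x₀ (F s).1)).1 0 1 :=
    inv_metricMatrix_comm _ _ _ _
  unfold localNormal localNormalCoords
  rw [hrep]
  constructor
  · simp only [prodMetric, map_smul, real_inner_smul_left, real_inner_smul_right]
    rw [hin]
    have hM := Real.sq_sqrt hpos.le
    have hM0 := (Real.sqrt_pos.2 hpos).ne'
    simp only [unitNormalCoords, hsymm]
    set M := √(conormalSq (chartCoeffs (chartAt Plane x₀) (chartAt Plane x₀ (F s).1)) 0 1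
      (tangentPair (localRep x₀ s₀ F) (chartAt Plane s₀ s)).1
      (tangentPair (localRep x₀ s₀ F) (chartAt Plane s₀ s)).2) with hMdef
    have hMM : M⁻¹ ^ 2 * M ^ 2 = 1 := by
      rw [← mul_pow, inv_mul_cancel₀ hM0, one_pow]
    rw [hM] at hMM
    unfold conormalSq at hMM
    simp
    linear_combination hσ2 + σ ^ 2 * hMM
  · intro w
    have hd := fderiv_localRep_chartAt hs hx hF (chartCoord s₀ s w)
    rw [chartLift_chartCoord hs] at hd
    have hd1 : (pushVec F s w).1 = chartLift x₀ (F s).1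
        (fderiv ℝ (localRep x₀ s₀ F) (chartAt Plane s₀ s) (chartCoord s₀ s w)).1 := by
      rw [hd, chartLift_chartCoord hx]
    have hd2 : (pushVec F s w).2 =
        (fderiv ℝ (localRep x₀ s₀ F) (chartAt Plane s₀ s) (chartCoord s₀ s w)).2 := by
      rw [hd]
    rw [prodMetric, hd1, hd2,
      fderiv_apply_eq_sum (fderiv ℝ (localRep x₀ s₀ F) (chartAt Plane s₀ s))]
    simp only [map_smul, real_inner_smul_left]
    rw [hin]
    simp only [unitNormalCoords, Fin.sum_univ_two]
    simp [crossFst, crossSnd, crossVert, tangentPair, tangentAt]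
    ring

end LocalNormal

end UnitNormal

/-! ### The global unit normal field as a limit of upward normals. -/

section NormalField

variable {N : Type*} [TopologicalSpace N] [ChartedSpace (EuclideanSpace ℝ (Fin 2)) N]
  {S : Type*} [TopologicalSpace S] [ChartedSpace (EuclideanSpace ℝ (Fin 2)) S]
  [RiemannianBundle (fun x : N => TangentSpace (𝓡 2) x)]

lemma angleFunction_eq_snd (F : S → N × ℝ) (ν : ∀ s : S, TangentSpace (𝓡 2) (F s).1 × ℝ) (s : S) :
    angleFunction F ν s = (ν s).2 := by
  simp [angleFunction, prodMetric]

variable [IsManifold (𝓡 2) ∞ N]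

lemma IsUnitNormal.isUnitNormalAt {F : S → N × ℝ}
    {ν : ∀ s : S, TangentSpace (𝓡 2) (F s).1 × ℝ} (h : IsUnitNormal F ν) (s : S) :
    IsUnitNormalAt F s (ν s) :=
  ⟨h.unit s, h.normal s⟩

variable [IsManifold (𝓡 2) 2 S]
  [IsContMDiffRiemannianBundle (𝓡 2) ∞ (EuclideanSpace ℝ (Fin 2))
      (fun x : N => TangentSpace (𝓡 2) x)]
  {Ω : ℕ → Set N} {u : ℕ → N → ℝ} {F : ℕ → S → N × ℝ} {G : S → N × ℝ}

section Patch

variable {x₀ : N} {s₀ s : S} {σ : ℝ} {B : Set Plane}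

lemma IsGraphPatch.continuousAt_unitNormalCoords (hB : IsGraphPatch x₀ s₀ Ω u F G B)
    (hG : IsC2Immersion G) {z : Plane} (hz : z ∈ B) :
    ContinuousAt (fun x : MetricCoeffs × (Plane × ℝ) × (Plane × ℝ) => unitNormalCoords x.1 x.2)
      (chartCoeffs (chartAt Plane x₀) (localRep x₀ s₀ G z).1,
        tangentPair (localRep x₀ s₀ G) z) :=
  _root_.continuousAt_unitNormalCoords (hB.surfaceConormalSq_pos hG hz zero_ne_one)

lemma IsGraphPatch.continuousAt_chartCoeffs (hB : IsGraphPatch x₀ s₀ Ω u F G B) {z : Plane}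
    (hz : z ∈ B) : ContinuousAt (chartCoeffs (chartAt Plane x₀)) (localRep x₀ s₀ G z).1 :=
  (contDiffAt_chartCoeffs ((chartAt Plane x₀).map_source (hB.mem_source z hz))).continuousAt

lemma IsGraphPatch.continuousAt_localNormalCoords (hB : IsGraphPatch x₀ s₀ Ω u F G B)
    (hG : IsC2Immersion G) {z : Plane} (hz : z ∈ B) :
    ContinuousAt (localNormalCoords x₀ s₀ G) z := by
  have hf := contDiffAt_localRep (hB.subset_target hz) (hB.mem_source z hz) (hG.contMDiff _)
  have h1 := hf.differentiableAt_fderiv.continuousAt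
  have h2 : ContinuousAt (fun z => chartCoeffs (chartAt Plane x₀) (localRep x₀ s₀ G z).1) z :=
    ContinuousAt.comp (f := fun z => (localRep x₀ s₀ G z).1)
      (hB.continuousAt_chartCoeffs hz) hf.fst.continuousAt
  have h3 : ContinuousAt (tangentPair (localRep x₀ s₀ G)) z :=
    (h1.clm_apply continuousAt_const).prodMk (h1.clm_apply continuousAt_const)
  exact ContinuousAt.comp (f := fun z => (chartCoeffs (chartAt Plane x₀) (localRep x₀ s₀ G z).1,
    tangentPair (localRep x₀ s₀ G) z)) (hB.continuousAt_unitNormalCoords hG hz) (h2.prodMk h3)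

lemma IsGraphPatch.tendsto_localNormalCoords (hB : IsGraphPatch x₀ s₀ Ω u F G B)
    (hG : IsC2Immersion G) {z : Plane} (hz : z ∈ B) :
    Tendsto (fun n => localNormalCoords x₀ s₀ (F n) z) atTop (𝓝 (localNormalCoords x₀ s₀ G z)) := by
  have h := hB.tendstoJet z hz
  have h1 := (h.coeffs (hB.continuousAt_chartCoeffs hz)).prodMk_nhds
    ((h.tangent 0).prodMk_nhds (h.tangent 1))
  have h2 := (hB.continuousAt_unitNormalCoords hG hz).tendsto
  exact Tendsto.comp (f := fun n => (chartCoeffs (chartAt Plane x₀) (localRep x₀ s₀ (F n) z).1,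
    tangentPair (localRep x₀ s₀ (F n)) z)) h2 h1

/-- The upward unit normals of the graphs converge to the unit normal of the limit surface. -/
lemma IsGraphPatch.tendsto_localNormal (hB : IsGraphPatch x₀ s₀ Ω u F G B)
    (hG : IsC2Immersion G) (hs : s ∈ (chartAt Plane s₀).source) (hz : chartAt Plane s₀ s ∈ B) :
    Tendsto (fun n => (⟨(F n s).1, (localNormal x₀ s₀ σ (F n) s).1⟩ : TangentBundle (𝓡 2) N))
      atTop (𝓝 ⟨(G s).1, (localNormal x₀ s₀ σ G s).1⟩) ∧
    Tendsto (fun n => (localNormal x₀ s₀ σ (F n) s).2) atTop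
      (𝓝 (localNormal x₀ s₀ σ G s).2) := by
  have h := hB.tendsto_localNormalCoords hG hz
  have hx := hB.mem_source _ hz
  rw [(chartAt Plane s₀).left_inv hs] at hx
  exact ⟨tendsto_chartLift hx (hB.tendsto_fst hs hz)
    (((continuous_fst.tendsto _).comp h).const_smul σ),
    ((continuous_snd.tendsto _).comp h).const_mul σ⟩

lemma IsGraphPatch.continuousAt_localNormal (hB : IsGraphPatch x₀ s₀ Ω u F G B)
    (hG : IsC2Immersion G) (hs : s ∈ (chartAt Plane s₀).source) (hz : chartAt Plane s₀ s ∈ B) :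
    ContinuousAt (fun s => (⟨(G s).1, (localNormal x₀ s₀ σ G s).1⟩ : TangentBundle (𝓡 2) N)) s ∧
    ContinuousAt (fun s => (localNormal x₀ s₀ σ G s).2) s := by
  have h : Tendsto (fun s => localNormalCoords x₀ s₀ G (chartAt Plane s₀ s)) (𝓝 s)
      (𝓝 (localNormalCoords x₀ s₀ G (chartAt Plane s₀ s))) :=
    (hB.continuousAt_localNormalCoords hG hz).tendsto.comp ((chartAt Plane s₀).continuousAt hs)
  have hx := hB.mem_source _ hz
  rw [(chartAt Plane s₀).left_inv hs] at hx
  exact ⟨tendsto_chartLift hx ((continuous_fst.comp hG.contMDiff.continuous).tendsto s)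
    (((continuous_fst.tendsto _).comp h).const_smul σ),
    ((continuous_snd.tendsto _).comp h).const_mul σ⟩

lemma IsGraphPatch.isUnitNormalAt_localNormal (hB : IsGraphPatch x₀ s₀ Ω u F G B)
    (hG : IsC2Immersion G) (hs : s ∈ (chartAt Plane s₀).source) (hz : chartAt Plane s₀ s ∈ B)
    (hσ : |σ| = 1) : IsUnitNormalAt G s (localNormal x₀ s₀ σ G s) := by
  have hx := hB.mem_source _ hz
  have hreg := isRegularPair_of_injective
    (hG.injective_fderiv_localRep (hB.subset_target hz) (hB.mem_source _ hz))
  rw [(chartAt Plane s₀).left_inv hs] at hx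
  exact _root_.isUnitNormalAt_localNormal hs hx (hG.contMDiff s) hreg hσ

/-- The normals of the graphs with the orientation of the patch are the upward unit normals. -/
lemma IsGraphPatch.eventually_isUnitNormalAt (hB : IsGraphPatch x₀ s₀ Ω u F G B)
    {𝒰 : Ultrafilter ℕ} (h𝒰 : (𝒰 : Filter ℕ) ≤ atTop) (hσ : |σ| = 1)
    (hsign : ∀ᶠ n in 𝒰, ∀ z ∈ B, 0 < σ * surfaceVert 0 1 (localRep x₀ s₀ (F n)) z)
    (hs : s ∈ (chartAt Plane s₀).source) (hz : chartAt Plane s₀ s ∈ B) :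
    ∀ᶠ n in 𝒰, IsTransverse (F n) s ∧ IsUnitNormalAt (F n) s (localNormal x₀ s₀ σ (F n) s) ∧
      0 < (localNormal x₀ s₀ σ (F n) s).2 := by
  filter_upwards [h𝒰 hB.graphPoint, hsign] with n hn hn'
  have hg := hn _ hz
  have hmem := hg.mem_source
  have hcont := hg.contMDiffAt
  have hreg := hg.regular
  have htr := (surfaceVert_ne_zero_iff (hB.subset_target hz) hmem hcont).1
    (right_ne_zero_of_mul (hn' _ hz).ne')
  have hp := inv_metricMatrix_pos hg.fst_mem_target zero_ne_one
  have hpos := conormalSq_pos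
    (κ := chartCoeffs (chartAt Plane x₀) (localRep x₀ s₀ (F n) (chartAt Plane s₀ s)).1)
    zero_ne_one hreg hp.1 hp.2
  rw [(chartAt Plane s₀).left_inv hs] at hmem hcont htr
  refine ⟨htr, _root_.isUnitNormalAt_localNormal hs hmem hcont hreg hσ, ?_⟩
  have h1 := mul_pos (inv_pos.2 (Real.sqrt_pos.2 hpos)) (hn' _ hz)
  refine h1.trans_eq ?_
  simp only [localNormal, localNormalCoords, unitNormalCoords, surfaceVert, tangentPair]
  ring

end Patch

/-- The limit surface has a continuous unit normal field which is nowhere pointing downwards. -/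
theorem exists_isUnitNormal_nonneg (hgraph : ∀ n, IsSmoothGraph (Ω n) (u n))
    (hG : IsC2Immersion G)
    (hF : ∀ K : Set S, IsCompact K → ∀ᶠ n in atTop, MapsTo (F n) K (graphOver (Ω n) (u n)))
    (hconv : TendstoLocC2 (𝓡 2) ((𝓡 2).prod 𝓘(ℝ, ℝ)) F G) :
    ∃ ν, IsUnitNormal G ν ∧ ∀ s, 0 ≤ (ν s).2 := by
  choose B hzB hB using exists_isGraphPatch (Ω := Ω) (u := u) hG hF hconv
  choose σ hσ hsign using fun s => (hB s).exists_sign hgraph Nat.hyperfilter_le_atTop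
  have hsrc : ∀ s : S, s ∈ (chartAt Plane s).source := fun s => mem_chart_source _ _
  -- Each point uses its own patch and sign; continuity comes only from the agreement with the
  -- neighbouring patches shown next.
  let ν : ∀ s : S, TangentSpace (𝓡 2) (G s).1 × ℝ := fun s => localNormal (G s).1 s (σ s) G s
  have key : ∀ s₀ : S, ∀ᶠ s in 𝓝 s₀, localNormal (G s₀).1 s₀ (σ s₀) G s = ν s := by
    intro s₀
    filter_upwards [(chartAt Plane s₀).open_source.mem_nhds (hsrc s₀),
      ((chartAt Plane s₀).continuousAt (hsrc s₀)).preimage_mem_nhds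
        ((hB s₀).isOpen.mem_nhds (hzB s₀))] with s hs hz
    have h1 := (hB s₀).eventually_isUnitNormalAt Nat.hyperfilter_le_atTop (hσ s₀)
      (hsign s₀) hs hz
    have h2 := (hB s).eventually_isUnitNormalAt Nat.hyperfilter_le_atTop (hσ s)
      (hsign s) (hsrc s) (hzB s)
    -- Both candidates are the upward unit normal of `F n` at `s`, which is unique. Since all signs
    -- were chosen along the same ultrafilter, the agreement passes to the limit, even at vertical
    -- points of `G`.
    have heq : ∀ᶠ n in hyperfilter ℕ, localNormal (G s₀).1 s₀ (σ s₀) (F n) s =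
        localNormal (G s).1 s (σ s) (F n) s := by
      filter_upwards [h1, h2] with n hn hn'
      exact hn.2.1.eq_of_snd_pos hn'.2.1 hn.1 hn.2.2 hn'.2.2
    obtain ⟨l1, l1'⟩ := (hB s₀).tendsto_localNormal (σ := σ s₀) hG hs hz
    obtain ⟨l2, l2'⟩ := (hB s).tendsto_localNormal (σ := σ s) hG (hsrc s) (hzB s)
    refine Prod.ext ?_ ?_
    · exact tangentBundle_tendsto_unique (l1.mono_left Nat.hyperfilter_le_atTop)
        (l2.mono_left Nat.hyperfilter_le_atTop) (heq.mono fun n hn => by simp only [hn])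
    · exact tendsto_nhds_unique_of_eventuallyEq (l1'.mono_left Nat.hyperfilter_le_atTop)
        (l2'.mono_left Nat.hyperfilter_le_atTop) (heq.mono fun n hn => by simp only [hn])
  have hunit : ∀ s, IsUnitNormalAt G s (ν s) := fun s =>
    (hB s).isUnitNormalAt_localNormal hG (hsrc s) (hzB s) (hσ s)
  refine ⟨ν, ⟨continuous_iff_continuousAt.2 fun s₀ => ?_, continuous_iff_continuousAt.2 fun s₀ => ?_,
    fun s => (hunit s).1, fun s => (hunit s).2⟩, fun s => ?_⟩
  · exact ((hB s₀).continuousAt_localNormal (σ := σ s₀) hG (hsrc s₀) (hzB s₀)).1.congr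
      ((key s₀).mono fun s hs => by simp only [hs])
  · exact ((hB s₀).continuousAt_localNormal (σ := σ s₀) hG (hsrc s₀) (hzB s₀)).2.congr
      ((key s₀).mono fun s hs => by simp only [hs])
  · refine ge_of_tendsto (((hB s).tendsto_localNormal (σ := σ s) hG (hsrc s) (hzB s)).2.mono_left
      Nat.hyperfilter_le_atTop) ?_
    filter_upwards [(hB s).eventually_isUnitNormalAt Nat.hyperfilter_le_atTop (hσ s)
      (hsign s) (hsrc s) (hzB s)] with n hn using hn.2.2.le

end NormalField

/-! ### The dichotomy for the angle function. -/

theorem theorem2p3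
    {N : Type*} [EMetricSpace N] [ChartedSpace (EuclideanSpace ℝ (Fin 2)) N]
    [IsManifold (𝓡 2) ∞ N]
    [RiemannianBundle (fun x : N => TangentSpace (𝓡 2) x)]
    [IsContMDiffRiemannianBundle (𝓡 2) ∞ (EuclideanSpace ℝ (Fin 2))
      (fun x : N => TangentSpace (𝓡 2) x)]
    [IsRiemannianManifold (𝓡 2) N] [CompleteSpace N]
    {S : Type*} [TopologicalSpace S] [T2Space S] [ConnectedSpace S]
    [ChartedSpace (EuclideanSpace ℝ (Fin 2)) S] [IsManifold (𝓡 2) 2 S]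
    (Ω : ℕ → Set N) (u : ℕ → N → ℝ) (F : ℕ → S → N × ℝ) (G : S → N × ℝ)
    (hgraph : ∀ n, IsSmoothGraph (Ω n) (u n))
    (hcurv : (∀ n, IsMinimalGraph (Ω n) (u n)) ∨ (∀ n, IsCMCGraph (Ω n) (u n)) ∨
      (∀ n, IsTranslatingGraph (Ω n) (u n)))
    (hG : IsC2Immersion G)
    (hF : ∀ K : Set S, IsCompact K →
      ∀ᶠ n in atTop, MapsTo (F n) K (graphOver (Ω n) (u n)))
    (hconv : TendstoLocC2 (𝓡 2) ((𝓡 2).prod 𝓘(ℝ, ℝ)) F G) :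
    (∃ ν, IsUnitNormal G ν ∧
      ((∀ s, 0 < angleFunction G ν s) ∨ (∀ s, angleFunction G ν s = 0))) ∧
    (∀ ν, IsUnitNormal G ν →
      (∀ s, 0 < angleFunction G ν s) ∨ (∀ s, angleFunction G ν s < 0) ∨
        (∀ s, angleFunction G ν s = 0)) := by
  obtain ⟨ν₀, hν₀, hν₀'⟩ := exists_isUnitNormal_nonneg hgraph hG hF hconv
  simp only [angleFunction_eq_snd]
  rcases forall_isTransverse_or_forall_not hgraph hcurv hG hF hconv with h | h
  -- In the transverse case no unit normal is horizontal: the nonnegative height of `ν₀` is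
  -- positive, and that of any continuous normal has a constant sign on the connected surface.
  · refine ⟨⟨ν₀, hν₀, Or.inl fun s =>
      (hν₀' s).lt_of_ne' ((hν₀.isUnitNormalAt s).snd_ne_zero (h s))⟩, fun ν hν => ?_⟩
    have h1 := isPreconnected_univ.forall_pos_or_forall_neg hν.continuous_vertical.continuousOn
      fun s _ => (hν.isUnitNormalAt s).snd_ne_zero (h s)
    exact h1.imp (fun h2 s => h2 s (mem_univ s)) fun h2 => Or.inl fun s => h2 s (mem_univ s)
  · have h1 : ∀ ν, IsUnitNormal G ν → ∀ s, (ν s).2 = 0 := fun ν hν s =>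
      hG.snd_eq_zero_of_not_isTransverse (h s) (hν.isUnitNormalAt s)
    exact ⟨⟨ν₀, hν₀, Or.inr (h1 ν₀ hν₀)⟩, fun ν hν => Or.inr (Or.inr (h1 ν hν))⟩
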